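/- Let $s_0,s_1,\dots$ be a computable bijective enumeration of the finite binary strings, and identify an oracle (a set $A$ of strings) with the point $a\in 2^\omega$ given by $a(n)=1 \iff s_n\in A$. For an oracle $A$ let $\mathbf{PSPACE}^A$ be the class of languages decided by deterministic oracle Turing machines with oracle $A$ in polynomial space, the query tape being subject to the space bound, and let $\mathbf{PH}^A$ be the class of languages $L$ for which there are $l,k\in\omega$ and an $(l+1)$-ary relation $R$ on strings, decidable in polynomial time relative to $A$, such that for all strings $y$ $$y\in L \iff \exists x_1\,\forall x_2\cdots Q x_l\; R(x_1,\dots,x_l,y),$$ where the quantifiers alternate and range over strings of length at most $|y|^k+k$. Let $$\mathbf{S}=\{A : \mathbf{PH}^A\neq \mathbf{PSPACE}^A\}\subseteq 2^\omega .$$ Then $\mathbf{S}$ is a (lightface) $\Pi^0_2$ set, that is, there is a recursively enumerable set $W\subseteq \omega\times 2^{<\omega}$ such that $a\in\mathbf{S}$ iff for every $n$ there is an initial segment $\sigma$ of $a$ with $(n,\sigma)\in W$. Therefore $\mathbf{S}$ is also boldface $\boldsymbol{\Pi}^0_2$ (a $G_\delta$ subset of the Cantor space $2^\omega$), and in particular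 Borel. -/

import Mathlib

/-! Deterministic multitape oracle Turing machines over the alphabet `{0, 1}` (the blank is `none`),
the relativized classes `PH` and `PSPACE`, and the lightface pointclass of effectively
`G_delta` subsets of Cantor space. -/

namespace OracleSep

/-- A string over the alphabet `{0, 1}`. -/
abbrev Str := List Bool

/-- The tapes of a machine with `m` input tapes and `k` work tapes. -/
inductive TapeIx (m k : ℕ) : Type
  | input (i : Fin m)
  | work (j : Fin k)
  | query

/-- What a machine does in a given state: halt (accepting or rejecting); query the oracle about the
word on the query tape and pass to one of two states according to the answer; or make an ordinary
move, which depends on the scanned symbols and gives the new state, the symbols to be written and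
the direction (`-1`, `0` or `1`) in which each head moves. -/
inductive Action (Q T : Type) : Type
  | halt (accept : Bool)
  | query (yes no : Q)
  | move (δ : (T → Option Bool) → Q × (T → Option Bool) × (T → SignType))

/-- A deterministic oracle Turing machine with `m` input tapes. -/
structure OracleTM (m : ℕ) where
  /-- the number of work tapes -/
  k : ℕ
  /-- the set of states -/
  State : Type
  finite_state : Finite State
  start : State
  act : State → Action State (TapeIx m k)

/-- A configuration; all tapes are infinite in both directions. -/
structure Cfg (Q T : Type) where
  state : Q
  tape : T → ℤ → Option Bool
  head : T → ℤ

/-- The tape with the string `w` in the cells `0, …, |w| - 1` and blanks elsewhere. -/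
def strTape (w : Str) : ℤ → Option Bool := fun z => if 0 ≤ z then w[z.toNat]? else none

/-- `w` is the word on the tape `t`: it stands in the cells `0, …, |w| - 1`, and the cell `|w|`
is blank. -/
def IsWordOn (t : ℤ → Option Bool) (w : Str) : Prop := ∀ i : ℕ, i ≤ w.length → t i = w[i]?

namespace OracleTM

variable {m : ℕ} (M : OracleTM m)

/-- The initial configuration: the inputs stand on the input tapes, all the other tapes are blank,
and all heads scan cell `0`. -/
def init (xs : Fin m → Str) : Cfg M.State (TapeIx m M.k) where
  state := M.start
  tape
    | .input i => strTape (xs i)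
    | .work _ => fun _ => none
    | .query => fun _ => none
  head := fun _ => 0

open Classical in
/-- One step relative to the oracle `A`; halting configurations do not change. -/
noncomputable def step (A : Set Str) (c : Cfg M.State (TapeIx m M.k)) :
    Cfg M.State (TapeIx m M.k) :=
  match M.act c.state with
  | .halt _ => c
  | .query yes no => { c with state := if ∃ w ∈ A, IsWordOn (c.tape .query) w then yes else no }
  | .move δ =>
    let r := δ (fun i => c.tape i (c.head i))
    { state := r.1
      tape := fun i => Function.update (c.tape i) (c.head i) (r.2.1 i)
      head := fun i => c.head i + (r.2.2 i : ℤ) }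

/-- The configuration after `t` steps on the inputs `xs`. -/
noncomputable def cfgAt (A : Set Str) (xs : Fin m → Str) (t : ℕ) : Cfg M.State (TapeIx m M.k) :=
  (M.step A)^[t] (M.init xs)

/-- On the inputs `xs` the machine has halted after at most `t` steps; it accepts iff `b = true`. -/
def HaltsBy (A : Set Str) (xs : Fin m → Str) (t : ℕ) (b : Bool) : Prop :=
  M.act (M.cfgAt A xs t).state = .halt b

/-- On the inputs `xs` no head, that of the query tape included, ever leaves the cells
`-s, …, s`. -/
def UsesSpace (A : Set Str) (xs : Fin m → Str) (s : ℕ) : Prop :=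
  ∀ t i, |(M.cfgAt A xs t).head i| ≤ (s : ℤ)

end OracleTM

/-- The relation `R` is decidable in polynomial time relative to `A`. -/
def PolyTimeRel (A : Set Str) {m : ℕ} (R : (Fin m → Str) → Prop) : Prop :=
  ∃ (M : OracleTM m) (c : ℕ), ∀ xs : Fin m → Str,
    ∃ b : Bool, M.HaltsBy A xs ((∑ i, (xs i).length) ^ c + c) b ∧ (b = true ↔ R xs)

/-- `l` alternating quantifiers over strings of length at most `n`, in front of `R`; the first one
is existential if `ex = true` and universal if `ex = false`. -/
def AltQuant (n : ℕ) : (l : ℕ) → (ex : Bool) → ((Fin l → Str) → Prop) → Prop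
  | 0, _, R => R Fin.elim0
  | l + 1, true, R => ∃ x : Str, x.length ≤ n ∧ AltQuant n l false (fun xs => R (Fin.cons x xs))
  | l + 1, false, R => ∀ x : Str, x.length ≤ n → AltQuant n l true (fun xs => R (Fin.cons x xs))

/-- The polynomial hierarchy relative to `A`: the languages that are defined by an expression
`∃ x₁ ∀ x₂ … Q x_l, R (y, x₁, …, x_l)` with polynomially bounded quantifiers and `R` decidable
in polynomial time relative to `A`. -/
def PH (A : Set Str) : Set (Set Str) :=
  {L | ∃ (l k : ℕ) (R : (Fin (l + 1) → Str) → Prop), PolyTimeRel A R ∧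
    ∀ y : Str, y ∈ L ↔ AltQuant (y.length ^ k + k) l true (fun xs => R (Fin.cons y xs))}

/-- The languages that are decidable in polynomial space relative to `A`. -/
def PSPACE (A : Set Str) : Set (Set Str) :=
  {L | ∃ (M : OracleTM 1) (c : ℕ), ∀ x : Str,
    M.UsesSpace A (fun _ => x) (x.length ^ c + c) ∧
    ∃ (t : ℕ) (b : Bool), M.HaltsBy A (fun _ => x) t b ∧ (b = true ↔ x ∈ L)}

/-- The oracle that a point `a` of Cantor space stands for, when the strings are enumerated as
`e 0, e 1, …`. -/
def oracleOf (e : ℕ ≃ Str) (a : ℕ → Bool) : Set Str := {x | a (e.symm x) = true}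

/-- The set of oracles that separate `PH` from `PSPACE`, as a subset of Cantor space. -/
def sepSet (e : ℕ ≃ Str) : Set (ℕ → Bool) := {a | PH (oracleOf e a) ≠ PSPACE (oracleOf e a)}

/-- Lightface `Σ⁰₁` subsets of `ω × 2^ω`: unions of recursively enumerable families of basic open
sets `{n} × {a | σ is an initial segment of a}`. -/
def LightfaceSigma01 (P : Set (ℕ × (ℕ → Bool))) : Prop :=
  ∃ W : ℕ × List Bool → Prop, REPred W ∧
    ∀ n a, (n, a) ∈ P ↔ ∃ σ : List Bool, W (n, σ) ∧ (List.range σ.length).map a = σ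

/-- Lightface `Π⁰₂` subsets of `2^ω`: the sets `{a | ∀ n, (n, a) ∈ P}` with `P` lightface
`Σ⁰₁`. -/
def LightfacePi02 (S : Set (ℕ → Bool)) : Prop :=
  ∃ P : Set (ℕ × (ℕ → Bool)), LightfaceSigma01 P ∧ ∀ a, a ∈ S ↔ ∀ n, (n, a) ∈ P

end OracleSep

/-! Relative to every oracle `A`, `PH A` is contained in `PSPACE A` (`PH_subset_PSPACE`), and
`PSPACE A` has a member `univ A`, defined uniformly in `A`, to which all its languages reduce by
polynomial padding maps (`univ_mem_pspace`, `exists_reduction_univ`). If `univ A` is in `PH A`,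
composing its defining formula with such a map puts every language of `PSPACE A` into `PH A`
(`PSPACE_subset_PH`). So the classes differ iff no formula of the hierarchy defines `univ A`.
Formulas in normal form are finite objects that do not mention `A`; hence `A` separates iff for
every formula there is a string `y` at which the formula disagrees with `univ A`
(`PH_ne_PSPACE_iff`). For a given formula and a given `y`, disagreement is decided by a primitive
recursive procedure from finitely many answers of the oracle (`Formula.primrecPred_errs`,
`Formula.errs_congr`). The existence of `y` is therefore `Σ⁰₁`, uniformly in the formula, and the
quantifier over formulas makes the set `Π⁰₂` (`mem_sepSet_iff`, `rePred_errsBy`).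

The labour lies in the normal form, since the classes are defined by machines with arbitrary finite
state types. Machines are replaced by sweeping machines: a bit string `P` serves as the table of an
automaton that passes to and fro over a word, replaces each bit, writes a query meanwhile and learns
the answer at the end of the sweep. The length of the word never changes, no query is longer than
the word, and the state is a number at most `P.length`. So bounds for space, for the use of the
oracle, and (by counting configurations, `verdict_two_pow`) for the number of sweeps are immediate,
and runs are easily seen to be primitive recursive.

Oracle machines become sweeping machines by laying all tapes on tracks of one word of cells; a left
sweep and a right sweep simulate one step (`sweepAut_verdict`), and letters are then coded by bits
(`exists_sweep_table`). Conversely, sweeping machines are run by programs of a small stack language,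
which is compiled to oracle machines in such a way that cost is the number of steps and the bound
for the registers is a bound for the heads (`leads_codeAct`). Together, `exists_sweepRel` and
`polyTimeRel_sweepRel` identify the polynomial-time relations with the relations `SweepRel`. The
same language provides the machines for quantifier evaluation (`ends_quantProg`), for `univ A`
(`ends_sweeps`) and for the composition with a reduction (`polyTimeRel_pad`). -/

namespace OracleSep

/-! ### A small while-language on stacks of bits -/

/-- Programs on registers indexed by `ι`, each of which holds a stack of bits. -/
inductive Prog (ι : Type) : Type
  | nop
  | push (i : ι) (b : Bool)
  | pop (i : ι) (pn pf pt : Prog ι)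
  | ask (p q : Prog ι)
  | seq (p q : Prog ι)
  | loop (i : ι) (c : Option Bool → Bool) (p : Prog ι)

open Function

variable {ι : Type} [DecidableEq ι]

/-- `Exec A qr B p s s' t`: with the oracle `A`, the query register `qr` and all registers bounded in
length by `B`, the program `p` leads from the store `s` to the store `s'` at cost `t`. -/
inductive Exec (A : Set Str) (qr : ι) (B : ℕ∞) : Prog ι → (ι → Str) → (ι → Str) → ℕ → Prop
  | nop (s) : Exec A qr B .nop s s 1
  | push (s i b) (h : ((s i).length : ℕ∞) < B) :
      Exec A qr B (.push i b) s (update s i (b :: s i)) 2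
  | pop_nil {s i pn pf pt s' t} (h : s i = []) (h1 : Exec A qr B pn s s' t) :
      Exec A qr B (.pop i pn pf pt) s s' (t + 1)
  | pop_cons {s i pn pf pt s' t} (b l) (h : s i = b :: l)
      (h1 : Exec A qr B (bif b then pt else pf) (update s i l) s' t) :
      Exec A qr B (.pop i pn pf pt) s s' (t + 1)
  | ask_yes {s p q s' t} (h : (s qr).reverse ∈ A) (h1 : Exec A qr B p s s' t) :
      Exec A qr B (.ask p q) s s' (t + 1)
  | ask_no {s p q s' t} (h : (s qr).reverse ∉ A) (h1 : Exec A qr B q s s' t) :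
      Exec A qr B (.ask p q) s s' (t + 1)
  | seq {p q s s1 s2 t1 t2} (h1 : Exec A qr B p s s1 t1) (h2 : Exec A qr B q s1 s2 t2) :
      Exec A qr B (.seq p q) s s2 (t1 + t2)
  | loop_done {i c p s} (h : c (s i).head? = false) : Exec A qr B (.loop i c p) s s 1
  | loop_step {i c p s s1 s2 t1 t2} (h : c (s i).head? = true) (h1 : Exec A qr B p s s1 t1)
      (h2 : Exec A qr B (.loop i c p) s1 s2 t2) :
      Exec A qr B (.loop i c p) s s2 (t1 + t2 + 1)

namespace Exec

variable {A : Set Str} {qr : ι} {B : ℕ∞} {p : Prog ι} {s s' : ι → Str} {t : ℕ}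

/-- Only `push` lengthens a register, by one symbol, and it costs more than that; so growth is
bounded by cost. -/
theorem length_le (h : Exec A qr B p s s' t) (N : ℕ) (hs : ∀ i, (s i).length ≤ N) :
    ∀ i, (s' i).length ≤ N + t := by
  induction h generalizing N with
  | nop s => intro i; have := hs i; omega
  | push s i b h =>
    intro j
    by_cases hj : j = i
    · subst hj; simp; have := hs j; omega
    · simp [hj]; have := hs j; omega
  | pop_nil h h1 ih => intro i; have := ih N hs i; omega
  | @pop_cons s i _ _ _ _ _ b l h h1 ih =>
    intro j
    have := ih N (fun j => ?_) j
    · omega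
    · by_cases hj : j = i
      · subst hj; have := hs j; simp [h] at this ⊢; omega
      · simp [hj, hs j]
  | ask_yes h h1 ih => intro i; have := ih N hs i; omega
  | ask_no h h1 ih => intro i; have := ih N hs i; omega
  | seq h1 h2 ih1 ih2 => intro i; have := ih2 _ (ih1 N hs) i; omega
  | loop_done h => intro i; have := hs i; omega
  | loop_step h h1 h2 ih1 ih2 => intro i; have := ih2 _ (ih1 N hs) i; omega

/-- Time bounds space. This allows programs to be analysed with the register bound `⊤`, a finite
bound being supplied afterwards from the cost. -/
theorem bounded (h : Exec A qr B p s s' t) (N : ℕ) (hs : ∀ i, (s i).length ≤ N) {B' : ℕ}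
    (hB : N + t ≤ B') : Exec A qr (B' : ℕ∞) p s s' t := by
  induction h generalizing N with
  | nop s => exact .nop s
  | push s i b h =>
    refine .push s i b ?_
    have := hs i
    exact_mod_cast (by omega : (s i).length < B')
  | pop_nil h h1 ih => exact .pop_nil h (ih N hs (by omega))
  | @pop_cons s i _ _ _ _ _ b l h h1 ih =>
    refine .pop_cons b l h (ih N (fun j => ?_) (by omega))
    by_cases hj : j = i
    · subst hj; have := hs j; simp [h] at this ⊢; omega
    · simp [hj, hs j]
  | ask_yes h h1 ih => exact .ask_yes h (ih N hs (by omega))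
  | ask_no h h1 ih => exact .ask_no h (ih N hs (by omega))
  | seq h1 h2 ih1 ih2 =>
    exact .seq (ih1 N hs (by omega)) (ih2 _ (h1.length_le N hs) (by omega))
  | loop_done h => exact .loop_done h
  | loop_step h h1 h2 ih1 ih2 =>
    exact .loop_step h (ih1 N hs (by omega)) (ih2 _ (h1.length_le N hs) (by omega))

end Exec

/-! ### Compilation to oracle Turing machines -/

namespace Prog



/-- The states of the machine for a program. -/
def Lab : Prog ι → Type
  | .nop => Unit
  | .push _ _ => Bool
  | .pop _ p q r => Option (Lab p ⊕ Lab q ⊕ Lab r)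
  | .ask p q => Option (Lab p ⊕ Lab q)
  | .seq p q => Lab p ⊕ Lab q
  | .loop _ _ p => Option (Lab p)

omit [DecidableEq ι] in
theorem finite_lab : ∀ p : Prog ι, Finite (Lab p)
  | .nop => inferInstanceAs (Finite Unit)
  | .push _ _ => inferInstanceAs (Finite Bool)
  | .pop _ p q r => by
    have := finite_lab p; have := finite_lab q; have := finite_lab r
    exact inferInstanceAs (Finite (Option (Lab p ⊕ Lab q ⊕ Lab r)))
  | .ask p q => by
    have := finite_lab p; have := finite_lab q
    exact inferInstanceAs (Finite (Option (Lab p ⊕ Lab q)))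
  | .seq p q => by
    have := finite_lab p; have := finite_lab q
    exact inferInstanceAs (Finite (Lab p ⊕ Lab q))
  | .loop _ _ p => by
    have := finite_lab p
    exact inferInstanceAs (Finite (Option (Lab p)))

/-- The first state of the machine for a program. -/
def first : (p : Prog ι) → Lab p
  | .nop => ()
  | .push _ _ => false
  | .pop _ _ _ _ => none
  | .ask _ _ => none
  | .seq p _ => .inl (first p)
  | .loop _ _ _ => none

end Prog

/-- The direction in which the stack on a tape grows. -/
def growth {m k : ℕ} : TapeIx m k → SignType
  | .query => 1
  | _ => -1

theorem growth_sq {m k : ℕ} (τ : TapeIx m k) : (growth τ : ℤ) * (growth τ : ℤ) = 1 := by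
  cases τ <;> simp [growth]

noncomputable instance {m k : ℕ} : DecidableEq (TapeIx m k) := Classical.decEq _

/-- The actions of the machine for a program, the states being renamed by `φ` and `e` being the state
in which the machine is left. -/
noncomputable def codeAct {m k : ℕ} (ψ : ι → TapeIx m k) {X : Type} :
    (p : Prog ι) → (Prog.Lab p → X) → X → Prog.Lab p → Action X (TapeIx m k)
  | .nop, _, e, _ => .move fun sc => (e, sc, 0)
  | .push i _, φ, _, false => .move fun sc => (φ true, sc, Pi.single (ψ i) (growth (ψ i)))
  | .push i b, _, e, true => .move fun sc => (e, update sc (ψ i) (some b), 0)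
  | .pop i p q r, φ, _, none => .move fun sc =>
      match sc (ψ i) with
      | none => (φ (some (.inl p.first)), sc, 0)
      | some b => (bif b then φ (some (.inr (.inr r.first))) else φ (some (.inr (.inl q.first))),
          update sc (ψ i) none, Pi.single (ψ i) (-growth (ψ i)))
  | .pop _ p _ _, φ, e, some (.inl l) => codeAct ψ p (fun x => φ (some (.inl x))) e l
  | .pop _ _ q _, φ, e, some (.inr (.inl l)) => codeAct ψ q (fun x => φ (some (.inr (.inl x)))) e l
  | .pop _ _ _ r, φ, e, some (.inr (.inr l)) => codeAct ψ r (fun x => φ (some (.inr (.inr x)))) e l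
  | .ask p q, φ, _, none => .query (φ (some (.inl p.first))) (φ (some (.inr q.first)))
  | .ask p _, φ, e, some (.inl l) => codeAct ψ p (fun x => φ (some (.inl x))) e l
  | .ask _ q, φ, e, some (.inr l) => codeAct ψ q (fun x => φ (some (.inr x))) e l
  | .seq p q, φ, _, .inl l => codeAct ψ p (fun x => φ (.inl x)) (φ (.inr q.first)) l
  | .seq _ q, φ, e, .inr l => codeAct ψ q (fun x => φ (.inr x)) e l
  | .loop i c p, φ, e, none => .move fun sc =>
      (bif c (sc (ψ i)) then φ (some p.first) else e, sc, 0)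
  | .loop _ _ p, φ, _, some l => codeAct ψ p (fun x => φ (some x)) (φ none) l

/-- The tape with the stack `l` on it, the bottom of the stack standing in the cell `a`. -/
def stackTape (a d : ℤ) (l : Str) : ℤ → Option Bool := fun z =>
  if 0 ≤ (z - a) * d then l.reverse[((z - a) * d).toNat]? else none

/-- The head of a stack tape rests on the top symbol. For the empty stack this is the blank cell
just below the bottom, so the scanned symbol is `l.head?` in all cases. -/
theorem stackTape_top (a d : ℤ) (hd : d * d = 1) (l : Str) :
    stackTape a d l (a + d * (l.length - 1)) = l.head? := by
  have : (a + d * ((l.length : ℤ) - 1) - a) * d = l.length - 1 := by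
    linear_combination ((l.length : ℤ) - 1) * hd
  rw [stackTape, this]
  rcases l with _ | ⟨b, l⟩
  · simp
  · have : ((((b :: l).length : ℕ) : ℤ) - 1) = (l.length : ℕ) := by simp
    rw [this]
    simp

theorem stackTape_cons (a d : ℤ) (hd : d * d = 1) (b : Bool) (l : Str) :
    stackTape a d (b :: l) = update (stackTape a d l) (a + d * l.length) (some b) := by
  funext z
  by_cases hz : z = a + d * l.length
  · subst hz
    rw [update_self]
    have := stackTape_top a d hd (b :: l)
    simpa using this
  · rw [update_of_ne hz]
    unfold stackTape
    split_ifs with h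
    · have : ((z - a) * d).toNat ≠ l.length := by
        intro h2
        apply hz
        have h3 : (z - a) * d = l.length := by omega
        linear_combination d * h3 - (z - a) * hd
      generalize ((z - a) * d).toNat = n at *
      rw [List.reverse_cons, List.getElem?_append]
      split_ifs with h4
      · rfl
      · simp at h4
        have : n - l.reverse.length ≠ 0 := by simp; omega
        rw [List.getElem?_eq_none (by simp; omega), List.getElem?_eq_none (by simp; omega)]
    · rfl

theorem stackTape_tail (a d : ℤ) (hd : d * d = 1) (b : Bool) (l : Str) :
    update (stackTape a d (b :: l)) (a + d * l.length) none = stackTape a d l := by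
  rw [stackTape_cons a d hd, update_idem]
  refine update_eq_self_iff.2 ?_
  unfold stackTape
  split_ifs with h
  · rw [List.getElem?_eq_none]
    have : (a + d * l.length - a) * d = l.length := by linear_combination (l.length : ℤ) * hd
    rw [this]
    simp
  · rfl

/-- The configuration in the state `q` whose tapes hold the stacks `s`. -/
def stackCfg {m k : ℕ} (ψ : ι ≃ TapeIx m k) (a : TapeIx m k → ℤ) {X : Type} (q : X) (s : ι → Str) :
    Cfg X (TapeIx m k) where
  state := q
  tape τ := stackTape (a τ) (growth τ) (s (ψ.symm τ))
  head τ := a τ + growth τ * ((s (ψ.symm τ)).length - 1)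

/-- `c` leads to `c'` in `t` steps, during which no head leaves the cells `-B, …, B`. -/
def Leads {m : ℕ} (M : OracleTM m) (A : Set Str) (B : ℕ) (c c' : Cfg M.State (TapeIx m M.k))
    (t : ℕ) : Prop :=
  (M.step A)^[t] c = c' ∧ ∀ j ≤ t, ∀ i, |((M.step A)^[j] c).head i| ≤ (B : ℤ)

theorem Leads.trans {m : ℕ} {M : OracleTM m} {A : Set Str} {B : ℕ}
    {c c' c'' : Cfg M.State (TapeIx m M.k)} {t u : ℕ} (h : Leads M A B c c' t)
    (h' : Leads M A B c' c'' u) : Leads M A B c c'' (t + u) := by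
  refine ⟨by rw [add_comm, iterate_add_apply, h.1, h'.1], fun j hj i => ?_⟩
  rcases le_total j t with h1 | h1
  · exact h.2 j h1 i
  · obtain ⟨v, rfl⟩ := Nat.exists_eq_add_of_le h1
    rw [add_comm, iterate_add_apply, h.1]
    exact h'.2 v (by omega) i

theorem Leads.one {m : ℕ} {M : OracleTM m} {A : Set Str} {B : ℕ}
    {c c' : Cfg M.State (TapeIx m M.k)} (h : M.step A c = c') (h1 : ∀ i, |c.head i| ≤ (B : ℤ))
    (h2 : ∀ i, |c'.head i| ≤ (B : ℤ)) : Leads M A B c c' 1 := by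
  refine ⟨h, fun j hj i => ?_⟩
  interval_cases j
  · exact h1 i
  · simp [h, h2 i]

end OracleSep

namespace OracleSep
open Function
variable {ι : Type} [DecidableEq ι]

/-! ### Correctness of the compilation. -/

section compile

variable {m : ℕ} {M : OracleTM m} {A : Set Str}

theorem step_move {c : Cfg M.State (TapeIx m M.k)} {δ} (h : M.act c.state = .move δ) :
    M.step A c =
      { state := (δ fun i => c.tape i (c.head i)).1
        tape := fun i => update (c.tape i) (c.head i) ((δ fun i => c.tape i (c.head i)).2.1 i)
        head := fun i => c.head i + ((δ fun i => c.tape i (c.head i)).2.2 i : ℤ) } := by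
  unfold OracleTM.step
  rw [h]

open Classical in
theorem step_query {c : Cfg M.State (TapeIx m M.k)} {x y} (h : M.act c.state = .query x y) :
    M.step A c =
      { c with state := if ∃ w ∈ A, IsWordOn (c.tape .query) w then x else y } := by
  unfold OracleTM.step
  rw [h]

theorem step_halt {c : Cfg M.State (TapeIx m M.k)} {b} (h : M.act c.state = .halt b) :
    M.step A c = c := by
  unfold OracleTM.step
  rw [h]

/-- The query stack has its bottom in cell `0` and grows to the right, so the word that the oracle
sees begins with the bottom symbol. This is why `ask` concerns the reverse of the register. -/
theorem isWordOn_stackTape (l w : Str) : IsWordOn (stackTape 0 1 l) w ↔ w = l.reverse := by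
  constructor
  · intro h
    refine List.ext_getElem? fun i => ?_
    have key : ∀ i ≤ w.length, l.reverse[i]? = w[i]? := fun i hi => by
      have := h i hi
      simpa [stackTape] using this
    rcases le_or_gt i w.length with hi | hi
    · exact (key i hi).symm
    -- The blank in cell `w.length` shows that the stack is not longer than `w`.
    · have h1 := key w.length le_rfl
      rw [List.getElem?_eq_none le_rfl, List.getElem?_eq_none_iff] at h1
      rw [List.getElem?_eq_none hi.le, List.getElem?_eq_none (h1.trans hi.le)]
  · rintro rfl i hi
    simp [stackTape]

variable (ψ : ι ≃ TapeIx m M.k) (a : TapeIx m M.k → ℤ) (B : ℕ)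

/-- All configurations with stacks of length at most `B` keep the heads in the cells `-B, …, B`. -/
def HeadsOk : Prop := ∀ (s : ι → Str) (q : M.State), (∀ i, (s i).length ≤ B) →
  ∀ i, |(stackCfg ψ a q s).head i| ≤ (B : ℤ)

variable {ψ a B}

omit [DecidableEq ι] in
theorem stackCfg_scan (q : M.State) (s : ι → Str) (τ) :
    (stackCfg ψ a q s).tape τ ((stackCfg ψ a q s).head τ) = (s (ψ.symm τ)).head? :=
  stackTape_top _ _ (growth_sq τ) _

omit [DecidableEq ι] in
theorem step_stay {q q' : M.State} {s : ι → Str} {g : (TapeIx m M.k → Option Bool) → M.State}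
    (h : M.act q = .move fun sc => (g sc, sc, 0))
    (hg : g (fun τ => (s (ψ.symm τ)).head?) = q') :
    M.step A (stackCfg ψ a q s) = stackCfg ψ a q' s := by
  rw [step_move (c := stackCfg ψ a q s) h]
  simp only [stackCfg_scan, hg]
  simp only [stackCfg, Cfg.mk.injEq, true_and]
  constructor
  · funext τ
    rw [update_eq_self_iff]
    exact (stackTape_top _ _ (growth_sq τ) _).symm
  · funext τ
    simp

/-- A machine writes before it moves, so a push needs two steps: one to reach the free cell above
the top, one to write there. In between, the tapes are still the old ones and the heads already the
new ones. A pop erases and then moves in a single step. -/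
theorem leads_push (ha : HeadsOk ψ a B) {q q1 q' : M.State} {s : ι → Str} {i : ι} {b : Bool}
    (h : M.act q = .move fun sc => (q1, sc, Pi.single (ψ i) (growth (ψ i))))
    (h1 : M.act q1 = .move fun sc => (q', update sc (ψ i) (some b), 0))
    (hs : ∀ i, (s i).length ≤ B) (hi : (s i).length < B) :
    Leads M A B (stackCfg ψ a q s) (stackCfg ψ a q' (update s i (b :: s i))) 2 := by
  have hs' : ∀ j, (update s i (b :: s i) j).length ≤ B := by
    intro j
    by_cases hj : j = i
    · subst hj; simp; omega
    · simp [hj, hs j]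
  have e1 : M.step A (stackCfg ψ a q s) =
      { state := q1
        tape := (stackCfg ψ a q s).tape
        head := (stackCfg ψ a q (update s i (b :: s i))).head } := by
    rw [step_move (c := stackCfg ψ a q s) h]
    simp only [stackCfg_scan]
    simp only [stackCfg, Cfg.mk.injEq, true_and]
    constructor
    · funext τ
      rw [update_eq_self_iff]
      exact (stackTape_top _ _ (growth_sq τ) _).symm
    · funext τ
      by_cases hτ : τ = ψ i
      · subst hτ
        simp
        ring
      · have : ψ.symm τ ≠ i := fun h => hτ (by rw [← h]; simp)
        simp [hτ, this]
  have e2 : M.step A (Cfg.mk q1 (stackCfg ψ a q s).tape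
        (stackCfg ψ a q (update s i (b :: s i))).head) =
      stackCfg ψ a q' (update s i (b :: s i)) := by
    rw [step_move h1]
    simp only [stackCfg, Cfg.mk.injEq, true_and]
    constructor
    · funext τ
      by_cases hτ : τ = ψ i
      · subst hτ
        simp [stackTape_cons _ _ (growth_sq _)]
      · have : ψ.symm τ ≠ i := fun h => hτ (by rw [← h]; simp)
        simp only [ne_eq, hτ, not_false_eq_true, update_of_ne, this]
        rw [update_eq_self_iff]
    · funext τ
      simp
  exact (Leads.one e1 (ha s q hs) (ha _ q hs')).trans (Leads.one e2 (ha _ q hs') (ha _ _ hs'))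

theorem step_pop_cons {q q' : M.State} {s : ι → Str} {i : ι} {b : Bool} {l : Str}
    {δ : (TapeIx m M.k → Option Bool) → _} (h : M.act q = .move δ) (hl : s i = b :: l)
    (hδ : ∀ sc, sc (ψ i) = some b →
      δ sc = (q', update sc (ψ i) none, Pi.single (ψ i) (-growth (ψ i)))) :
    M.step A (stackCfg ψ a q s) = stackCfg ψ a q' (update s i l) := by
  rw [step_move (c := stackCfg ψ a q s) h]
  simp only [stackCfg_scan]
  rw [hδ _ (by simp [hl])]
  simp only [stackCfg, Cfg.mk.injEq, true_and]
  constructor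
  · funext τ
    by_cases hτ : τ = ψ i
    · subst hτ
      have := stackTape_tail (a (ψ i)) (growth (ψ i)) (growth_sq _) b l
      simpa [hl] using this
    · have : ψ.symm τ ≠ i := fun h => hτ (by rw [← h]; simp)
      simp only [ne_eq, hτ, not_false_eq_true, update_of_ne, this]
      rw [update_eq_self_iff]
      exact (stackTape_top _ _ (growth_sq τ) _).symm
  · funext τ
    by_cases hτ : τ = ψ i
    · subst hτ
      simp [hl, SignType.coe_neg]
      ring
    · have : ψ.symm τ ≠ i := fun h => hτ (by rw [← h]; simp)
      simp [hτ, this]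

/-- Induction on the execution. Keeping the embedding `φ` of the labels and the exit state `e`
arbitrary lets the induction hypothesis apply to subprograms, whose exit is a state of the
surrounding program. The cost is exactly the number of steps. -/
theorem leads_codeAct (ha : HeadsOk ψ a B) {qr : ι} (hq : ψ qr = .query) (hq0 : a .query = 0)
    {p : Prog ι} {s s' : ι → Str} {t : ℕ} (h : Exec A qr (B : ℕ∞) p s s' t) :
    ∀ (φ : Prog.Lab p → M.State) (e : M.State), (∀ l, M.act (φ l) = codeAct ψ p φ e l) →
    (∀ i, (s i).length ≤ B) →
    Leads M A B (stackCfg ψ a (φ p.first) s) (stackCfg ψ a e s') t ∧ ∀ i, (s' i).length ≤ B := by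
  induction h with
  | nop s =>
    intro φ e hφ hs
    exact ⟨.one (step_stay (hφ _) rfl) (ha _ _ hs) (ha _ _ hs), hs⟩
  | push s i b h =>
    intro φ e hφ hs
    have hi : (s i).length < B := by exact_mod_cast h
    refine ⟨leads_push ha (hφ false) (hφ true) hs hi, fun j => ?_⟩
    by_cases hj : j = i
    · subst hj; simp; omega
    · simp [hj, hs j]
  | @pop_nil s i pn pf pt s' t h h1 ih =>
    intro φ e hφ hs
    have := ih (fun x => φ (some (.inl x))) e (fun l => hφ (some (.inl l))) hs
    refine ⟨?_, this.2⟩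
    rw [add_comm]
    refine .trans (.one ?_ (ha _ _ hs) (ha _ _ hs)) this.1
    have h2 := hφ none
    change M.step A (stackCfg ψ a (φ none) s) = _
    rw [step_move (c := stackCfg ψ a _ s) h2]
    simp only [stackCfg_scan]
    simp only [Equiv.symm_apply_apply, h, List.head?_nil, stackCfg, Cfg.mk.injEq, true_and]
    constructor
    · funext τ
      rw [update_eq_self_iff]
      exact (stackTape_top _ _ (growth_sq τ) _).symm
    · funext τ
      simp
  | @pop_cons s i pn pf pt s' t b l h h1 ih =>
    intro φ e hφ hs
    have hs' : ∀ j, (update s i l j).length ≤ B := by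
      intro j
      by_cases hj : j = i
      · subst hj; have := hs j; simp [h] at this ⊢; omega
      · simp [hj, hs j]
    rw [add_comm]
    cases b with
    | false =>
      have := ih (fun x => φ (some (.inr (.inl x)))) e (fun l => hφ (some (.inr (.inl l)))) hs'
      exact ⟨.trans (.one (step_pop_cons (hφ none) h fun sc hsc => by simp [hsc])
        (ha _ _ hs) (ha _ _ hs')) this.1, this.2⟩
    | true =>
      have := ih (fun x => φ (some (.inr (.inr x)))) e (fun l => hφ (some (.inr (.inr l)))) hs'
      exact ⟨.trans (.one (step_pop_cons (hφ none) h fun sc hsc => by simp [hsc])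
        (ha _ _ hs) (ha _ _ hs')) this.1, this.2⟩
  | @ask_yes s p q s' t h h1 ih =>
    intro φ e hφ hs
    have := ih (fun x => φ (some (.inl x))) e (fun l => hφ (some (.inl l))) hs
    refine ⟨?_, this.2⟩
    rw [add_comm]
    refine .trans (.one ?_ (ha _ _ hs) (ha _ _ hs)) this.1
    change M.step A (stackCfg ψ a (φ none) s) = _
    rw [step_query (c := stackCfg ψ a _ s) (hφ none), if_pos]
    · rfl
    · refine ⟨_, h, ?_⟩
      rw [← Equiv.eq_symm_apply] at hq
      simp only [stackCfg, hq0, growth, ← hq]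
      exact (isWordOn_stackTape _ _).2 rfl
  | @ask_no s p q s' t h h1 ih =>
    intro φ e hφ hs
    have := ih (fun x => φ (some (.inr x))) e (fun l => hφ (some (.inr l))) hs
    refine ⟨?_, this.2⟩
    rw [add_comm]
    refine .trans (.one ?_ (ha _ _ hs) (ha _ _ hs)) this.1
    change M.step A (stackCfg ψ a (φ none) s) = _
    rw [step_query (c := stackCfg ψ a _ s) (hφ none), if_neg]
    · rfl
    · rintro ⟨w, hw, hw'⟩
      rw [← Equiv.eq_symm_apply] at hq
      simp only [stackCfg, hq0, growth, ← hq] at hw'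
      rw [(isWordOn_stackTape _ _).1 hw'] at hw
      exact h hw
  | @seq p q s s1 s2 t1 t2 h1 h2 ih1 ih2 =>
    intro φ e hφ hs
    have e1 := ih1 (fun x => φ (.inl x)) _ (fun l => hφ (.inl l)) hs
    have e2 := ih2 (fun x => φ (.inr x)) e (fun l => hφ (.inr l)) e1.2
    exact ⟨e1.1.trans e2.1, e2.2⟩
  | @loop_done i c p s h =>
    intro φ e hφ hs
    exact ⟨.one (step_stay (hφ none) (by simp [h])) (ha _ _ hs) (ha _ _ hs), hs⟩
  | @loop_step i c p s s1 s2 t1 t2 h h1 h2 ih1 ih2 =>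
    intro φ e hφ hs
    have e1 := ih1 (fun x => φ (some x)) _ (fun l => hφ (some l)) hs
    have e2 := ih2 φ e hφ e1.2
    refine ⟨?_, e2.2⟩
    rw [add_comm]
    exact .trans (.one (step_stay (hφ none) (by simp [h])) (ha _ _ hs) (ha _ _ hs))
      (e1.1.trans e2.1)

end compile

/-! ### Complete machines: inputs, start and verdict. -/

/-- The registers of the programs: input registers, further registers, and the query register. -/
inductive Reg (m : ℕ) (κ : Type) : Type
  | inp (i : Fin m)
  | wk (j : κ)
  | qry
deriving DecidableEq

/-- The store with the inputs `xs`. -/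
def inputStore {m : ℕ} {κ : Type} (xs : Fin m → Str) : Reg m κ → Str
  | .inp i => xs i
  | _ => []

/-- The correspondence between registers and tapes. -/
def regEquiv (m : ℕ) {κ : Type} {k : ℕ} (f : κ ≃ Fin k) : Reg m κ ≃ TapeIx m k where
  toFun
    | .inp i => .input i
    | .wk j => .work (f j)
    | .qry => .query
  invFun
    | .input i => .inp i
    | .work j => .wk (f.symm j)
    | .query => .qry
  left_inv r := by cases r <;> simp
  right_inv r := by cases r <;> simp

section machine

variable {m : ℕ} {κ : Type} [DecidableEq κ] [Fintype κ]

/-- The machine for the program `p`, which accepts iff `true` is on top of the stack `r` at the end. -/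
noncomputable def progMachine (p : Prog (Reg m κ)) (r : κ) : OracleTM m where
  k := Fintype.card κ
  State := Prog.Lab p ⊕ (Bool ⊕ Bool)
  finite_state := by have := p.finite_lab; infer_instance
  start := .inr (.inl false)
  act
    | .inl l => codeAct (regEquiv m (Fintype.equivFin κ)) p .inl (.inr (.inl true)) l
    | .inr (.inl false) => .move fun sc => (.inl p.first, sc, fun | .query => -1 | _ => 0)
    | .inr (.inl true) => .move fun sc =>
        (.inr (.inr (sc (.work (Fintype.equivFin κ r)) == some true)), sc, 0)
    | .inr (.inr b) => .halt b

/-- The cells of the bottoms of the stacks. -/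
def bottoms {m k : ℕ} (xs : Fin m → Str) : TapeIx m k → ℤ
  | .input i => (xs i).length - 1
  | .work _ => -1
  | .query => 0

theorem stackTape_nil (a d : ℤ) : stackTape a d [] = fun _ => none := by
  funext z
  simp [stackTape]

/-- Input stacks grow to the left from the last letter, so the first letter is on top and scanned in
cell `0`; an input tape is a stack without any preparation. -/
theorem strTape_eq_stackTape (x : Str) : strTape x = stackTape (x.length - 1) (-1) x := by
  funext z
  unfold strTape stackTape
  split_ifs with h1 h2 h2
  · rw [List.getElem?_reverse (by omega)]
    congr 1
    omega
  · rw [List.getElem?_eq_none]; omega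
  · rw [List.getElem?_eq_none]; simp; omega
  · rfl

/-- Two steps are added to the cost of the program: the first moves the query head to cell `-1`,
where the head of an empty query stack belongs, and the last reads the verdict off the register `r`.
The position `-1` is the reason for `1 ≤ B`. -/
theorem progMachine_leads {A : Set Str} (p : Prog (Reg m κ)) (r : κ) (xs : Fin m → Str)
    {s' : Reg m κ → Str} {t B : ℕ} (hB : ∀ i, (xs i).length ≤ B) (hB1 : 1 ≤ B)
    (h : Exec A .qry (B : ℕ∞) p (inputStore xs) s' t) :
    ∃ c, Leads (progMachine p r) A B ((progMachine p r).init xs) c (t + 2) ∧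
      (progMachine p r).act c.state = .halt ((s' (.wk r)).head? == some true) := by
  set M := progMachine p r
  let ψ : Reg m κ ≃ TapeIx m M.k := regEquiv m (Fintype.equivFin κ)
  have ψi : ∀ i, ψ.symm (.input i) = .inp i := fun _ => rfl
  have ψw : ∀ j, ψ.symm (.work j) = .wk ((Fintype.equivFin κ).symm j) := fun _ => rfl
  have ψq : ψ.symm .query = .qry := rfl
  have ha : HeadsOk (M := M) ψ (bottoms xs) B := by
    intro s q hs τ
    rcases τ with i | j | _
    · have := hs (.inp i)
      have := hB i
      simp only [stackCfg, bottoms, growth, ψi, SignType.coe_neg, SignType.coe_one]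
      rw [abs_le]
      constructor <;> omega
    · have := hs (.wk ((Fintype.equivFin κ).symm j))
      simp only [stackCfg, bottoms, growth, ψw, SignType.coe_neg, SignType.coe_one]
      rw [abs_le]
      constructor <;> omega
    · have := hs .qry
      simp only [stackCfg, bottoms, growth, ψq, SignType.coe_one]
      rw [abs_le]
      constructor <;> omega
  have hs : ∀ i, (inputStore (κ := κ) xs i).length ≤ B := by
    intro i; cases i <;> simp [inputStore, hB]
  have key := leads_codeAct (M := M) (a := bottoms xs) ha (qr := .qry) rfl rfl h
    Sum.inl (.inr (.inl true)) (fun l => rfl) hs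
  have e0 : M.step A (M.init xs) = stackCfg ψ (bottoms xs) (.inl p.first) (inputStore xs) := by
    rw [step_move (c := M.init xs) (rfl : M.act (M.init xs).state = .move _)]
    unfold OracleTM.init stackCfg
    congr 1
    · funext τ
      rw [update_eq_self]
      rcases τ with i | j | _
      · simp [ψi, growth, bottoms, inputStore, strTape_eq_stackTape]
      · simp [ψw, growth, bottoms, inputStore, stackTape_nil]
      · simp [ψq, growth, bottoms, inputStore, stackTape_nil]
    · funext τ
      rcases τ with i | j | _
      · simp [ψi, growth, bottoms, inputStore]
      · simp [ψw, growth, bottoms, inputStore]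
      · simp [ψq, growth, bottoms, inputStore]
  have l0 : Leads M A B (M.init xs) _ 1 := .one e0 (by intro i; simp [OracleTM.init]) (ha _ _ hs)
  have e1 : M.step A (stackCfg ψ (bottoms xs) (.inr (.inl true)) s') =
      stackCfg ψ (bottoms xs) (.inr (.inr ((s' (.wk r)).head? == some true))) s' := by
    refine step_stay (M := M) (ψ := ψ) (rfl : M.act (.inr (.inl true)) = .move _) ?_
    simp only
    exact congrArg (fun r => Sum.inr (Sum.inr ((s' (.wk r)).head? == some true)))
      ((Fintype.equivFin κ).symm_apply_apply r)
  have l1 := (l0.trans key.1).trans (.one e1 (ha _ _ key.2) (ha _ _ key.2))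
  rw [add_comm 1 t] at l1
  exact ⟨_, l1, rfl⟩

/-- A function that is bounded by one of the polynomials `n ^ c + c`. -/
def PolyBdd (f : ℕ → ℕ) : Prop := ∃ c, ∀ n, f n ≤ n ^ c + c

theorem iterate_step_halt {A : Set Str} {M : OracleTM m} {c : Cfg M.State (TapeIx m M.k)} {b}
    (h : M.act c.state = .halt b) (n : ℕ) : (M.step A)^[n] c = c :=
  iterate_fixed (step_halt h) n

theorem polyTimeRel_of_exec {A : Set Str} (p : Prog (Reg m κ)) (r : κ) {f : ℕ → ℕ}
    (hf : PolyBdd fun n => f n + 2) {R : (Fin m → Str) → Prop}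
    (h : ∀ xs, ∃ s' t, Exec A .qry ⊤ p (inputStore xs) s' t ∧ t ≤ f (∑ i, (xs i).length) ∧
      ((s' (.wk r)).head? = some true ↔ R xs)) : PolyTimeRel A R := by
  obtain ⟨c, hc⟩ := hf
  refine ⟨progMachine p r, c, fun xs => ?_⟩
  obtain ⟨s', t, h1, h2, h3⟩ := h xs
  set N := ∑ i, (xs i).length
  have hN : ∀ i, (xs i).length ≤ N := fun i =>
    Finset.single_le_sum (f := fun i => (xs i).length) (fun _ _ => Nat.zero_le _) (Finset.mem_univ i)
  -- The registers start with at most `N` symbols and gain at most `t`; the additional `1` takes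
  -- care of the position `-1` of the query head.
  obtain ⟨c', h4, h5⟩ := progMachine_leads p r xs (B := N + t + 1)
    (fun i => (hN i).trans (by omega)) (by omega)
    (h1.bounded N (by intro i; cases i <;> simp [inputStore, hN]) (by omega))
  refine ⟨(s' (.wk r)).head? == some true, ?_, by simpa using h3⟩
  -- The machine idles in its halting configuration until the clock has run out.
  have : N ^ c + c = (N ^ c + c - (t + 2)) + (t + 2) := by
    have := hc N
    simp only at this
    omega
  rw [OracleTM.HaltsBy, OracleTM.cfgAt, this, iterate_add_apply, h4.1, iterate_step_halt h5, h5]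

/-- No bound on the cost `t` is needed, only one on the registers. The heads stay within bounds at
all times because the configuration is constant after the halt. -/
theorem mem_pspace_of_exec {A : Set Str} (p : Prog (Reg 1 κ)) (r : κ) {f : ℕ → ℕ}
    (hf : PolyBdd f) {L : Set Str}
    (h : ∀ x : Str, 1 ≤ f x.length ∧ x.length ≤ f x.length ∧
      ∃ s' t, Exec A .qry (f x.length : ℕ) p (inputStore fun _ => x) s' t ∧
      ((s' (.wk r)).head? = some true ↔ x ∈ L)) : L ∈ PSPACE A := by
  obtain ⟨c, hc⟩ := hf
  refine ⟨progMachine p r, c, fun x => ?_⟩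
  obtain ⟨h0, h1, s', t, h2, h3⟩ := h x
  obtain ⟨c', h4, h5⟩ := progMachine_leads p r (fun _ => x) (fun _ => h1) h0 h2
  refine ⟨fun j i => ?_, t + 2, (s' (.wk r)).head? == some true, ?_, by simpa using h3⟩
  · refine le_trans ?_ (Int.ofNat_le.2 (hc x.length))
    rcases le_total j (t + 2) with hj | hj
    · exact h4.2 j hj i
    · obtain ⟨v, rfl⟩ := Nat.exists_eq_add_of_le hj
      have := h4.2 (t + 2) le_rfl i
      rw [OracleTM.cfgAt, add_comm, iterate_add_apply, h4.1, iterate_step_halt h5]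
      rwa [h4.1] at this
  · rw [OracleTM.HaltsBy, OracleTM.cfgAt, h4.1, h5]

end machine

end OracleSep

namespace OracleSep
open Function
variable {ι : Type} [DecidableEq ι]

/-! ### Programs for basic tasks -/

/-- The program `p` leads from `s` to `s'` at cost at most `T`. -/
def Runs (A : Set Str) (qr : ι) (p : Prog ι) (s s' : ι → Str) (T : ℕ) : Prop :=
  ∃ t ≤ T, Exec A qr ⊤ p s s' t

namespace Runs

variable {A : Set Str} {qr : ι} {p q r : Prog ι} {s s1 s' : ι → Str} {T T1 T2 : ℕ} {i : ι}

theorem nop (h : 1 ≤ T) : Runs A qr .nop s s T := ⟨1, h, .nop s⟩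

theorem push {b} (h : 2 ≤ T) (hs : s' = update s i (b :: s i)) : Runs A qr (.push i b) s s' T :=
  ⟨2, h, hs ▸ .push s i b (ENat.natCast_lt_top _)⟩

theorem mono (h : Runs A qr p s s' T1) (hT : T1 ≤ T) : Runs A qr p s s' T :=
  let ⟨t, ht, h⟩ := h; ⟨t, ht.trans hT, h⟩

theorem pop_nil (h : s i = []) (h1 : Runs A qr p s s' T1) (hT : T1 + 1 ≤ T) :
    Runs A qr (.pop i p q r) s s' T :=
  let ⟨t, ht, h1⟩ := h1; ⟨t + 1, by omega, .pop_nil h h1⟩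

theorem pop_cons {b l} (h : s i = b :: l) (h1 : Runs A qr (bif b then r else q) (update s i l) s' T1)
    (hT : T1 + 1 ≤ T) : Runs A qr (.pop i p q r) s s' T :=
  let ⟨t, ht, h1⟩ := h1; ⟨t + 1, by omega, .pop_cons b l h h1⟩

theorem ask_yes (h : (s qr).reverse ∈ A) (h1 : Runs A qr p s s' T1) (hT : T1 + 1 ≤ T) :
    Runs A qr (.ask p q) s s' T :=
  let ⟨t, ht, h1⟩ := h1; ⟨t + 1, by omega, .ask_yes h h1⟩

theorem ask_no (h : (s qr).reverse ∉ A) (h1 : Runs A qr q s s' T1) (hT : T1 + 1 ≤ T) :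
    Runs A qr (.ask p q) s s' T :=
  let ⟨t, ht, h1⟩ := h1; ⟨t + 1, by omega, .ask_no h h1⟩

theorem seq (h1 : Runs A qr p s s1 T1) (h2 : Runs A qr q s1 s' T2) (hT : T1 + T2 ≤ T) :
    Runs A qr (.seq p q) s s' T :=
  let ⟨t1, ht1, h1⟩ := h1; let ⟨t2, ht2, h2⟩ := h2; ⟨t1 + t2, by omega, .seq h1 h2⟩

theorem loop_done {c} (h : c (s i).head? = false) (hT : 1 ≤ T) : Runs A qr (.loop i c p) s s T :=
  ⟨1, hT, .loop_done h⟩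

theorem loop_step {c} (h : c (s i).head? = true) (h1 : Runs A qr p s s1 T1)
    (h2 : Runs A qr (.loop i c p) s1 s' T2) (hT : T1 + T2 + 1 ≤ T) :
    Runs A qr (.loop i c p) s s' T :=
  let ⟨t1, ht1, h1⟩ := h1; let ⟨t2, ht2, h2⟩ := h2; ⟨t1 + t2 + 1, by omega, .loop_step h h1 h2⟩

/-- A loop that consumes one symbol of the stack `i` per round is a left fold over that stack. `I l
a` is the store when `l` remains to be consumed and `a` has been accumulated; `P` is a side
condition that rounds preserve. -/
theorem loop_foldl {α : Type} (I : Str → α → ι → Str) (f : α → Bool → α) (P : Str → α → Prop)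
    (hI : ∀ l a, P l a → I l a i = l)
    (hP : ∀ b l a, P (b :: l) a → P l (f a b) ∧ Runs A qr p (I (b :: l) a) (I l (f a b)) T1) :
    ∀ l a, P l a → l.length * (T1 + 1) + 1 ≤ T →
      Runs A qr (.loop i Option.isSome p) (I l a) (I [] (l.foldl f a)) T := by
  intro l
  induction l generalizing T with
  | nil => intro a ha hT; exact loop_done (by simp [hI _ _ ha]) (by simpa using hT)
  | cons b l ih =>
    intro a ha hT
    obtain ⟨h1, h2⟩ := hP b l a ha
    refine loop_step (by simp [hI _ _ ha]) h2 (ih _ h1 le_rfl) ?_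
    simp at hT
    nlinarith

end Runs

section basic

variable {A : Set Str} {qr : ι} {s : ι → Str} {T : ℕ}

/-- Empty the stack `r`. -/
def drain (r : ι) : Prog ι := .loop r Option.isSome (.pop r .nop .nop .nop)

theorem runs_drain (r : ι) (hT : 3 * (s r).length + 1 ≤ T) :
    Runs A qr (drain r) s (update s r []) T := by
  have := Runs.loop_foldl (A := A) (qr := qr) (p := .pop r .nop .nop .nop) (i := r) (T1 := 2) (T := T)
    (fun l (_ : Unit) => update s r l) (fun _ _ => ()) (fun _ _ => True) (by simp)
    (fun b l _ _ => ⟨trivial, ?_⟩) (s r) () trivial (by omega)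
  · simpa [drain] using this
  · refine .pop_cons (b := b) (l := l) (by simp) (T1 := 1) ?_ le_rfl
    rw [update_idem]
    cases b <;> exact .nop le_rfl

/-- Reverse the stack `r` onto the stack `u`. -/
def unload (r u : ι) : Prog ι :=
  .loop r Option.isSome (.pop r .nop (.push u false) (.push u true))

theorem runs_unload {r u : ι} (hru : r ≠ u) {s' : ι → Str} (hT : 4 * (s r).length + 1 ≤ T)
    (hs : s' = update (update s r []) u ((s r).reverse ++ s u)) :
    Runs A qr (unload r u) s s' T := by
  have := Runs.loop_foldl (A := A) (qr := qr) (p := .pop r .nop (.push u false) (.push u true))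
    (i := r) (T1 := 3) (T := T)
    (fun l a => update (update s r l) u a) (fun a b => b :: a) (fun _ _ => True) (by simp [hru])
    (fun b l a _ => ⟨trivial, ?_⟩) (s r) (s u) trivial (by omega)
  · rw [hs]
    simpa [unload] using this
  · refine .pop_cons (b := b) (l := l) (by simp [hru]) (T1 := 2) ?_ le_rfl
    cases b <;> exact .push le_rfl (by funext j; grind [Function.update_apply])

/-- Push a copy of the stack `r` onto the stack `u`, the stack `t` being used for intermediate
storage. -/
def copy (r u t : ι) : Prog ι :=
  .seq (unload r t) (.loop t Option.isSome
    (.pop t .nop (.seq (.push r false) (.push u false)) (.seq (.push r true) (.push u true))))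

theorem runs_copy {r u t : ι} (hru : r ≠ u) (hrt : r ≠ t) (hut : u ≠ t) (ht : s t = [])
    {s' : ι → Str} (hT : 10 * (s r).length + 2 ≤ T) (hs : s' = update s u (s r ++ s u)) :
    Runs A qr (copy r u t) s s' T := by
  subst hs
  refine .seq (runs_unload hrt le_rfl rfl) (T2 := 6 * (s r).length + 1) ?_ (by omega)
  have := Runs.loop_foldl (A := A) (qr := qr) (p := .pop t .nop (.seq (.push r false) (.push u false))
      (.seq (.push r true) (.push u true)))
    (i := t) (T1 := 5) (T := 6 * (s r).length + 1)
    (fun l a => update (update (update s r a.1) u a.2) t l)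
    (fun a b => (b :: a.1, b :: a.2)) (fun _ _ => True) (by simp)
    (fun b l a _ => ⟨trivial, ?_⟩) (s r).reverse ([], s u) trivial (by simp; omega)
  · have key : ∀ (l : Str) (a : Str × Str), l.foldl (fun a b => (b :: a.1, b :: a.2)) a =
        (l.reverse ++ a.1, l.reverse ++ a.2) := by
      intro l
      induction l with
      | nil => simp
      | cons b l ih => simp [ih]
    rw [key] at this
    convert this using 1
    · funext j; grind [Function.update_apply]
    · funext j; grind [Function.update_apply]
  · refine .pop_cons (b := b) (l := l) (by simp) (T1 := 4) ?_ le_rfl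
    cases b <;>
    exact .seq (.push le_rfl rfl) (.push le_rfl (by funext j; grind [Function.update_apply])) le_rfl

/-- The string `1 ⋯ 1` of length `n`. -/
abbrev ones (n : ℕ) : Str := List.replicate n true

theorem ones_add (m n : ℕ) : ones (m + n) = ones m ++ ones n :=
  List.replicate_add _ _ _

/-- Push one symbol onto `u` for each symbol of `r`, the stack `t` being used for intermediate
storage. -/
def addLen (r u t : ι) : Prog ι :=
  .seq (unload r t) (.loop t Option.isSome
    (.pop t .nop (.seq (.push r false) (.push u true)) (.seq (.push r true) (.push u true))))

theorem runs_addLen {r u t : ι} (hru : r ≠ u) (hrt : r ≠ t) (hut : u ≠ t) (ht : s t = [])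
    {s' : ι → Str} (hT : 10 * (s r).length + 2 ≤ T) (hs : s' = update s u (ones (s r).length ++ s u)) :
    Runs A qr (addLen r u t) s s' T := by
  subst hs
  refine .seq (runs_unload hrt le_rfl rfl) (T2 := 6 * (s r).length + 1) ?_ (by omega)
  have := Runs.loop_foldl (A := A) (qr := qr) (p := .pop t .nop (.seq (.push r false) (.push u true))
      (.seq (.push r true) (.push u true)))
    (i := t) (T1 := 5) (T := 6 * (s r).length + 1)
    (fun l a => update (update (update s r a.1) u a.2) t l)
    (fun a b => (b :: a.1, true :: a.2)) (fun _ _ => True) (by simp)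
    (fun b l a _ => ⟨trivial, ?_⟩) (s r).reverse ([], s u) trivial (by simp; omega)
  · have key : ∀ (l : Str) (a : Str × Str), l.foldl (fun a b => (b :: a.1, true :: a.2)) a =
        (l.reverse ++ a.1, ones l.length ++ a.2) := by
      intro l
      induction l with
      | nil => simp
      | cons b l ih => intro a; simp [ih, List.replicate_succ']
    rw [key] at this
    convert this using 1
    · funext j; grind [Function.update_apply]
    · funext j; grind [Function.update_apply]
  · refine .pop_cons (b := b) (l := l) (by simp) (T1 := 4) ?_ le_rfl
    cases b <;>
    exact .seq (.push le_rfl rfl) (.push le_rfl (by funext j; grind [Function.update_apply])) le_rfl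

/-- Push the symbols of `w` onto the stack `r`, the last one first. -/
def pushAll (r : ι) : Str → Prog ι
  | [] => .nop
  | b :: w => .seq (pushAll r w) (.push r b)

theorem runs_pushAll (r : ι) (w : Str) {s' : ι → Str} (hT : 2 * w.length + 1 ≤ T)
    (hs : s' = update s r (w ++ s r)) : Runs A qr (pushAll r w) s s' T := by
  subst hs
  induction w generalizing T with
  | nil => simpa [pushAll] using Runs.nop (by simpa using hT)
  | cons b w ih =>
    simp at hT
    exact .seq (ih le_rfl) (.push le_rfl (by simp)) (by omega)

/-- Multiply the unary number in `u` by that in `n`. -/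
def mulUnary (n u v t : ι) : Prog ι :=
  .seq (.loop u Option.isSome (.pop u .nop (addLen n v t) (addLen n v t))) (unload v u)

/-- Each symbol taken from `u` adds the length of `n` to `v`, and the product is finally carried
from `v` to `u`. The rounds cost `10 |n| + 4` each and the transfer costs `4 k |n| + 1`. -/
theorem runs_mulUnary {n u v t : ι} (h1 : n ≠ u) (h2 : n ≠ v) (h3 : n ≠ t) (h4 : u ≠ v) (h5 : u ≠ t)
    (h6 : v ≠ t) (ht : s t = []) (hv : s v = []) {s' : ι → Str} {k : ℕ} (hu : s u = ones k)
    (hT : 14 * (k * (s n).length) + 4 * k + 2 ≤ T) (hs : s' = update s u (ones (k * (s n).length))) :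
    Runs A qr (mulUnary n u v t) s s' T := by
  have := Runs.loop_foldl (A := A) (qr := qr) (p := .pop u .nop (addLen n v t) (addLen n v t))
    (i := u) (T1 := 10 * (s n).length + 3) (T := k * (10 * (s n).length + 3 + 1) + 1)
    (fun l a => update (update s u l) v (ones a)) (fun a _ => a + (s n).length) (fun _ _ => True)
    (by simp [h4])
    (fun b l a _ => ⟨trivial, ?_⟩) (s u) 0 trivial (by simp [hu])
  · have key : ∀ (l : Str) (a : ℕ), l.foldl (fun a _ => a + (s n).length) a =
        a + l.length * (s n).length := by
      intro l
      induction l with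
      | nil => simp
      | cons b l ih => intro a; simp [ih]; ring
    rw [key] at this
    refine .seq (s1 := update (update s u []) v (ones (k * (s n).length))) ?_
      (T1 := k * (10 * (s n).length + 3 + 1) + 1)
      (runs_unload h4.symm le_rfl ?_) (by simp; nlinarith)
    · convert this using 1
      · funext j; grind [Function.update_apply]
      · simp [hu]
    · rw [hs]; funext j; grind [Function.update_apply, List.reverse_replicate]
  · refine .pop_cons (b := b) (l := l) (by simp [h4]) (T1 := 10 * (s n).length + 2) ?_ le_rfl
    simp only [Bool.cond_self]
    refine runs_addLen h2 h3 h6 ?_ ?_ ?_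
    · simp [h5.symm, h6.symm, ht]
    · simp [h1, h2]
    · have : ones (a + (s n).length) = ones (s n).length ++ ones a := by
        rw [add_comm, ones_add]
      rw [this]
      funext j; grind [Function.update_apply]

/-- Multiply the unary number in `u` by the `k`-th power of that in `n`. -/
def powUnary (n u v t : ι) : ℕ → Prog ι
  | 0 => .nop
  | k + 1 => .seq (powUnary n u v t k) (mulUnary n u v t)

/-- A multiplication costs `14 N ^ (k + 1) + 4 N ^ k + 2`. Passing to powers of `N + 1`, which are
at least `1` and increase with the exponent, absorbs this in `20 (N + 1) ^ (k + 1)`, as `14 + 4 + 2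
= 20`. -/
theorem runs_powUnary {n u v t : ι} (h1 : n ≠ u) (h2 : n ≠ v) (h3 : n ≠ t) (h4 : u ≠ v) (h5 : u ≠ t)
    (h6 : v ≠ t) (ht : s t = []) (hv : s v = []) {s' : ι → Str} (k : ℕ) (hu : s u = ones 1)
    (hT : 20 * (k * ((s n).length + 1) ^ k) + 1 ≤ T) (hs : s' = update s u (ones ((s n).length ^ k))) :
    Runs A qr (powUnary n u v t k) s s' T := by
  subst hs
  induction k generalizing T with
  | zero => rw [pow_zero, ← hu, update_eq_self]; exact .nop (by omega)
  | succ k ih =>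
    set N := (s n).length
    have e1 : N ^ k ≤ (N + 1) ^ k := Nat.pow_le_pow_left (by omega) _
    have e2 : 1 ≤ (N + 1) ^ k := Nat.one_le_pow _ _ (by omega)
    have e3 : N ^ (k + 1) ≤ (N + 1) ^ (k + 1) := Nat.pow_le_pow_left (by omega) _
    have e4 : (N + 1) ^ k ≤ (N + 1) ^ (k + 1) := Nat.pow_le_pow_right (by omega) (by omega)
    refine .seq (ih le_rfl) (runs_mulUnary h1 h2 h3 h4 h5 h6 (k := N ^ k) ?_ ?_ ?_ le_rfl ?_) ?_
    · simp [h5.symm, ht]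
    · simp [h4.symm, hv]
    · simp
    · rw [update_idem, update_of_ne h1, pow_succ]
    · rw [update_of_ne h1]
      change 20 * (k * (N + 1) ^ k) + 1 + (14 * (N ^ k * N) + 4 * N ^ k + 2) ≤ T
      rw [← pow_succ]
      nlinarith

/-- Push `n ^ k + k` symbols onto the empty stack `u`, where `n` is the length of the stack `n`. -/
def polyUnary (n u v t : ι) (k : ℕ) : Prog ι :=
  .seq (.push u true) (.seq (powUnary n u v t k) (pushAll u (ones k)))

theorem runs_polyUnary {n u v t : ι} (h1 : n ≠ u) (h2 : n ≠ v) (h3 : n ≠ t) (h4 : u ≠ v) (h5 : u ≠ t)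
    (h6 : v ≠ t) (ht : s t = []) (hv : s v = []) {s' : ι → Str} (k : ℕ) (hu : s u = [])
    (hT : 20 * (k * ((s n).length + 1) ^ k) + 2 * k + 4 ≤ T)
    (hs : s' = update s u (ones ((s n).length ^ k + k))) :
    Runs A qr (polyUnary n u v t k) s s' T := by
  refine .seq (.push le_rfl rfl) (.seq
    (runs_powUnary h1 h2 h3 h4 h5 h6 ?_ ?_ k ?_ le_rfl rfl) (runs_pushAll u _ le_rfl ?_) le_rfl) ?_
  · simp [h5.symm, ht]
  · simp [h4.symm, hv]
  · simp [hu]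
  · rw [hs, update_idem, update_of_ne h1, update_idem, update_self, add_comm, ones_add]
  · simp [h1]; omega

end basic

end OracleSep

namespace OracleSep
open Function

/-! ### Sweeping machines given by bit strings

A table is a bit string that is read as a sequence of entries `1 ⋯ 1 0 b₁ b₂ b₃`. A machine with such a
table sweeps over a word, turning round at its ends. -/

/-- Drop the first entry of a table. -/
def skipEntry (l : Str) : Str := (l.dropWhile id).drop 4

/-- The first entry of a table. -/
def readEntry (l : Str) : ℕ × Bool × Bool × Bool :=
  ((l.takeWhile id).length, ((l.dropWhile id)[1]?).getD false, ((l.dropWhile id)[2]?).getD false,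
    ((l.dropWhile id)[3]?).getD false)

/-- The entry number `j` of the table `P`. -/
def entry (P : Str) (j : ℕ) : ℕ × Bool × Bool × Bool := readEntry (skipEntry^[j] P)

/-- Process one bit: the triple consists of the state, of the bits written so far (the last one
first), and of the query word written so far (again the last symbol first). -/
def bitStep (P : Str) (a : ℕ × Str × Str) (b : Bool) : ℕ × Str × Str :=
  let e := entry P (a.1 + b.toNat)
  (e.1, e.2.1 :: a.2.1, if e.2.2.1 then e.2.2.2 :: a.2.2 else a.2.2)

/-- The state after the processing of all bits of a word. -/
def passOver (P : Str) (c : ℕ × Str) : ℕ × Str × Str := c.2.foldl (bitStep P) (c.1, [], [])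

open Classical in
/-- One sweep, with the verdict if the machine halts at its end. -/
noncomputable def sweep (A : Set Str) (P : Str) (c : ℕ × Str) : Option Bool × ℕ × Str :=
  let a := passOver P c
  let e := entry P (a.1 + if a.2.2.reverse ∈ A then 3 else 2)
  (if e.2.1 then some e.2.2.1 else none, e.1, a.2.1)

/-- The verdict of the machine after at most `T` sweeps. -/
noncomputable def verdict (A : Set Str) (P : Str) : ℕ → ℕ × Str → Option Bool
  | 0, _ => none
  | T + 1, c => (sweep A P c).1.or (verdict A P T (sweep A P c).2)

theorem length_skipEntry_le (l : Str) : (skipEntry l).length ≤ l.length := by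
  simp only [skipEntry, List.length_drop]
  exact (Nat.sub_le _ _).trans (List.length_dropWhile_le _ _)

/-- A next state is the length of a run of ones inside `P`. So there are at most `P.length + 1`
states to reckon with, even if `P` is not a sensible table. -/
theorem entry_fst_le (P : Str) (j : ℕ) : (entry P j).1 ≤ P.length := by
  have : ∀ j, (skipEntry^[j] P).length ≤ P.length := by
    intro j
    induction j with
    | zero => simp
    | succ j ih => rw [iterate_succ_apply']; exact (length_skipEntry_le _).trans ih
  exact (List.takeWhile_prefix _).length_le.trans (this j)

/-! ### Programs that run sweeping machines -/

/-- The names of the work registers. -/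
inductive Nm (n : ℕ) : Type
  | p | p' | st | o1 | o2 | o3 | w | out | rev | run | res | clk
  | t | v | len | bd | rem | py | nb
  | x (i : Fin n) | y (i : Fin n) | rm (i : Fin n) | go (i : Fin n) | acc (i : Fin n)
deriving DecidableEq, Fintype

/-- The contents of the registers that serve to run a sweeping machine. -/
structure ZStore where
  p : Str
  p' : Str
  st : Str
  o1 : Str
  o2 : Str
  o3 : Str
  w : Str
  out : Str
  rev : Str
  run : Str
  res : Str
  clk : Str
  q : Str

variable {m n : ℕ}

/-- The store with the given contents of the registers for sweeping machines that agrees with `s` on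
the other registers. -/
def zst (s : Reg m (Nm n) → Str) (z : ZStore) : Reg m (Nm n) → Str
  | .wk .p => z.p
  | .wk .p' => z.p'
  | .wk .st => z.st
  | .wk .o1 => z.o1
  | .wk .o2 => z.o2
  | .wk .o3 => z.o3
  | .wk .w => z.w
  | .wk .out => z.out
  | .wk .rev => z.rev
  | .wk .run => z.run
  | .wk .res => z.res
  | .wk .clk => z.clk
  | .qry => z.q
  | r => s r

section zst

variable (s : Reg m (Nm n) → Str) (z : ZStore) (l : Str)

@[simp] theorem zst_p : zst s z (.wk .p) = z.p := rfl
@[simp] theorem zst_p' : zst s z (.wk .p') = z.p' := rfl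
@[simp] theorem zst_st : zst s z (.wk .st) = z.st := rfl
@[simp] theorem zst_o1 : zst s z (.wk .o1) = z.o1 := rfl
@[simp] theorem zst_o2 : zst s z (.wk .o2) = z.o2 := rfl
@[simp] theorem zst_o3 : zst s z (.wk .o3) = z.o3 := rfl
@[simp] theorem zst_w : zst s z (.wk .w) = z.w := rfl
@[simp] theorem zst_out : zst s z (.wk .out) = z.out := rfl
@[simp] theorem zst_rev : zst s z (.wk .rev) = z.rev := rfl
@[simp] theorem zst_run : zst s z (.wk .run) = z.run := rfl
@[simp] theorem zst_res : zst s z (.wk .res) = z.res := rfl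
@[simp] theorem zst_clk : zst s z (.wk .clk) = z.clk := rfl
@[simp] theorem zst_q : zst s z .qry = z.q := rfl

/-- Source of the simp lemmas that turn register updates into record updates. They let stores be
compared by computation. -/
theorem zst_update {r : Reg m (Nm n)} {z z' : ZStore} {l : Str} (h : zst s z' r = l)
    (h' : ∀ r', r' ≠ r → zst s z' r' = zst s z r') : update (zst s z) r l = zst s z' := by
  funext r'
  by_cases hr : r' = r
  · subst hr; rw [update_self, h]
  · rw [update_of_ne hr, h' r' hr]

@[simp] theorem update_zst_p : update (zst s z) (.wk .p) l = zst s { z with p := l } :=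
  zst_update s rfl fun r hr => by rcases r with _ | r | _ <;> [rfl; (cases r <;> first | rfl | exact absurd rfl hr); rfl]
@[simp] theorem update_zst_p' : update (zst s z) (.wk .p') l = zst s { z with p' := l } :=
  zst_update s rfl fun r hr => by rcases r with _ | r | _ <;> [rfl; (cases r <;> first | rfl | exact absurd rfl hr); rfl]
@[simp] theorem update_zst_st : update (zst s z) (.wk .st) l = zst s { z with st := l } :=
  zst_update s rfl fun r hr => by rcases r with _ | r | _ <;> [rfl; (cases r <;> first | rfl | exact absurd rfl hr); rfl]
@[simp] theorem update_zst_o1 : update (zst s z) (.wk .o1) l = zst s { z with o1 := l } :=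
  zst_update s rfl fun r hr => by rcases r with _ | r | _ <;> [rfl; (cases r <;> first | rfl | exact absurd rfl hr); rfl]
@[simp] theorem update_zst_o2 : update (zst s z) (.wk .o2) l = zst s { z with o2 := l } :=
  zst_update s rfl fun r hr => by rcases r with _ | r | _ <;> [rfl; (cases r <;> first | rfl | exact absurd rfl hr); rfl]
@[simp] theorem update_zst_o3 : update (zst s z) (.wk .o3) l = zst s { z with o3 := l } :=
  zst_update s rfl fun r hr => by rcases r with _ | r | _ <;> [rfl; (cases r <;> first | rfl | exact absurd rfl hr); rfl]
@[simp] theorem update_zst_w : update (zst s z) (.wk .w) l = zst s { z with w := l } :=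
  zst_update s rfl fun r hr => by rcases r with _ | r | _ <;> [rfl; (cases r <;> first | rfl | exact absurd rfl hr); rfl]
@[simp] theorem update_zst_out : update (zst s z) (.wk .out) l = zst s { z with out := l } :=
  zst_update s rfl fun r hr => by rcases r with _ | r | _ <;> [rfl; (cases r <;> first | rfl | exact absurd rfl hr); rfl]
@[simp] theorem update_zst_rev : update (zst s z) (.wk .rev) l = zst s { z with rev := l } :=
  zst_update s rfl fun r hr => by rcases r with _ | r | _ <;> [rfl; (cases r <;> first | rfl | exact absurd rfl hr); rfl]
@[simp] theorem update_zst_run : update (zst s z) (.wk .run) l = zst s { z with run := l } :=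
  zst_update s rfl fun r hr => by rcases r with _ | r | _ <;> [rfl; (cases r <;> first | rfl | exact absurd rfl hr); rfl]
@[simp] theorem update_zst_res : update (zst s z) (.wk .res) l = zst s { z with res := l } :=
  zst_update s rfl fun r hr => by rcases r with _ | r | _ <;> [rfl; (cases r <;> first | rfl | exact absurd rfl hr); rfl]
@[simp] theorem update_zst_clk : update (zst s z) (.wk .clk) l = zst s { z with clk := l } :=
  zst_update s rfl fun r hr => by rcases r with _ | r | _ <;> [rfl; (cases r <;> first | rfl | exact absurd rfl hr); rfl]
@[simp] theorem update_zst_q : update (zst s z) .qry l = zst s { z with q := l } :=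
  zst_update s rfl fun r hr => by rcases r with _ | r | _ <;> [rfl; (cases r <;> rfl); exact absurd rfl hr]

end zst

/-- A shorthand for work registers. -/
abbrev wr (r : Nm n) : Reg m (Nm n) := .wk r

/-- Move one symbol from `p` to `p'`. -/
def moveOne : Prog (Reg m (Nm n)) := .pop (wr .p) .nop (.push (wr .p') false) (.push (wr .p') true)

/-- Move one symbol from `p` to `p'` and push a copy of it (`false` if there is none) onto `o`. -/
def readOne (o : Nm n) : Prog (Reg m (Nm n)) :=
  .pop (wr .p) (.push (wr o) false) (.seq (.push (wr .p') false) (.push (wr o) false))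
    (.seq (.push (wr .p') true) (.push (wr o) true))

/-- Skip one entry of the table. -/
def skipProg : Prog (Reg m (Nm n)) :=
  .seq (.loop (wr .p) (· == some true) moveOne)
    (.seq moveOne (.seq moveOne (.seq moveOne moveOne)))

/-- Read one entry of the table. -/
def readProg : Prog (Reg m (Nm n)) :=
  .seq (.loop (wr .p) (· == some true) (.seq moveOne (.push (wr .st) true)))
    (.seq moveOne (.seq (readOne .o1) (.seq (readOne .o2) (.seq (readOne .o3)
      (unload (wr .p') (wr .p))))))

/-- Replace the number in `st` by the entry of that number. -/
def entryProg : Prog (Reg m (Nm n)) :=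
  .seq (.loop (wr .st) Option.isSome (.seq (.pop (wr .st) .nop .nop .nop) skipProg)) readProg

section

variable {A : Set Str} {s : Reg m (Nm n) → Str} {z : ZStore} {T : ℕ}

theorem runs_moveOne (hT : 3 ≤ T) :
    Runs A .qry moveOne (zst s z)
      (zst s { z with p := z.p.drop 1, p' := (z.p.take 1).reverse ++ z.p' }) T := by
  rcases h : z.p with _ | ⟨b, l⟩
  · refine .pop_nil (by simpa using h) (T1 := 1) ?_ (by omega)
    have : zst s { z with p := List.drop 1 [], p' := (List.take 1 []).reverse ++ z.p' } = zst s z := by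
      cases z; simp only at h; simp [h]
    rw [this]
    exact .nop le_rfl
  · refine .pop_cons (b := b) (l := l) (by simpa using h) (T1 := 2) ?_ (by omega)
    cases b <;> exact .push le_rfl (by simp)

/-- The flag `c` treats the loops of `skipProg` and `readProg` together; only the latter counts the
ones in `st`. -/
theorem runs_moveOnes (c : Bool) (hT : 6 * z.p.length + 1 ≤ T) :
    Runs A .qry (.loop (wr .p) (· == some true)
        (if c then .seq moveOne (.push (wr .st) true) else moveOne)) (zst s z)
      (zst s { z with
        p := z.p.dropWhile id
        p' := (z.p.takeWhile id).reverse ++ z.p'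
        st := if c then ones (z.p.takeWhile id).length ++ z.st else z.st }) T := by
  rcases h : z with ⟨p, p', st, o1, o2, o3, w, out, rev, run, res, clk, q⟩
  subst h
  simp only at hT ⊢
  induction p generalizing p' st T with
  | nil => simpa using Runs.loop_done (by simp) (by omega)
  | cons b l ih =>
    cases b with
    | false => simpa using Runs.loop_done (by simp) (by omega)
    | true =>
      simp only [List.length_cons] at hT
      cases c with
      | false =>
        have h1 := ih (true :: p') st le_rfl
        refine .loop_step (by simp) (runs_moveOne le_rfl) (T2 := 6 * l.length + 1) ?_ (by omega)
        simpa using h1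
      | true =>
        have h1 := ih (true :: p') (true :: st) le_rfl
        refine .loop_step (by simp) (T1 := 5) (.seq (runs_moveOne le_rfl) (.push le_rfl rfl) le_rfl)
          (T2 := 6 * l.length + 1) ?_ (by omega)
        simpa [List.replicate_succ'] using h1

/-- The registers `p'` and `p` form a zipper: `p'` reversed, followed by `p`, is always the whole
table. This invariant is what makes rewinding restore the table. -/
theorem take_one_zipper (p' l : Str) :
    ((l.take 1).reverse ++ p').reverse ++ l.drop 1 = p'.reverse ++ l := by
  rw [List.reverse_append, List.reverse_reverse, List.append_assoc, List.take_append_drop]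

theorem takeWhile_zipper (p' l : Str) :
    ((l.takeWhile id).reverse ++ p').reverse ++ l.dropWhile id = p'.reverse ++ l := by
  rw [List.reverse_append, List.reverse_reverse, List.append_assoc, List.takeWhile_append_dropWhile]

theorem runs_skipProg (hT : 6 * z.p.length + 13 ≤ T) : ∃ q', q'.reverse ++ skipEntry z.p =
    z.p'.reverse ++ z.p ∧
    Runs A .qry skipProg (zst s z) (zst s { z with p := skipEntry z.p, p' := q' }) T := by
  have e : skipEntry z.p = ((((z.p.dropWhile id).drop 1).drop 1).drop 1).drop 1 := by
    simp only [skipEntry, List.drop_drop]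
  rw [e]
  refine ⟨_, ?_, .seq (T1 := 6 * z.p.length + 1) (T2 := 12) (runs_moveOnes false le_rfl)
    (.seq (runs_moveOne le_rfl) (.seq (runs_moveOne le_rfl) (.seq (runs_moveOne le_rfl)
      (runs_moveOne le_rfl) le_rfl) le_rfl) le_rfl) (by omega)⟩
  simp only [take_one_zipper, takeWhile_zipper]

theorem runs_readOne {o : Nm n} (ho : o ≠ .p) (ho' : o ≠ .p') (hT : 5 ≤ T) :
    Runs A .qry (readOne o) (zst s z)
      (update (zst s { z with p := z.p.drop 1, p' := (z.p.take 1).reverse ++ z.p' }) (.wk o)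
        ((z.p[0]?).getD false :: zst s z (.wk o))) T := by
  have key : ∀ l l', zst s { z with p := l, p' := l' } (.wk o) = zst s z (.wk o) := by
    intro l l'; cases o <;> first | rfl | contradiction
  rcases h : z.p with _ | ⟨b, l⟩
  · refine .pop_nil (by simpa using h) (T1 := 2) (.push le_rfl ?_) (by omega)
    cases z; simp only at h; simp [h]
  · refine .pop_cons (b := b) (l := l) (by simpa using h) (T1 := 4) ?_ (by omega)
    cases b <;> exact .seq (.push le_rfl rfl) (.push le_rfl (by simp [key])) le_rfl

theorem runs_readProg (h1 : z.o1 = []) (h2 : z.o2 = []) (h3 : z.o3 = []) (hst : z.st = [])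
    {P : Str} (hP : z.p'.reverse ++ z.p = P) (hT : 10 * P.length + 30 ≤ T) :
    Runs A .qry readProg (zst s z) (zst s { z with
      p := P
      p' := []
      st := ones (readEntry z.p).1
      o1 := [(readEntry z.p).2.1]
      o2 := [(readEntry z.p).2.2.1]
      o3 := [(readEntry z.p).2.2.2] }) T := by
  have hl : z.p.length ≤ P.length := by rw [← hP]; simp
  refine .seq (T1 := 6 * z.p.length + 1) (T2 := 4 * P.length + 28) (runs_moveOnes true le_rfl)
    (.seq (runs_moveOne le_rfl) (.seq (T1 := 5) (runs_readOne (by simp) (by simp) le_rfl)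
      (.seq (T1 := 5) (s1 := zst s { z with
          p := (((z.p.dropWhile id).drop 1).drop 1).drop 1
          p' := ((((z.p.dropWhile id).drop 1).drop 1).take 1).reverse ++
            ((((z.p.dropWhile id).drop 1).take 1).reverse ++
            (((z.p.dropWhile id).take 1).reverse ++ ((z.p.takeWhile id).reverse ++ z.p')))
          st := ones (readEntry z.p).1
          o1 := [(readEntry z.p).2.1]
          o2 := [(readEntry z.p).2.2.1] }) ?_
        (.seq (T1 := 5) (s1 := zst s { z with
          p := ((((z.p.dropWhile id).drop 1).drop 1).drop 1).drop 1
          p' := (((((z.p.dropWhile id).drop 1).drop 1).drop 1).take 1).reverse ++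
            (((((z.p.dropWhile id).drop 1).drop 1).take 1).reverse ++
            ((((z.p.dropWhile id).drop 1).take 1).reverse ++
            (((z.p.dropWhile id).take 1).reverse ++ ((z.p.takeWhile id).reverse ++ z.p'))))
          st := ones (readEntry z.p).1
          o1 := [(readEntry z.p).2.1]
          o2 := [(readEntry z.p).2.2.1]
          o3 := [(readEntry z.p).2.2.2] }) ?_
        (runs_unload (by simp) (T := 4 * P.length + 10) ?_ ?_) le_rfl) le_rfl) le_rfl) (by omega))
        (by omega)
  · rw [update_zst_o1]
    convert runs_readOne (o := Nm.o2) (by simp) (by simp) le_rfl using 1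
    rw [update_zst_o2]
    simp [readEntry, hst, h1, h2]
  · convert runs_readOne (o := Nm.o3) (by simp) (by simp) le_rfl using 1
    rw [update_zst_o3]
    simp [readEntry, h3]
  · simp only [zst_p']
    have : P.length = z.p'.length + z.p.length := by rw [← hP]; simp
    have h5 : z.p.length = (z.p.takeWhile id).length + (z.p.dropWhile id).length := by
      rw [← List.length_append, List.takeWhile_append_dropWhile]
    simp
    omega
  · simp only [zst_p', zst_p, take_one_zipper, takeWhile_zipper, update_zst_p, update_zst_p', hP]

/-- The number in `st` is counted down while entries are skipped. Only the zipper invariant is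
recorded for the table during this phase; the final `unload` in `readProg` rewinds the table. -/
theorem runs_entryProg {P : Str} {j : ℕ} (h1 : z.o1 = []) (h2 : z.o2 = []) (h3 : z.o3 = [])
    (hp : z.p = P) (hp' : z.p' = []) (hst : z.st = ones j)
    (hT : j * (6 * P.length + 17) + 10 * P.length + 40 ≤ T) :
    Runs A .qry entryProg (zst s z) (zst s { z with
      st := ones (entry P j).1
      o1 := [(entry P j).2.1]
      o2 := [(entry P j).2.2.1]
      o3 := [(entry P j).2.2.2] }) T := by
  have key : ∀ j q' p, q'.reverse ++ p = P → ∃ r', r'.reverse ++ skipEntry^[j] p = P ∧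
      Runs A .qry (.loop (wr .st) Option.isSome (.seq (.pop (wr .st) .nop .nop .nop) skipProg))
      (zst s { z with st := ones j, p := p, p' := q' })
      (zst s { z with st := [], p := skipEntry^[j] p, p' := r' }) (j * (6 * P.length + 17) + 1) := by
    intro j
    induction j with
    | zero => intro q' p hP; exact ⟨q', hP, .loop_done (by simp) (by omega)⟩
    | succ j ih =>
      intro q' p hP
      obtain ⟨r1, e1, e2⟩ := runs_skipProg (A := A) (s := s)
        (z := { z with st := ones j, p := p, p' := q' }) le_rfl
      obtain ⟨r2, e3, e4⟩ := ih r1 (skipEntry p) (e1.trans hP)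
      have hl : p.length ≤ P.length := by rw [← hP]; simp
      refine ⟨r2, e3, .loop_step (by simp [List.replicate_succ]) (T1 := 6 * P.length + 15)
        (.seq (T1 := 2) (.pop_cons (b := true) (l := ones j) (by simp [List.replicate_succ]) 
          (.nop le_rfl) le_rfl) (T2 := 6 * P.length + 13) ?_ (by omega)) e4 (by ring_nf; omega)⟩
      rw [update_zst_st]
      exact e2.mono (by simp; omega)
  obtain ⟨r', e1, e2⟩ := key j [] P rfl
  have e3 := runs_readProg (A := A) (s := s)
    (z := { z with st := [], p := skipEntry^[j] P, p' := r' }) h1 h2 h3 rfl e1 le_rfl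
  have e4 : z = { z with st := ones j, p := P, p' := [] } := by rw [← hp, ← hp', ← hst]
  rw [e4]
  exact .seq e2 e3 (by omega)

end
end OracleSep

/-! ### Programs for a sweep and for a clocked run. -/

namespace OracleSep
open Function
variable {m n : ℕ} {A : Set Str} {s : Reg m (Nm n) → Str} {z : ZStore} {T : ℕ}

/-- Process one bit of the word in `w`. -/
def bitProg : Prog (Reg m (Nm n)) :=
  .seq (.pop (wr .w) .nop .nop (.push (wr .st) true)) (.seq entryProg
    (.seq (.pop (wr .o1) .nop (.push (wr .out) false) (.push (wr .out) true))
      (.pop (wr .o2) .nop (.pop (wr .o3) .nop .nop .nop)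
        (.pop (wr .o3) .nop (.push .qry false) (.push .qry true)))))

/-- A bound for the cost of looking up an entry of the table `P`. -/
def entryCost (k : ℕ) : ℕ := (k + 3) * (6 * k + 17) + 10 * k + 40

theorem runs_bitProg {P : Str} {a : ℕ × Str × Str} {b : Bool} {l : Str} (h1 : z.o1 = [])
    (h2 : z.o2 = []) (h3 : z.o3 = []) (hp : z.p = P) (hp' : z.p' = []) (ha : a.1 ≤ P.length)
    (hT : entryCost P.length + 10 ≤ T) :
    Runs A .qry bitProg (zst s { z with w := b :: l, st := ones a.1, out := a.2.1, q := a.2.2 })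
      (zst s { z with
        w := l
        st := ones (bitStep P a b).1
        out := (bitStep P a b).2.1
        q := (bitStep P a b).2.2 }) T := by
  have e1 : Runs A .qry (.pop (wr .w) .nop .nop (.push (wr .st) true))
      (zst s { z with w := b :: l, st := ones a.1, out := a.2.1, q := a.2.2 })
      (zst s { z with w := l, st := ones (a.1 + b.toNat), out := a.2.1, q := a.2.2 }) 3 := by
    refine .pop_cons (b := b) (l := l) (by simp) (T1 := 2) ?_ le_rfl
    cases b
    · simpa using Runs.nop (by omega)
    · exact .push le_rfl (by simp [List.replicate_succ])
  have hb : b.toNat ≤ 1 := by cases b <;> simp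
  refine .seq e1 (.seq (T1 := entryCost P.length) (T2 := 7)
    (runs_entryProg (P := P) (j := a.1 + b.toNat) h1 h2 h3 hp hp' rfl ?_) ?_ le_rfl) (by omega)
  · have : (a.1 + b.toNat) * (6 * P.length + 17) ≤ (P.length + 3) * (6 * P.length + 17) :=
      Nat.mul_le_mul_right _ (by omega)
    unfold entryCost
    omega
  · rcases he : entry P (a.1 + b.toNat) with ⟨σ, b1, b2, b3⟩
    have e : bitStep P a b = (σ, b1 :: a.2.1, if b2 then b3 :: a.2.2 else a.2.2) := by
      simp [bitStep, he]
    rw [e]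
    refine .seq (T1 := 3) (T2 := 4) (.pop_cons (b := b1) (l := []) (by simp) (T1 := 2) (s' := zst s { z with
        w := l
        st := ones σ
        out := b1 :: a.2.1
        q := a.2.2
        o2 := [b2]
        o3 := [b3] }) ?_ le_rfl) (.pop_cons (b := b2) (l := []) (by simp) (T1 := 3) ?_ le_rfl) le_rfl
    · cases b1 <;> exact .push le_rfl (by simp [h1])
    · cases b2
      · refine .pop_cons (b := b3) (l := []) (by simp) (T1 := 2) ?_ le_rfl
        cases b3 <;> simpa [h2, h3] using Runs.nop (by omega)
      · refine .pop_cons (b := b3) (l := []) (by simp) (T1 := 2) ?_ le_rfl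
        cases b3 <;> exact .push le_rfl (by simp [h2, h3])

theorem bitStep_fst_le (P : Str) (a b) : (bitStep P a b).1 ≤ P.length := entry_fst_le _ _

/-- Each bit read yields exactly one bit of the new word and at most one symbol of the query. -/
theorem foldl_bitStep_length (P : Str) (w : Str) (a) :
    (w.foldl (bitStep P) a).2.1.length = w.length + a.2.1.length ∧
      (w.foldl (bitStep P) a).2.2.length ≤ w.length + a.2.2.length := by
  induction w generalizing a with
  | nil => simp
  | cons b w ih =>
    obtain ⟨h1, h2⟩ := ih (bitStep P a b)
    have h3 : (bitStep P a b).2.1.length = a.2.1.length + 1 := by simp [bitStep]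
    have h4 : (bitStep P a b).2.2.length ≤ a.2.2.length + 1 := by
      simp only [bitStep]; split_ifs <;> simp
    simp only [List.foldl_cons, List.length_cons]
    omega

theorem foldl_bitStep_fst_le (P : Str) (w : Str) (a) (ha : a.1 ≤ P.length) :
    (w.foldl (bitStep P) a).1 ≤ P.length := by
  induction w generalizing a with
  | nil => simpa
  | cons b w ih => exact ih _ (bitStep_fst_le _ _ _)

theorem sweep_length (P : Str) (c : ℕ × Str) : (sweep A P c).2.2.length = c.2.length := by
  simpa [sweep, passOver] using (foldl_bitStep_length P c.2 (c.1, [], [])).1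

theorem sweep_fst_le (P : Str) (c : ℕ × Str) : (sweep A P c).2.1 ≤ P.length := entry_fst_le _ _

/-- Run a sweeping machine for one sweep. -/
def sweepProg : Prog (Reg m (Nm n)) :=
  .seq (.loop (wr .w) Option.isSome bitProg)
  (.seq (.ask (pushAll (wr .st) (ones 3)) (pushAll (wr .st) (ones 2)))
  (.seq (drain .qry)
  (.seq entryProg
  (.seq (.pop (wr .o1) .nop (.pop (wr .o2) .nop .nop .nop)
    (.seq (drain (wr .run)) 
      (.pop (wr .o2) .nop (.push (wr .res) false) (.push (wr .res) true))))
  (.seq (drain (wr .o3))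
  (.seq (unload (wr .out) (wr .rev)) (unload (wr .rev) (wr .w))))))))

/-- A bound for the cost of a sweep. -/
def sweepCost (k l : ℕ) : ℕ := (l + 1) * (entryCost k + 40)

/-- The last bit written is on top of `out`, which is the order in which the next sweep, in the
opposite direction, reads the word; hence the two reversals through `rev`. The query register also
has its last symbol on top, in agreement with the convention for `ask`. -/
theorem runs_sweepProg {P : Str} {c : ℕ × Str} (h1 : z.o1 = [])
    (h2 : z.o2 = []) (h3 : z.o3 = []) (hp : z.p = P) (hp' : z.p' = []) (hc : c.1 ≤ P.length)
    (ho : z.out = []) (hr : z.rev = []) (hq : z.q = []) (hrun : z.run = [true]) (hres : z.res = [])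
    (hT : sweepCost P.length c.2.length ≤ T) :
    Runs A .qry sweepProg (zst s { z with w := c.2, st := ones c.1 })
      (zst s { z with
        w := (sweep A P c).2.2
        st := ones (sweep A P c).2.1
        run := if (sweep A P c).1.isSome then [] else [true]
        res := (sweep A P c).1.toList }) T := by
  obtain ⟨zp, zp', zs, zo1, zo2, zo3, zw, zout, zrev, zrun, zres, zclk, zq⟩ := z
  simp only at h1 h2 h3 hp hp' ho hr hq hrun hres
  subst h1 h2 h3 hp hp' ho hr hq hrun hres
  rename' zp => P
  simp only
  have e1 := Runs.loop_foldl (A := A) (qr := .qry) (p := bitProg) (i := wr .w)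
    (T1 := entryCost P.length + 10) (T := c.2.length * (entryCost P.length + 11) + 1)
    (fun l (a : ℕ × Str × Str) => zst s ⟨P, [], ones a.1, [], [], [], l, a.2.1, [], [true], [], zclk, a.2.2⟩)
    (bitStep P) (fun _ a => a.1 ≤ P.length) (fun l a _ => by simp)
    (fun b l a ha => ⟨bitStep_fst_le _ _ _, runs_bitProg
      (z := ⟨P, [], [], [], [], [], [], [], [], [true], [], zclk, []⟩) rfl rfl rfl rfl rfl ha le_rfl⟩) c.2
    (c.1, [], []) hc le_rfl
  set a := c.2.foldl (bitStep P) (c.1, [], []) with ha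
  have ha1 : a.1 ≤ P.length := foldl_bitStep_fst_le _ _ _ hc
  obtain ⟨ha2, ha3⟩ := foldl_bitStep_length P c.2 (c.1, [], [])
  rw [← ha] at ha2 ha3
  simp only [List.length_nil, add_zero] at ha2 ha3
  classical
  -- Offsets `0` and `1` from a state select its entries for a bit, offsets `2` and `3` those for
  -- the answer of the oracle.
  let d := if a.2.2.reverse ∈ A then 3 else 2
  have hd : d ≤ 3 := by simp only [d]; split_ifs <;> omega
  have e2 : Runs A .qry (.ask (pushAll (wr .st) (ones 3)) (pushAll (wr .st) (ones 2)))
      (zst s ⟨P, [], ones a.1, [], [], [], [], a.2.1, [], [true], [], zclk, a.2.2⟩)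
      (zst s ⟨P, [], ones (a.1 + d), [], [], [], [], a.2.1, [], [true], [], zclk, a.2.2⟩) 8 := by
    by_cases hA : a.2.2.reverse ∈ A
    · refine .ask_yes hA (T1 := 7) (runs_pushAll _ _ (by simp) ?_) le_rfl
      simp [d, hA, add_comm a.1, List.replicate_add]
    · refine .ask_no hA (T1 := 7) (runs_pushAll _ _ (by simp) ?_) le_rfl
      simp [d, hA, add_comm a.1, List.replicate_add]
  rcases he : entry P (a.1 + d) with ⟨σ, b1, b2, b3⟩
  have e : sweep A P c = (if b1 then some b2 else none, σ, a.2.1) := by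
    simp [sweep, passOver, ← ha, d] at he ⊢; simp [he]
  rw [e]
  refine .seq e1 (.seq e2 (.seq (T1 := 3 * c.2.length + 1) (runs_drain _ (by simp; omega))
    (.seq (T1 := entryCost P.length) (by
      rw [update_zst_q]
      refine runs_entryProg (P := P) (j := a.1 + d) rfl rfl rfl rfl rfl rfl ?_
      have : (a.1 + d) * (6 * P.length + 17) ≤ (P.length + 3) * (6 * P.length + 17) :=
        Nat.mul_le_mul_right _ (by omega)
      unfold entryCost
      omega)
    (.seq (T1 := 8) (s1 := zst s ⟨P, [], ones σ, [], [], [b3], [], a.2.1, [],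
        if b1 then [] else [true], if b1 then [b2] else [], zclk, []⟩) ?_
    (.seq (T1 := 4) (runs_drain _ (by simp))
    (.seq (T1 := 4 * c.2.length + 1) (runs_unload (by simp) (by simp [ha2]) rfl)
      (runs_unload (by simp) (T := 4 * c.2.length + 1) (by simp [ha2]) ?_)
      le_rfl) le_rfl) le_rfl) le_rfl) le_rfl) le_rfl) ?_
  · rw [he]
    refine .pop_cons (b := b1) (l := []) (by simp) (T1 := 7) ?_ le_rfl
    cases b1
    · refine .pop_cons (b := b2) (l := []) (by simp) (T1 := 1) ?_ (by omega)
      cases b2 <;> simpa using Runs.nop le_rfl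
    · refine .seq (T1 := 4) (T2 := 3) (runs_drain _ (by simp)) (.pop_cons (b := b2) (l := [])
        (by simp) (T1 := 2) ?_ le_rfl) le_rfl
      cases b2 <;> exact .push le_rfl (by simp)
  · simp only [update_zst_o3, update_zst_out, update_zst_rev, update_zst_w, zst_rev, zst_out, zst_w]
    cases b1 <;> simp
  · unfold sweepCost at hT
    simp only [add_mul, mul_add] at hT ⊢
    omega

/-- Run a sweeping machine for as many sweeps as there are symbols in `clk`, unless it halts. -/
def clockedProg : Prog (Reg m (Nm n)) :=
  .loop (wr .clk) Option.isSome (.seq (.pop (wr .clk) .nop .nop .nop)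
    (.pop (wr .run) .nop .nop (.seq (.push (wr .run) true) sweepProg)))

/-- After a verdict `run` is empty and the remaining rounds only use up the clock. Of the final
configuration `c'` no more than its size is needed, for the cost of cleaning up. -/
theorem runs_clockedProg {P : Str} {c : ℕ × Str} {N : ℕ} (h1 : z.o1 = [])
    (h2 : z.o2 = []) (h3 : z.o3 = []) (hp : z.p = P) (hp' : z.p' = []) (hc : c.1 ≤ P.length)
    (ho : z.out = []) (hr : z.rev = []) (hq : z.q = []) 
    (hT : N * (sweepCost P.length c.2.length + 10) + 1 ≤ T) :
    ∃ c' : ℕ × Str, c'.1 ≤ P.length ∧ c'.2.length = c.2.length ∧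
    Runs A .qry clockedProg
      (zst s { z with w := c.2, st := ones c.1, run := [true], res := [], clk := ones N })
      (zst s { z with
        w := c'.2
        st := ones c'.1
        run := if (verdict A P N c).isSome then [] else [true]
        res := (verdict A P N c).toList
        clk := [] }) T := by
  have key : ∀ (N : ℕ) (c : ℕ × Str) (r : Str), Runs A .qry clockedProg
      (zst s { z with w := c.2, st := ones c.1, run := [], res := r, clk := ones N })
      (zst s { z with w := c.2, st := ones c.1, run := [], res := r, clk := [] }) (N * 10 + 1) := by
    intro N c r
    induction N with
    | zero => exact .loop_done (by simp) (by omega)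
    | succ N ih =>
      refine .loop_step (by simp [List.replicate_succ]) (T1 := 4) (.seq (T1 := 2) (T2 := 2)
        (.pop_cons (b := true) (l := ones N) (by simp [List.replicate_succ]) (.nop le_rfl) le_rfl)
        (.pop_nil (by simp) (.nop le_rfl) le_rfl) le_rfl) (T2 := N * 10 + 1) ?_ (by omega)
      simpa [clockedProg] using ih
  induction N generalizing c T with
  | zero =>
    refine ⟨c, hc, rfl, ?_⟩
    simpa [verdict, clockedProg] using Runs.loop_done (by simp) (by omega)
  | succ N ih =>
    have e1 := runs_sweepProg (A := A) (s := s) (P := P) (c := c) (T := sweepCost P.length c.2.length)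
      (z := { z with run := [true], res := [], clk := ones N }) h1 h2 h3 hp hp' hc ho hr hq rfl rfl le_rfl
    have e2 : Runs A .qry (.seq (.pop (wr .clk) .nop .nop .nop)
        (.pop (wr .run) .nop .nop (.seq (.push (wr .run) true) sweepProg)))
        (zst s { z with w := c.2, st := ones c.1, run := [true], res := [], clk := ones (N + 1) })
        (zst s { z with
          w := (sweep A P c).2.2
          st := ones (sweep A P c).2.1
          run := if (sweep A P c).1.isSome then [] else [true]
          res := (sweep A P c).1.toList
          clk := ones N }) (sweepCost P.length c.2.length + 5) := by
      refine .seq (T1 := 2) (T2 := sweepCost P.length c.2.length + 3)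
        (.pop_cons (b := true) (l := ones N) (by simp [List.replicate_succ]) (.nop le_rfl) le_rfl)
        (.pop_cons (b := true) (l := []) (by simp) (T1 := sweepCost P.length c.2.length + 2)
        (.seq (T1 := 2) (.push le_rfl rfl) (T2 := sweepCost P.length c.2.length) ?_ (by omega)) le_rfl)
        (by omega)
      simpa using e1
    rcases hs : (sweep A P c).1 with _ | b
    · obtain ⟨c', i1, i2, i3⟩ := ih (c := (sweep A P c).2) (sweep_fst_le _ _) le_rfl
      rw [sweep_length] at i2 i3
      refine ⟨c', i1, i2, ?_⟩
      simp only [verdict, hs, Option.none_or]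
      refine .loop_step (by simp [List.replicate_succ]) e2 (by simpa [hs, clockedProg] using i3) ?_
      simp only [add_mul, mul_add] at hT ⊢
      omega
    · refine ⟨(sweep A P c).2, sweep_fst_le _ _, sweep_length _ _, ?_⟩
      simp only [verdict, hs, Option.some_or]
      refine .loop_step (by simp [List.replicate_succ]) e2 (by simpa [hs, clockedProg] using key N _ [b]) ?_
      simp only [add_mul, mul_add] at hT ⊢
      omega

end OracleSep

namespace OracleSep
open Function

/-! ### Polynomial bounds -/

namespace PolyBdd

variable {f g : ℕ → ℕ}

theorem of_le (h : PolyBdd g) (hf : ∀ n, f n ≤ g n) : PolyBdd f :=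
  let ⟨c, hc⟩ := h; ⟨c, fun n => (hf n).trans (hc n)⟩

/-- The form `k (n + 1) ^ k` is the convenient one for sums and products, because powers of `n + 1`
are monotone in the exponent also for `n = 0`. -/
theorem iff_mul : PolyBdd f ↔ ∃ k, ∀ n, f n ≤ k * (n + 1) ^ k := by
  constructor
  · rintro ⟨c, hc⟩
    refine ⟨c + 1, fun n => (hc n).trans ?_⟩
    have h1 : n ^ c ≤ (n + 1) ^ c := Nat.pow_le_pow_left (by omega) _
    have h2 : (n + 1) ^ c ≤ (n + 1) ^ (c + 1) := Nat.pow_le_pow_right (by omega) (by omega)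
    have h3 : 1 ≤ (n + 1) ^ (c + 1) := Nat.one_le_pow _ _ (by omega)
    nlinarith
  · rintro ⟨k, hk⟩
    -- For `n ≥ 2` the power with exponent `3 k` suffices, since `k ≤ n ^ k` and `n + 1 ≤ n ^ 2`.
    -- The constant covers `n = 0` and `n = 1`, where powers of `n` are of no help.
    refine ⟨3 * k + k * 2 ^ k, fun n => (hk n).trans ?_⟩
    have h0 : 1 ≤ 2 ^ k := Nat.one_le_pow _ _ (by omega)
    rcases n with _ | _ | n
    · simp only [zero_add, one_pow, mul_one]
      exact le_add_left (by omega)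
    · norm_num; omega
    · have h1 : k ≤ (n + 2) ^ k := (Nat.lt_pow_self (by omega)).le
      have h2 : (n + 2 + 1) ^ k ≤ ((n + 2) ^ 2) ^ k := Nat.pow_le_pow_left (by nlinarith) _
      calc k * (n + 2 + 1) ^ k ≤ (n + 2) ^ k * ((n + 2) ^ 2) ^ k := Nat.mul_le_mul h1 h2
        _ = (n + 2) ^ (3 * k) := by rw [← pow_mul, ← pow_add]; congr 1; omega
        _ ≤ (n + 2) ^ (3 * k + k * 2 ^ k) := Nat.pow_le_pow_right (by omega) (by omega)
        _ ≤ _ := Nat.le_add_right _ _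

theorem const (a : ℕ) : PolyBdd fun _ => a := ⟨a, fun _ => Nat.le_add_left _ _⟩

theorem id' : PolyBdd fun n => n := ⟨1, fun _ => by simp⟩

theorem add (hf : PolyBdd f) (hg : PolyBdd g) : PolyBdd fun n => f n + g n := by
  obtain ⟨a, ha⟩ := iff_mul.1 hf
  obtain ⟨b, hb⟩ := iff_mul.1 hg
  refine iff_mul.2 ⟨a + b, fun n => ?_⟩
  have h1 : (n + 1) ^ a ≤ (n + 1) ^ (a + b) := Nat.pow_le_pow_right (by omega) (by omega)
  have h2 : (n + 1) ^ b ≤ (n + 1) ^ (a + b) := Nat.pow_le_pow_right (by omega) (by omega)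
  have := ha n
  have := hb n
  nlinarith

theorem mul (hf : PolyBdd f) (hg : PolyBdd g) : PolyBdd fun n => f n * g n := by
  obtain ⟨a, ha⟩ := iff_mul.1 hf
  obtain ⟨b, hb⟩ := iff_mul.1 hg
  refine iff_mul.2 ⟨a * b + (a + b), fun n => ?_⟩
  calc f n * g n ≤ (a * (n + 1) ^ a) * (b * (n + 1) ^ b) := Nat.mul_le_mul (ha n) (hb n)
    _ = (a * b) * (n + 1) ^ (a + b) := by ring
    _ ≤ _ := Nat.mul_le_mul (by omega) (Nat.pow_le_pow_right (by omega) (by omega))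

theorem pow (hf : PolyBdd f) (k : ℕ) : PolyBdd fun n => f n ^ k := by
  induction k with
  | zero => simpa using const 1
  | succ k ih => simpa [pow_succ] using ih.mul hf

theorem comp (hf : PolyBdd f) (hg : PolyBdd g) : PolyBdd fun n => f (g n) :=
  let ⟨c, hc⟩ := hf
  ((hg.pow c).add (const c)).of_le fun n => hc (g n)

end PolyBdd

/-! ### The initial word of a sweeping machine -/

/-- A number for the content of a cell. -/
def symCode : Option Bool → ℕ
  | none => 0
  | some false => 1
  | some true => 2

/-- A number for the first symbols of several strings. -/
def headCode (xs : List Str) : ℕ := xs.foldr (fun x a => 3 * a + symCode x.head?) 0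

/-- A number for the symbols at the place `z` of several strings. -/
def cellCode (xs : List Str) (z : ℕ) : ℕ := xs.foldr (fun x a => 3 * a + symCode x[z]?) 0

/-- The word by which a cell is represented according to the list `tab`. -/
def block (tab : List Str) (c o : ℕ) : Str := (tab[2 * c + o]?).getD []

/-- The representation of the cells `S, …, 0` with the strings `xs` on several tracks. -/
def posWord (tab : List Str) (xs : List Str) : ℕ → Str
  | 0 => block tab (cellCode xs 0) 1
  | S + 1 => block tab (cellCode xs (S + 1)) 0 ++ posWord tab xs S

/-- The representation of `S` empty cells. -/
def negWord (tab : List Str) : ℕ → Str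
  | 0 => []
  | S + 1 => block tab 0 0 ++ negWord tab S

/-- The representation of the cells `S, …, -S` with the strings `xs` on several tracks. -/
def initWord (tab : List Str) (xs : List Str) (S : ℕ) : Str := posWord tab xs S ++ negWord tab S

/-- A bound for the length of the words in a list. -/
def maxBlock (tab : List Str) : ℕ := (tab.map List.length).sum

theorem length_block_le (tab : List Str) (c o : ℕ) : (block tab c o).length ≤ maxBlock tab := by
  unfold block maxBlock
  rcases h : tab[2 * c + o]? with _ | l
  · simp
  · exact List.single_le_sum (by simp) _ (List.mem_map_of_mem (List.mem_of_getElem? h))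

theorem length_posWord_le (tab xs : List Str) (S : ℕ) :
    (posWord tab xs S).length ≤ (S + 1) * maxBlock tab := by
  induction S with
  | zero => simpa [posWord] using length_block_le _ _ _
  | succ S ih =>
    have := length_block_le tab (cellCode xs (S + 1)) 0
    simp only [posWord, List.length_append]
    nlinarith

theorem length_negWord_le (tab : List Str) (S : ℕ) :
    (negWord tab S).length ≤ S * maxBlock tab := by
  induction S with
  | zero => simp [negWord]
  | succ S ih =>
    have := length_block_le tab 0 0
    simp only [negWord, List.length_append]
    nlinarith

theorem length_initWord_le (tab xs : List Str) (S : ℕ) :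
    (initWord tab xs S).length ≤ (2 * S + 1) * maxBlock tab := by
  have := length_posWord_le tab xs S
  have := length_negWord_le tab S
  simp only [initWord, List.length_append]
  nlinarith

/-- The bound `N ^ c + c`, where `N` is the total length of the strings `xs`. -/
def clockBound (c : ℕ) (xs : List Str) : ℕ := (xs.map List.length).sum ^ c + c

/-- The relation that is decided by a sweeping machine within a polynomial number of sweeps. -/
def SweepRel (A : Set Str) (tab : List Str) (P : Str) (c : ℕ) (xs : List Str) : Prop :=
  verdict A P (clockBound c xs) (0, initWord tab xs (clockBound c xs)) = some true

variable {m n : ℕ} {A : Set Str}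

/-- Pop one symbol from each of the stacks `rs` and go on with a program that depends on them. -/
def readCell {ι : Type} : List ι → (ℕ → Prog ι) → Prog ι
  | [], k => k 0
  | r :: rs, k => readCell rs fun a => .pop r (k (3 * a)) (k (3 * a + 1)) (k (3 * a + 2))

/-- The store in which `z` symbols have been removed from each of the stacks `rs`. -/
def dropAll {ι : Type} [DecidableEq ι] (rs : List ι) (z : ℕ) (s : ι → Str) : ι → Str :=
  fun r => if r ∈ rs then (s r).drop z else s r

/-- The symbols read are remembered in the control: the continuation `k` receives them as ternary
digits. Exhausted stacks give the digit `0` and remain empty, just as `drop` does. -/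
theorem runs_readCell {ι : Type} [DecidableEq ι] {qr : ι} {s s' : ι → Str} {T T' : ℕ} {rs : List ι}
    (hrs : rs.Nodup) {k : ℕ → Prog ι} (h : Runs A qr (k (headCode (rs.map s))) (dropAll rs 1 s) s' T)
    (hT : T + rs.length ≤ T') : Runs A qr (readCell rs k) s s' T' := by
  induction rs generalizing k T with
  | nil => 
    have : dropAll [] 1 s = s := by funext r; simp [dropAll]
    rw [this] at h
    exact h.mono hT
  | cons r rs ih =>
    rw [List.nodup_cons] at hrs
    refine ih hrs.2 (k := fun a => .pop r (k (3 * a)) (k (3 * a + 1)) (k (3 * a + 2))) (T := T + 1) ?_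
      (by simp at hT; omega)
    have h1 : dropAll rs 1 s r = s r := by simp [dropAll, hrs.1]
    have h2 : update (dropAll rs 1 s) r (s r).tail = dropAll (r :: rs) 1 s := by
      funext r'
      by_cases hr : r' = r
      · subst hr; simp [dropAll]
      · simp [dropAll, hr]
    rcases hs : s r with _ | ⟨b, l⟩
    · refine .pop_nil (h1.trans hs) ?_ le_rfl
      rw [hs] at h2
      have h3 : update (dropAll rs 1 s) r ([] : Str).tail = dropAll rs 1 s := by
        rw [update_eq_self_iff, h1, hs]; rfl
      rw [h3] at h2
      rw [h2]
      simpa [headCode, hs, symCode] using h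
    · refine .pop_cons (h1.trans hs) ?_ le_rfl
      rw [hs] at h2
      rw [show l = (b :: l).tail from rfl, h2]
      cases b <;> simpa [headCode, hs, symCode] using h

theorem dropAll_dropAll {ι : Type} [DecidableEq ι] (rs : List ι) (y z : ℕ) (s : ι → Str) :
    dropAll rs y (dropAll rs z s) = dropAll rs (z + y) s := by
  funext r
  by_cases h : r ∈ rs <;> simp [dropAll, h]

theorem headCode_dropAll {ι : Type} [DecidableEq ι] (rs : List ι) (z : ℕ) (s : ι → Str) :
    headCode (rs.map (dropAll rs z s)) = cellCode (rs.map s) z := by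
  simp only [headCode, cellCode, List.foldr_map]
  refine List.foldr_ext _ _ _ fun r hr a => ?_
  simp [dropAll, hr, List.head?_drop]

section frame

variable (s : Reg m (Nm n) → Str) (z : ZStore) (l : Str)

/-- The counterpart of `zst_update` for registers outside the record: their updates pass to the
underlying store. -/
theorem update_zst_outer {r : Reg m (Nm n)} (h : ∀ s z, zst s z r = s r) :
    update (zst s z) r l = zst (update s r l) z := by
  funext r'
  by_cases hr : r' = r
  · subst hr; rw [update_self, h, update_self]
  · rw [update_of_ne hr]
    rcases r' with i | r' | _
    · exact (update_of_ne hr _ _).symm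
    · cases r' <;> first | rfl | exact (update_of_ne hr _ _).symm
    · rfl

@[simp] theorem zst_t : zst s z (.wk .t) = s (.wk .t) := rfl
@[simp] theorem zst_v : zst s z (.wk .v) = s (.wk .v) := rfl
@[simp] theorem zst_len : zst s z (.wk .len) = s (.wk .len) := rfl
@[simp] theorem zst_bd : zst s z (.wk .bd) = s (.wk .bd) := rfl
@[simp] theorem update_zst_v : update (zst s z) (.wk .v) l = zst (update s (.wk .v) l) z :=
  update_zst_outer s z l fun _ _ => rfl
@[simp] theorem update_zst_len : update (zst s z) (.wk .len) l = zst (update s (.wk .len) l) z :=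
  update_zst_outer s z l fun _ _ => rfl
@[simp] theorem update_zst_bd : update (zst s z) (.wk .bd) l = zst (update s (.wk .bd) l) z :=
  update_zst_outer s z l fun _ _ => rfl

end frame

/-- The registers that may hold the inputs of a sweeping machine. -/
def IsSource : Reg m (Nm n) → Prop
  | .inp _ => True
  | .wk .py => True
  | .wk (.y _) => True
  | _ => False

theorem IsSource.zst {r : Reg m (Nm n)} (h : IsSource r) (s z) : zst s z r = s r := by
  rcases r with i | r | _
  · rfl
  · cases r <;> first | rfl | exact h.elim
  · exact h.elim

theorem dropAll_zst {rs : List (Reg m (Nm n))} (h : ∀ r ∈ rs, IsSource r) (k : ℕ) (s z) :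
    dropAll rs k (zst s z) = zst (dropAll rs k s) z := by
  funext r
  by_cases hr : r ∈ rs
  · rw [(h r hr).zst]
    simp [dropAll, hr, (h r hr).zst]
  · simp only [dropAll, hr, if_false]
    rcases r with i | r | _
    · simp [OracleSep.zst, dropAll, hr]
    · cases r <;> simp [OracleSep.zst, dropAll, hr]
    · rfl

theorem dropAll_update {rs : List (Reg m (Nm n))} {r : Reg m (Nm n)} (hr : r ∉ rs) (k : ℕ) (s l) :
    dropAll rs k (update s r l) = update (dropAll rs k s) r l := by
  funext r'
  by_cases h : r' = r
  · subst h; simp [dropAll, hr]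
  · simp [dropAll, h]

end OracleSep

/-! ### Writing the initial word and measuring the inputs. -/

namespace OracleSep
open Function
variable {m n : ℕ} {A : Set Str} {s : Reg m (Nm n) → Str} {z : ZStore} {T : ℕ}
  {rs : List (Reg m (Nm n))}

/-- Write the initial word. -/
def initProg (tab : List Str) (rs : List (Reg m (Nm n))) : Prog (Reg m (Nm n)) :=
  .seq (addLen (wr .bd) (wr .v) (wr .t))
  (.seq (.loop (wr .v) Option.isSome (.seq (.pop (wr .v) .nop .nop .nop)
    (pushAll (wr .w) (block tab 0 0))))
  (.seq (readCell rs fun c => pushAll (wr .w) (block tab c 1))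
  (.seq (addLen (wr .bd) (wr .v) (wr .t))
  (.loop (wr .v) Option.isSome (.seq (.pop (wr .v) .nop .nop .nop)
    (readCell rs fun c => pushAll (wr .w) (block tab c 0)))))))

/-- A bound for the cost of writing the initial word. -/
def initCost (K k S : ℕ) : ℕ := (2 * S + 1) * (2 * K + k + 20) + 20

theorem foldl_count (l : Str) (a : ℕ) : l.foldl (fun i _ => i + 1) a = a + l.length := by
  induction l generalizing a with
  | nil => rfl
  | cons b l ih => simp [ih]; omega

theorem IsSource.ne {r : Nm n} {r' : Reg m (Nm n)} (h : IsSource r') (hr : ¬ IsSource (wr r : Reg m (Nm n))) :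
    r' ≠ wr r := fun e => hr (e ▸ h)

theorem IsSource.notMem {r : Nm n} (h : ∀ r ∈ rs, IsSource r) (hr : ¬ IsSource (wr r : Reg m (Nm n))) :
    wr r ∉ rs := fun e => hr (h _ e)

/-- The stack `w` is filled from below: the negative cells, then cell `0` with the mark of the
origin, then the cells `1, …, S`. The positive cells thus occur in the order in which the inputs are
popped, and cell `S` is on top at the end. -/
theorem runs_initProg (tab : List Str) (hrs : rs.Nodup) (hsrc : ∀ r ∈ rs, IsSource r) {S : ℕ}
    (hw : z.w = []) (ht : s (wr .t) = []) (hv : s (wr .v) = []) (hbd : s (wr .bd) = ones S)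
    (hT : initCost (maxBlock tab) rs.length S ≤ T) :
    Runs A .qry (initProg tab rs) (zst s z)
      (zst (dropAll rs (S + 1) s) { z with w := initWord tab (rs.map s) S }) T := by
  have hvs : wr .v ∉ rs := IsSource.notMem hsrc (by simp [IsSource])
  have hts : wr .t ∉ rs := IsSource.notMem hsrc (by simp [IsSource])
  have hbds : wr .bd ∉ rs := IsSource.notMem hsrc (by simp [IsSource])
  have e0 : Runs A .qry (addLen (wr .bd) (wr .v) (wr .t)) (zst s z)
      (zst (update s (wr .v) (ones S)) z) (10 * S + 2) :=
    runs_addLen (by simp) (by simp) (by simp) (by simpa using ht) (by simp [hbd])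
      (by simp [hbd, hv])
  have e1 := Runs.loop_foldl (A := A) (qr := .qry) (p := .seq (.pop (wr .v) .nop .nop .nop)
      (pushAll (wr .w) (block tab 0 0))) (i := wr .v) (T1 := 2 * maxBlock tab + 3)
    (T := S * (2 * maxBlock tab + 4) + 1)
    (fun l (i : ℕ) => zst (update s (wr .v) l) { z with w := negWord tab i }) (fun i _ => i + 1)
    (fun _ _ => True) (fun l i _ => by simp)
    (fun b l i _ => ⟨trivial, .seq (T1 := 2) (.pop_cons (b := b) (l := l) (by simp)
      (by rw [Bool.cond_self]; exact .nop le_rfl) le_rfl)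
      (runs_pushAll _ _ le_rfl (by simp [negWord])) (by
        have := length_block_le tab 0 0; omega)⟩) (ones S) 0 trivial (by simp)
  have e2 : Runs A .qry (readCell rs fun c => pushAll (wr .w) (block tab c 1))
      (zst s { z with w := negWord tab S })
      (zst (dropAll rs 1 s) { z with w := posWord tab (rs.map s) 0 ++ negWord tab S })
      (2 * maxBlock tab + 1 + rs.length) := by
    refine runs_readCell hrs (T := 2 * maxBlock tab + 1) (runs_pushAll _ _ ?_ ?_) le_rfl
    · have := length_block_le tab (headCode (rs.map (zst s { z with w := negWord tab S }))) 1
      omega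
    · have h0 : rs.map (zst s { z with w := negWord tab S }) = rs.map s :=
        List.map_congr_left fun r hr => (hsrc r hr).zst _ _
      have h1 := headCode_dropAll rs 0 s
      have h2 : dropAll rs 0 s = s := by funext r; simp [dropAll]
      rw [h2] at h1
      rw [dropAll_zst hsrc, h0, h1]
      simp [posWord]
  have e3 : Runs A .qry (addLen (wr .bd) (wr .v) (wr .t))
      (zst (dropAll rs 1 s) { z with w := posWord tab (rs.map s) 0 ++ negWord tab S })
      (zst (update (dropAll rs 1 s) (wr .v) (ones S))
        { z with w := posWord tab (rs.map s) 0 ++ negWord tab S }) (10 * S + 2) :=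
    runs_addLen (by simp) (by simp) (by simp) (by simpa [dropAll, hts] using ht)
      (by simp [hbd, dropAll, hbds]) (by simp [hbd, hv, dropAll, hbds, hvs])
  have e4 := Runs.loop_foldl (A := A) (qr := .qry) (p := .seq (.pop (wr .v) .nop .nop .nop)
      (readCell rs fun c => pushAll (wr .w) (block tab c 0))) (i := wr .v)
    (T1 := 2 * maxBlock tab + 3 + rs.length)
    (T := S * (2 * maxBlock tab + 4 + rs.length) + 1)
    (fun l (i : ℕ) => zst (update (dropAll rs (i + 1) s) (wr .v) l)
      { z with w := posWord tab (rs.map s) i ++ negWord tab S }) (fun i _ => i + 1)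
    (fun _ _ => True) (fun l i _ => by simp)
    (fun b l i _ => ⟨trivial, .seq (T1 := 2) (.pop_cons (b := b) (l := l) (by simp)
      (by rw [Bool.cond_self]; exact .nop le_rfl) le_rfl)
      (runs_readCell hrs (T := 2 * maxBlock tab + 1) (runs_pushAll _ _ (by
        have := length_block_le tab (headCode (rs.map (zst (update (dropAll rs (i + 1) s) (wr .v) l)
          { z with w := posWord tab (rs.map s) i ++ negWord tab S }))) 0
        simp only [update_zst_v, update_idem]
        omega) (by
        simp only [update_zst_v, update_idem]
        have h0 : rs.map (zst (update (dropAll rs (i + 1) s) (wr .v) l)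
            { z with w := posWord tab (rs.map s) i ++ negWord tab S }) =
            rs.map (dropAll rs (i + 1) s) :=
          List.map_congr_left fun r hr => by
            rw [(hsrc r hr).zst, update_of_ne ((hsrc r hr).ne (by simp [IsSource]))]
        rw [dropAll_zst hsrc, dropAll_update hvs, dropAll_dropAll, h0, headCode_dropAll,
          update_zst_w]
        simp [posWord])) le_rfl) (by omega)⟩) (ones S) 0 trivial (by
          simp only [List.length_replicate]
          have : 2 * maxBlock tab + 3 + rs.length + 1 = 2 * maxBlock tab + 4 + rs.length := by omega
          rw [this])
  simp only [foldl_count, zero_add, List.length_replicate] at e1 e4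
  have h5 : ∀ k, update (dropAll rs k s) (wr .v) [] = dropAll rs k s := fun k => by
    rw [update_eq_self_iff]; simp [dropAll, hvs, hv]
  have h6 : update s (wr .v) [] = s := by rw [update_eq_self_iff, hv]
  rw [h6] at e1
  rw [h5] at e4
  have h7 : z = { z with w := negWord tab 0 } := by simp [negWord, ← hw]
  rw [← h7] at e1
  refine .seq e0 (.seq e1 (.seq e2 (.seq e3 e4 le_rfl) le_rfl) le_rfl) ?_
  simp only [initCost, add_mul, mul_add] at hT ⊢
  nlinarith [Nat.zero_le (S * rs.length)]

/-- Push `N` symbols onto `len`, where `N` is the total length of the stacks `rs`. -/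
def sumLen : List (Reg m (Nm n)) → Prog (Reg m (Nm n))
  | [] => .nop
  | r :: rs => .seq (sumLen rs) (addLen r (wr .len) (wr .t))

theorem runs_sumLen (hsrc : ∀ r ∈ rs, IsSource r) (ht : s (wr .t) = []) (hlen : s (wr .len) = [])
    (hT : 10 * (rs.map fun r => (s r).length).sum + 2 * rs.length + 1 ≤ T) :
    Runs A .qry (sumLen rs) (zst s z)
      (zst (update s (wr .len) (ones (rs.map fun r => (s r).length).sum)) z) T := by
  induction rs generalizing T with
  | nil =>
    have : update s (wr .len) [] = s := by rw [update_eq_self_iff, hlen]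
    simpa [sumLen, this] using Runs.nop (by omega)
  | cons r rs ih =>
    have hr : IsSource r := hsrc r (by simp)
    simp only [List.map_cons, List.sum_cons, List.length_cons] at hT ⊢
    have h1 := hr.ne (r := Nm.len) (by simp [IsSource])
    have h2 := hr.ne (r := Nm.t) (by simp [IsSource])
    refine .seq (ih (fun r hr => hsrc r (by simp [hr])) le_rfl)
      (runs_addLen (T := 10 * (s r).length + 2) h1 h2 (by simp) (by simpa using ht) ?_ ?_) (by omega)
    · rw [hr.zst, update_of_ne h1]
    · rw [hr.zst, update_of_ne h1, ones_add]
      simp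

/-- Empty the stacks `rs`. -/
def drainAll {ι : Type} : List ι → Prog ι
  | [] => .nop
  | r :: rs => .seq (drainAll rs) (drain r)

/-- The store in which the stacks `rs` are empty. -/
def clearAll {ι : Type} [DecidableEq ι] (rs : List ι) (s : ι → Str) : ι → Str :=
  fun r => if r ∈ rs then [] else s r

theorem runs_drainAll {ι : Type} [DecidableEq ι] {qr : ι} {rs : List ι} {s : ι → Str} {N : ℕ}
    (h : ∀ r ∈ rs, (s r).length ≤ N) (hT : rs.length * (3 * N + 1) + 1 ≤ T) :
    Runs A qr (drainAll rs) s (clearAll rs s) T := by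
  induction rs generalizing T with
  | nil =>
    have : clearAll [] s = s := by funext r; simp [clearAll]
    rw [this]; exact .nop (by omega)
  | cons r rs ih =>
    have h1 : clearAll (r :: rs) s = update (clearAll rs s) r [] := by
      funext r'
      by_cases hr : r' = r <;> simp [clearAll, hr]
    have h2 : (clearAll rs s r).length ≤ N := by
      unfold clearAll
      split_ifs
      · simp
      · exact h r (by simp)
    rw [h1]
    simp only [List.length_cons, add_mul] at hT
    exact .seq (ih (fun r hr => h r (by simp [hr])) le_rfl) (runs_drain r (T := 3 * N + 1) (by omega))
      (by omega)

theorem clearAll_dropAll {ι : Type} [DecidableEq ι] (rs : List ι) (k : ℕ) (s : ι → Str) :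
    clearAll rs (dropAll rs k s) = clearAll rs s := by
  funext r
  by_cases h : r ∈ rs <;> simp [clearAll, dropAll, h]

theorem clearAll_zst (hsrc : ∀ r ∈ rs, IsSource r) (s z) :
    clearAll rs (zst s z) = zst (clearAll rs s) z := by
  funext r
  by_cases hr : r ∈ rs
  · rw [(hsrc r hr).zst]
    simp [clearAll, hr]
  · simp only [clearAll, hr, if_false]
    rcases r with i | r | _
    · simp [zst, clearAll, hr]
    · cases r <;> simp [zst, clearAll, hr]
    · rfl

end OracleSep

/-! ### Deciding `SweepRel` by a program. -/

namespace OracleSep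
open Function
variable {m n : ℕ} {A : Set Str} {s : Reg m (Nm n) → Str} {T : ℕ} {rs : List (Reg m (Nm n))}

/-- All registers for sweeping machines are empty. -/
def ZStore.nil : ZStore := ⟨[], [], [], [], [], [], [], [], [], [], [], [], []⟩

/-- Decide whether `SweepRel` holds of the strings in the registers `rs`. -/
def relProg (tab : List Str) (P : Str) (c : ℕ) (rs : List (Reg m (Nm n))) : Prog (Reg m (Nm n)) :=
  .seq (sumLen rs)
  (.seq (polyUnary (wr .len) (wr .bd) (wr .v) (wr .t) c)
  (.seq (initProg tab rs)
  (.seq (drainAll rs)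
  (.seq (addLen (wr .bd) (wr .clk) (wr .t))
  (.seq (pushAll (wr .p) P)
  (.seq (.push (wr .run) true)
  (.seq clockedProg
  (.seq (drain (wr .p))
  (.seq (drain (wr .st))
  (.seq (drain (wr .w))
  (.seq (drain (wr .run))
  (.seq (drain (wr .bd)) (drain (wr .len))))))))))))))

/-- A bound for the cost of `relProg` for `k` strings of total length `N`. -/
def relCost (K l c k N : ℕ) : ℕ :=
  (10 * N + 2 * k + 1) + (20 * (c * (N + 1) ^ c) + 2 * c + 4) + initCost K k (N ^ c + c) +
  (k * (3 * N + 1) + 1) + (10 * (N ^ c + c) + 2) + (2 * l + 1) + 2 +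
  ((N ^ c + c) * (sweepCost l ((2 * (N ^ c + c) + 1) * K) + 10) + 1) +
  (3 * l + 1) + (3 * l + 1) + (3 * ((2 * (N ^ c + c) + 1) * K) + 1) + 4 + (3 * (N ^ c + c) + 1) +
  (3 * N + 1)

theorem polyBdd_relCost (K l c k : ℕ) : PolyBdd (relCost K l c k) := by
  have h1 : PolyBdd fun N => N ^ c + c := ⟨c, fun _ => le_rfl⟩
  unfold relCost initCost sweepCost
  have id := PolyBdd.id'
  have cc := fun a => PolyBdd.const a
  repeat first
    | exact cc _
    | exact id
    | exact h1
    | refine PolyBdd.add ?_ ?_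
    | refine PolyBdd.mul ?_ ?_
    | refine PolyBdd.pow ?_ _

theorem length_le_sum_map {α : Type} (f : α → ℕ) {l : List α} {a : α} (h : a ∈ l) :
    f a ≤ (l.map f).sum :=
  List.single_le_sum (by simp) _ (List.mem_map_of_mem h)

/-- Apart from the verdict in `res`, all auxiliary registers are left empty and the sources are
consumed. This clean exit permits repeated use inside the loops for quantifiers. -/
theorem runs_relProg (tab : List Str) (P : Str) (c : ℕ) (hrs : rs.Nodup)
    (hsrc : ∀ r ∈ rs, IsSource r) (ht : s (wr .t) = []) (hv : s (wr .v) = [])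
    (hlen : s (wr .len) = []) (hbd : s (wr .bd) = []) :
    Runs A .qry (relProg tab P c rs) (zst s .nil)
      (zst (clearAll rs s) { ZStore.nil with
        res := (verdict A P (clockBound c (rs.map s))
          (0, initWord tab (rs.map s) (clockBound c (rs.map s)))).toList })
      (relCost (maxBlock tab) P.length c rs.length ((rs.map s).map List.length).sum) := by
  set N := ((rs.map s).map List.length).sum with hN
  have hN' : (rs.map fun r => (s r).length).sum = N := by simp [hN, comp_def]
  have hS : clockBound c (rs.map s) = N ^ c + c := rfl
  rw [hS]
  set S := N ^ c + c with hSdef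
  have nvs : wr .v ∉ rs := IsSource.notMem hsrc (by simp [IsSource])
  have nts : wr .t ∉ rs := IsSource.notMem hsrc (by simp [IsSource])
  have nbd : wr .bd ∉ rs := IsSource.notMem hsrc (by simp [IsSource])
  have nlen : wr .len ∉ rs := IsSource.notMem hsrc (by simp [IsSource])
  have e1 := runs_sumLen (A := A) (z := .nil) hsrc ht hlen le_rfl
  rw [hN'] at e1
  set s1 := update s (wr .len) (ones N) with hs1
  have e2 := runs_polyUnary (A := A) (qr := .qry) (n := wr (n := n) (m := m) .len) (u := wr .bd)
    (v := wr .v) (t := wr .t) (s := zst s1 .nil)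
    (by simp) (by simp) (by simp) (by simp) (by simp) (by simp) (by simpa [hs1] using ht)
    (by simpa [hs1] using hv) c (by simpa [hs1] using hbd) le_rfl rfl
  simp only [zst_len, update_zst_bd] at e2
  have hl1 : (s1 (wr .len)).length = N := by simp [hs1]
  rw [hl1, ← hSdef] at e2
  set s2 := update s1 (wr .bd) (ones S) with hs2
  have hmap : rs.map s2 = rs.map s := List.map_congr_left fun r hr => by
    rw [hs2, hs1, update_of_ne ((hsrc r hr).ne (by simp [IsSource])),
      update_of_ne ((hsrc r hr).ne (by simp [IsSource]))]
  have e3 := runs_initProg (A := A) (s := s2) (z := .nil) tab hrs hsrc (S := S) rfl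
    (by simpa [hs2, hs1] using ht) (by simpa [hs2, hs1] using hv) (by simp [hs2]) le_rfl
  rw [hmap] at e3
  set W := initWord tab (rs.map s) S with hW
  have e4 := runs_drainAll (A := A) (qr := .qry) (rs := rs)
    (s := zst (dropAll rs (S + 1) s2) { ZStore.nil with w := W }) (N := N) (fun r hr => by
      rw [(hsrc r hr).zst]
      simp only [dropAll, hr, if_true, List.length_drop]
      have h1 : (s r).length ≤ N := by
        rw [← hN']; exact length_le_sum_map (fun r => (s r).length) hr
      have h2 : s2 r = s r := by
        rw [hs2, hs1, update_of_ne ((hsrc r hr).ne (by simp [IsSource])),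
          update_of_ne ((hsrc r hr).ne (by simp [IsSource]))]
      rw [h2]; omega) le_rfl
  rw [clearAll_zst hsrc, clearAll_dropAll] at e4
  set s3 := clearAll rs s2 with hs3
  have hbd3 : s3 (wr .bd) = ones S := by simp [hs3, clearAll, nbd, hs2]
  have e5 : Runs A .qry (addLen (wr .bd) (wr .clk) (wr .t)) (zst s3 { ZStore.nil with w := W })
      (zst s3 { ZStore.nil with w := W, clk := ones S }) (10 * S + 2) :=
    runs_addLen (by simp) (by simp) (by simp) (by simpa [hs3, clearAll, nts, hs2, hs1] using ht)
      (by simp [hbd3]) (by simp [hbd3, ZStore.nil])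
  have e6 : Runs A .qry (pushAll (wr .p) P) (zst s3 { ZStore.nil with w := W, clk := ones S })
      (zst s3 { ZStore.nil with w := W, clk := ones S, p := P }) (2 * P.length + 1) :=
    runs_pushAll _ _ le_rfl (by simp [ZStore.nil])
  have e7 : Runs A .qry (.push (wr .run) true)
      (zst s3 { ZStore.nil with w := W, clk := ones S, p := P })
      (zst s3 { ZStore.nil with w := W, clk := ones S, p := P, run := [true] }) 2 :=
    .push le_rfl (by simp [ZStore.nil])
  obtain ⟨c', h1, h2, e8⟩ := runs_clockedProg (A := A) (s := s3) (P := P) (c := (0, W)) (N := S)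
    (z := { ZStore.nil with p := P }) rfl rfl rfl rfl rfl (by simp) rfl rfl rfl le_rfl
  have hWl : W.length ≤ (2 * S + 1) * maxBlock tab := length_initWord_le _ _ _
  simp only at h2 e8
  set vd := verdict A P S (0, W)
  have e9 : Runs A .qry (.seq (drain (wr .p)) (.seq (drain (wr .st)) (.seq (drain (wr .w))
      (.seq (drain (wr .run)) (.seq (drain (wr .bd)) (drain (wr .len)))))))
      (zst s3 { ZStore.nil with
        p := P
        w := c'.2
        st := ones c'.1
        run := if vd.isSome then [] else [true]
        res := vd.toList
        clk := [] })
      (zst (update (update s3 (wr .bd) []) (wr .len) []) { ZStore.nil with res := vd.toList })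
      ((3 * P.length + 1) + (3 * P.length + 1) + (3 * ((2 * S + 1) * maxBlock tab) + 1) + 4 +
      (3 * S + 1) + (3 * N + 1)) := by
    have hlen3 : s3 (wr .len) = ones N := by simp [hs3, clearAll, nlen, hs2, hs1]
    refine .seq (T1 := 3 * P.length + 1) (runs_drain _ (by simp))
      (.seq (T1 := 3 * P.length + 1) (runs_drain _ (by simp; omega))
      (.seq (T1 := 3 * ((2 * S + 1) * maxBlock tab) + 1) (runs_drain _ (by simp; omega))
      (.seq (T1 := 4) (runs_drain _ (by simp; split_ifs <;> simp))
      (.seq (T1 := 3 * S + 1) (runs_drain _ (by simp [hbd3])) 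
        (?_ : Runs _ _ _ _ _ (3 * N + 1)) le_rfl) le_rfl) le_rfl) le_rfl) (by omega)
    have := runs_drain (A := A) (qr := .qry) (T := 3 * N + 1) (wr (m := m) (n := n) .len)
      (s := zst (update s3 (wr .bd) []) { ZStore.nil with res := vd.toList })
      (by simp [hlen3])
    simpa [ZStore.nil] using this
  -- The registers `len` and `bd` were empty at the start, so emptying them restores the original
  -- store.
  have hfin : update (update s3 (wr .bd) []) (wr .len) [] = clearAll rs s := by
    funext r
    by_cases hr : r = wr .len
    · subst hr; simp [clearAll, nlen, hlen]
    by_cases hr' : r = wr .bd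
    · subst hr'; simp [clearAll, nbd, hbd]
    simp [hr, hr', hs3, hs2, hs1, clearAll]
  rw [hfin] at e9
  refine .seq e1 (.seq e2 (.seq e3 (.seq e4 (.seq e5 (.seq e6 (.seq e7 (.seq e8 e9 le_rfl) le_rfl)
    le_rfl) le_rfl) le_rfl) le_rfl) le_rfl) ?_
  have hsw : S * (sweepCost P.length W.length + 10) ≤
      S * (sweepCost P.length ((2 * S + 1) * maxBlock tab) + 10) := by
    refine Nat.mul_le_mul_left _ (Nat.add_le_add_right ?_ _)
    exact Nat.mul_le_mul_right _ (by omega)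
  simp only [relCost, ← hSdef]
  omega

/-- One half of the normal form for polynomial-time relations; `exists_sweepRel` is the other. -/
theorem polyTimeRel_sweepRel (A : Set Str) (tab : List Str) (P : Str) (c : ℕ) (m : ℕ) :
    PolyTimeRel A fun xs : Fin m → Str => SweepRel A tab P c (List.ofFn xs) := by
  let rs : List (Reg m (Nm 0)) := List.ofFn fun i => .inp i
  have hsrc : ∀ r ∈ rs, IsSource r := by
    intro r hr
    obtain ⟨i, rfl⟩ := List.mem_ofFn.1 hr
    trivial
  have hnd : rs.Nodup := List.nodup_ofFn.2 fun i j h => by simpa using h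
  refine polyTimeRel_of_exec (relProg tab P c rs) .res
    (f := relCost (maxBlock tab) P.length c m) ((polyBdd_relCost _ _ _ _).add (.const 2))
    fun xs => ?_
  have hs : (inputStore xs : Reg m (Nm 0) → Str) = zst (inputStore xs) .nil := by
    funext r
    rcases r with i | r | _
    · rfl
    · cases r <;> rfl
    · rfl
  obtain ⟨t, ht, h⟩ := runs_relProg (A := A) (s := inputStore xs) tab P c hnd hsrc rfl rfl rfl rfl
  have hmap : rs.map (inputStore xs) = List.ofFn xs := by
    simp only [rs, List.map_ofFn]; rfl
  rw [hmap] at h ht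
  rw [← hs] at h
  refine ⟨_, t, h, ?_, ?_⟩
  · have : ((List.ofFn xs).map List.length).sum = ∑ i, (xs i).length := by
      rw [List.map_ofFn, List.sum_ofFn]; rfl
    rw [this] at ht
    simpa [rs] using ht
  · simp only [zst_res, SweepRel]
    cases verdict A P (clockBound c (List.ofFn xs))
      (0, initWord tab (List.ofFn xs) (clockBound c (List.ofFn xs))) <;> simp

end OracleSep

namespace OracleSep
open Function

/-! ### Enumeration of strings -/

/-- The successor of a string in the order by length and then by the least significant bit first. -/
def nextStr : Str → Str
  | [] => [false]
  | false :: l => true :: l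
  | true :: l => false :: nextStr l

/-- The number of predecessors of a string. -/
def rank : Str → ℕ
  | [] => 0
  | b :: l => 2 * rank l + (b.toNat + 1)

theorem rank_nextStr (l : Str) : rank (nextStr l) = rank l + 1 := by
  induction l with
  | nil => rfl
  | cons b l ih => cases b <;> simp [nextStr, rank, ih]; omega

/-- `rank` evaluates bijective binary numerals with the digits `1` and `2`, the least significant
digit first; such numerals are unique. -/
theorem rank_injective : Injective rank := by
  intro l
  induction l with
  | nil => intro l' h; cases l' <;> simp [rank] at h ⊢
  | cons b l ih =>
    intro l' h
    rcases l' with _ | ⟨b', l'⟩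
    · simp [rank] at h
    · simp only [rank] at h
      have h1 : b.toNat ≤ 1 := Bool.toNat_le b
      have h2 : b'.toNat ≤ 1 := Bool.toNat_le b'
      have h3 : rank l = rank l' := by omega
      have h4 : b.toNat = b'.toNat := by omega
      rw [ih h3]
      congr
      revert h4
      cases b <;> cases b' <;> simp

/-- The ranks of the strings of length `n` lie between `2 ^ n - 1` and `2 ^ (n + 1) - 2`. Hence
`nextStr`, which raises the rank by one, visits all strings of length at most `N` before it exceeds
that length. -/
theorem rank_bounds (l : Str) : 2 ^ l.length ≤ rank l + 1 ∧ rank l + 1 < 2 ^ (l.length + 1) := by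
  induction l with
  | nil => simp [rank]
  | cons b l ih =>
    have h1 : b.toNat ≤ 1 := Bool.toNat_le b
    simp only [rank, List.length_cons, pow_succ] at ih ⊢
    omega

theorem rank_lt_iff (l : Str) (N : ℕ) : rank l + 1 < 2 ^ (N + 1) ↔ l.length ≤ N := by
  obtain ⟨h1, h2⟩ := rank_bounds l
  constructor
  · intro h
    by_contra hl
    have := Nat.pow_le_pow_right (n := 2) (by omega) (by omega : N + 1 ≤ l.length)
    omega
  · intro h
    have := Nat.pow_le_pow_right (n := 2) (by omega) (by omega : l.length + 1 ≤ N + 1)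
    omega

theorem length_le_of_rank_le {l l' : Str} (h : rank l ≤ rank l') : l.length ≤ l'.length := by
  have h1 := (rank_lt_iff l' l'.length).2 le_rfl
  exact (rank_lt_iff l _).1 (by omega)

/-- The two cases of a carry: it runs through all digits and lengthens the string, or it stops at
the first `false`. -/
theorem ones_decomp (l : Str) : ∃ k, l = ones k ∨ ∃ l', l = ones k ++ false :: l' := by
  induction l with
  | nil => exact ⟨0, .inl rfl⟩
  | cons b l ih =>
    cases b
    · exact ⟨0, .inr ⟨l, rfl⟩⟩
    · obtain ⟨k, rfl | ⟨l', rfl⟩⟩ := ih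
      · exact ⟨k + 1, .inl rfl⟩
      · exact ⟨k + 1, .inr ⟨l', rfl⟩⟩

theorem nextStr_ones (k : ℕ) : nextStr (ones k) = List.replicate (k + 1) false := by
  induction k with
  | zero => rfl
  | succ k ih => change false :: nextStr (ones k) = _; rw [ih]; rfl

theorem nextStr_ones_append (k : ℕ) (l : Str) :
    nextStr (ones k ++ false :: l) = List.replicate k false ++ true :: l := by
  induction k with
  | zero => rfl
  | succ k ih => simp only [List.replicate_succ, List.cons_append, nextStr] at ih ⊢; rw [ih]

variable {ι : Type} [DecidableEq ι]

/-- Push as many `false` onto `c` as there are symbols in `t`. -/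
def refill (c t : ι) : Prog ι := .loop t Option.isSome (.seq (.pop t .nop .nop .nop) (.push c false))

/-- Pass from the string in `c` to its successor; `rem` contains as many symbols as the string may still
become longer, and when there is none left, `c` and `go` are emptied. -/
def nextProg (c t rem go : ι) : Prog ι :=
  .seq (.loop c (· == some true) (.seq (.pop c .nop .nop .nop) (.push t true)))
    (.pop c (.pop rem (.seq (drain t) (drain go)) .nop (.seq (.push c false) (refill c t)))
      (.seq (.push c true) (refill c t)) .nop)

variable {A : Set Str} {qr : ι} {s s' : ι → Str} {T : ℕ}

theorem runs_refill {c t : ι} (hct : c ≠ t) {k : ℕ} (ht : s t = ones k) (hT : 5 * k + 1 ≤ T)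
    (hs : s' = update (update s t []) c (List.replicate k false ++ s c)) :
    Runs A qr (refill c t) s s' T := by
  have := Runs.loop_foldl (A := A) (qr := qr) (p := .seq (.pop t .nop .nop .nop) (.push c false))
    (i := t) (T1 := 4) (T := T)
    (fun l (i : ℕ) => update (update s t l) c (List.replicate i false ++ s c)) (fun i _ => i + 1)
    (fun _ _ => True) (fun l i _ => by simp [hct.symm])
    (fun b l i _ => ⟨trivial, .seq (T1 := 2) (T2 := 2) (.pop_cons (b := b) (l := l) (by simp [hct.symm])
      (by rw [Bool.cond_self]; exact .nop le_rfl) le_rfl) (.push le_rfl (by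
        funext j; grind [Function.update_apply])) le_rfl⟩)
    (s t) 0 trivial (by simp [ht]; omega)
  rw [foldl_count] at this
  rw [hs, refill]
  convert this using 1
  · simp
  · simp [ht]

/-- The leading ones are moved to `t`, the carry is placed, and `t` is replaced by as many zeros.
Length is gained only when the carry runs through; then `rem` tells whether another symbol is
allowed, and if not, emptying `go` stops the loop that `go` controls. -/
theorem runs_nextProg {c t rem go : ι} (h1 : c ≠ t) (h2 : c ≠ rem) (h3 : c ≠ go) (h4 : t ≠ rem)
    (h5 : t ≠ go) (ht : s t = []) {l : Str} {N : ℕ} (hc : s c = l) (hl : l.length ≤ N)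
    (hrem : s rem = ones (N - l.length)) (hT : 10 * N + 3 * (s go).length + 20 ≤ T)
    (hs : s' = if (nextStr l).length ≤ N then
        update (update s c (nextStr l)) rem (ones (N - (nextStr l).length))
      else update (update s c []) go []) :
    Runs A qr (nextProg c t rem go) s s' T := by
  have key : ∀ k i l', l'.head? ≠ some true →
      Runs A qr (.loop c (· == some true) (.seq (.pop c .nop .nop .nop) (.push t true)))
      (update (update s c (ones k ++ l')) t (ones i))
      (update (update s c l') t (ones (i + k))) (5 * k + 1) := by
    intro k
    induction k with
    | zero => 
      intro i l' hl'
      exact .loop_done (by simpa [h1] using hl') (by omega)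
    | succ k ih =>
      intro i l' hl'
      have e := ih (i + 1) l' hl'
      rw [add_assoc, add_comm 1 k] at e
      refine .loop_step (by simp [h1, List.replicate_succ]) (T1 := 4) (.seq (T1 := 2) (T2 := 2)
        (.pop_cons (b := true) (l := ones k ++ l') (by simp [h1, List.replicate_succ])
          (.nop le_rfl) le_rfl) (.push le_rfl ?_) le_rfl) e (by omega)
      funext j; grind [Function.update_apply]
  have hs0 : s = update (update s c l) t (ones 0) := by
    funext j; grind [Function.update_apply]
  obtain ⟨k, rfl | ⟨l', rfl⟩⟩ := ones_decomp l
  · have e1 := key k 0 [] (by simp)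
    rw [List.append_nil, ← hs0] at e1
    simp only [List.length_replicate] at hl hrem
    rw [nextStr_ones, List.length_replicate] at hs
    by_cases hk : k + 1 ≤ N
    · rw [if_pos hk] at hs
      obtain ⟨j, rfl⟩ := Nat.exists_eq_add_of_le hk
      refine .seq e1 (T2 := 5 * k + 5) (.pop_nil (by simp [h1]) (T1 := 5 * k + 4)
        (.pop_cons (b := true) (l := ones j) ?_ (T1 := 5 * k + 3) (.seq (T1 := 2) (.push le_rfl rfl)
        (runs_refill h1 (k := k) ?_ le_rfl ?_) (by omega)) le_rfl) le_rfl) (by omega)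
      · have : k + 1 + j - k = j + 1 := by omega
        simp [h2.symm, h4.symm, hrem, this, List.replicate_succ]
      · simp [h1.symm, h4]
      · have : k + 1 + j - (k + 1) = j := by omega
        rw [hs, this, List.replicate_succ']
        funext j; grind [Function.update_apply]
    · rw [if_neg hk] at hs
      have hkN : k = N := by omega
      subst hkN
      refine .seq e1 (T2 := 3 * k + 3 * (s go).length + 5) (.pop_nil (by simp [h1])
        (T1 := 3 * k + 3 * (s go).length + 4) (.pop_nil (by simp [h2.symm, h4.symm, hrem])
        (T1 := 3 * k + 3 * (s go).length + 2)
        (.seq (T1 := 3 * k + 1) (T2 := 3 * (s go).length + 1) (runs_drain _ (by simp))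
          (s1 := _) (s' := s') ?_ (by omega)) (by omega)) (by omega)) (by omega)
      have e2 := runs_drain (A := A) (qr := qr) go (T := 3 * (s go).length + 1)
        (s := update (update (update s c []) t (ones (0 + k))) t [])
        (by simp [h3.symm, h5.symm])
      convert e2 using 1
      rw [hs]
      funext j; grind [Function.update_apply]
  · have e1 := key k 0 (false :: l') (by simp)
    rw [← hs0] at e1
    rw [nextStr_ones_append] at hs
    simp only [List.length_append, List.length_replicate, List.length_cons] at hl hs hrem
    rw [if_pos hl] at hs
    refine .seq e1 (T2 := 5 * k + 4) (.pop_cons (b := false) (l := l') (by simp [h1])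
      (T1 := 5 * k + 3) (.seq (T1 := 2) (.push le_rfl rfl)
        (runs_refill h1 (k := k) ?_ le_rfl ?_) (by omega)) le_rfl) (by omega)
    · simp [h1.symm]
    · rw [hs]
      funext j; grind [Function.update_apply]

end OracleSep

/-! ### Quantifier prefixes over lists, and runs of bounded space. -/

namespace OracleSep
open Function

/-- `l` alternating quantifiers over strings of length at most `M`, in front of a predicate of
lists of strings. -/
def AltList (M : ℕ) (Q : List Str → Prop) : ℕ → Bool → List Str → Prop
  | 0, _, xs => Q xs
  | l + 1, true, xs => ∃ u : Str, u.length ≤ M ∧ AltList M Q l false (xs ++ [u])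
  | l + 1, false, xs => ∀ u : Str, u.length ≤ M → AltList M Q l true (xs ++ [u])

/-- Lists of the values chosen so far replace functions on `Fin l`, so that the matrix keeps one
type throughout the recursion on the prefix. -/
theorem altQuant_iff_altList (M : ℕ) (Q : List Str → Prop) (l : ℕ) (ex : Bool) (pre : List Str) :
    AltQuant M l ex (fun xs => Q (pre ++ List.ofFn xs)) ↔ AltList M Q l ex pre := by
  induction l generalizing ex pre with
  | zero => simp [AltQuant, AltList]
  | succ l ih =>
    have key : ∀ (ex' : Bool) (u : Str),
        AltQuant M l ex' (fun xs => Q (pre ++ List.ofFn (Fin.cons u xs : Fin (l + 1) → Str))) ↔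
        AltList M Q l ex' (pre ++ [u]) := by
      intro ex' u
      rw [← ih]
      simp
    cases ex <;> simp only [AltQuant, AltList, key]

/-- Execution with bounded registers at arbitrary cost. -/
def Ends {ι : Type} [DecidableEq ι] (A : Set Str) (qr : ι) (B : ℕ∞) (p : Prog ι) (s s' : ι → Str) :
    Prop := ∃ t, Exec A qr B p s s' t

namespace Ends

variable {ι : Type} [DecidableEq ι] {A : Set Str} {qr : ι} {B : ℕ∞} {p q r : Prog ι}
  {s s1 s' : ι → Str} {i : ι}

theorem of_runs {T D : ℕ} {B : ℕ} (h : Runs A qr p s s' T) (hs : ∀ i, (s i).length ≤ D)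
    (hB : D + T ≤ B) : Ends A qr B p s s' :=
  let ⟨t, ht, h⟩ := h; ⟨t, h.bounded D hs (by omega)⟩

theorem seq (h1 : Ends A qr B p s s1) (h2 : Ends A qr B q s1 s') : Ends A qr B (.seq p q) s s' :=
  let ⟨_, h1⟩ := h1; let ⟨_, h2⟩ := h2; ⟨_, .seq h1 h2⟩

theorem loop_done {c} (h : c (s i).head? = false) : Ends A qr B (.loop i c p) s s :=
  ⟨1, .loop_done h⟩

theorem loop_step {c} (h : c (s i).head? = true) (h1 : Ends A qr B p s s1)
    (h2 : Ends A qr B (.loop i c p) s1 s') : Ends A qr B (.loop i c p) s s' :=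
  let ⟨_, h1⟩ := h1; let ⟨_, h2⟩ := h2; ⟨_, .loop_step h h1 h2⟩

end Ends

variable {m n : ℕ} {A : Set Str}

section frame

variable (s : Reg m (Nm n) → Str) (z : ZStore) (l : Str)

@[simp] theorem zst_nb : zst s z (.wk .nb) = s (.wk .nb) := rfl
@[simp] theorem zst_rem : zst s z (.wk .rem) = s (.wk .rem) := rfl
@[simp] theorem zst_py : zst s z (.wk .py) = s (.wk .py) := rfl
@[simp] theorem zst_inp (i) : zst s z (.inp i) = s (.inp i) := rfl
@[simp] theorem zst_x (i) : zst s z (.wk (.x i)) = s (.wk (.x i)) := rfl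
@[simp] theorem zst_y (i) : zst s z (.wk (.y i)) = s (.wk (.y i)) := rfl
@[simp] theorem zst_rm (i) : zst s z (.wk (.rm i)) = s (.wk (.rm i)) := rfl
@[simp] theorem zst_go (i) : zst s z (.wk (.go i)) = s (.wk (.go i)) := rfl
@[simp] theorem zst_acc (i) : zst s z (.wk (.acc i)) = s (.wk (.acc i)) := rfl
@[simp] theorem update_zst_nb : update (zst s z) (.wk .nb) l = zst (update s (.wk .nb) l) z :=
  update_zst_outer s z l fun _ _ => rfl
@[simp] theorem update_zst_rem : update (zst s z) (.wk .rem) l = zst (update s (.wk .rem) l) z :=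
  update_zst_outer s z l fun _ _ => rfl
@[simp] theorem update_zst_py : update (zst s z) (.wk .py) l = zst (update s (.wk .py) l) z :=
  update_zst_outer s z l fun _ _ => rfl
@[simp] theorem update_zst_inp (i) : update (zst s z) (.inp i) l = zst (update s (.inp i) l) z :=
  update_zst_outer s z l fun _ _ => rfl
@[simp] theorem update_zst_x (i) :
    update (zst s z) (.wk (.x i)) l = zst (update s (.wk (.x i)) l) z :=
  update_zst_outer s z l fun _ _ => rfl
@[simp] theorem update_zst_y (i) :
    update (zst s z) (.wk (.y i)) l = zst (update s (.wk (.y i)) l) z :=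
  update_zst_outer s z l fun _ _ => rfl
@[simp] theorem update_zst_rm (i) :
    update (zst s z) (.wk (.rm i)) l = zst (update s (.wk (.rm i)) l) z :=
  update_zst_outer s z l fun _ _ => rfl
@[simp] theorem update_zst_go (i) :
    update (zst s z) (.wk (.go i)) l = zst (update s (.wk (.go i)) l) z :=
  update_zst_outer s z l fun _ _ => rfl
@[simp] theorem update_zst_acc (i) :
    update (zst s z) (.wk (.acc i)) l = zst (update s (.wk (.acc i)) l) z :=
  update_zst_outer s z l fun _ _ => rfl

end frame

/-! ### The polynomial hierarchy is contained in polynomial space -/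

/-- Copy the registers `x i` to the registers `y i`, for `i` in a list. -/
def copyXY : List (Fin n) → Prog (Reg m (Nm n))
  | [] => .nop
  | i :: is => .seq (copyXY is) (copy (wr (.x i)) (wr (.y i)) (wr .t))

/-- The store in which the registers `x i` have been copied to `y i`, for `i` in a list. -/
def xyStore (is : List (Fin n)) (s : Reg m (Nm n) → Str) : Reg m (Nm n) → Str
  | .wk (.y i) => if i ∈ is then s (wr (.x i)) else s (wr (.y i))
  | r => s r

/-- The matrix is evaluated on copies, because `relProg` consumes its inputs while the quantifier
loops still need theirs. -/
theorem runs_copyXY {is : List (Fin n)} (his : is.Nodup) {s : Reg m (Nm n) → Str} {D T : ℕ}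
    (ht : s (wr .t) = []) (hy : ∀ i, s (wr (.y i)) = []) (hx : ∀ i, (s (wr (.x i))).length ≤ D)
    (hT : is.length * (10 * D + 2) + 1 ≤ T) :
    Runs A .qry (copyXY is) (zst s .nil) (zst (xyStore is s) .nil) T := by
  induction is generalizing T with
  | nil =>
    have : xyStore [] s = s := by
      funext r
      rcases r with _ | r | _
      · rfl
      · cases r <;> rfl
      · rfl
    rw [this]
    exact .nop (by omega)
  | cons i is ih =>
    rw [List.nodup_cons] at his
    simp only [List.length_cons, add_mul] at hT
    refine .seq (ih his.2 le_rfl) (runs_copy (T := 10 * D + 2) (by simp) (by simp) (by simp) ?_ ?_ ?_)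
      (by omega)
    · simpa [xyStore] using ht
    · have := hx i
      simp [xyStore]
      omega
    · simp only [zst_x, zst_y, update_zst_y]
      congr 1
      funext r
      by_cases hr : r = wr (.y i)
      · subst hr; simp [xyStore, his.1, hy]
      · rw [update_of_ne hr]
        rcases r with _ | r | _
        · rfl
        · cases r <;> try rfl
          simp only [wr, Reg.wk.injEq, Nm.y.injEq] at hr
          simp [xyStore, hr]
        · rfl

/-- Decide a relation given by alternating quantifiers; the quantifiers that remain to be treated are
the elements of the second list, the first of them being existential if `ex = true`. -/
def quantProg (tab : List Str) (P : Str) (c : ℕ) :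
    List (Fin n) → List (Fin n) → Bool → Prog (Reg m (Nm n))
  | ps, [], _ => .seq (copyXY ps) (.seq (relProg tab P c (ps.map fun i => wr (.y i)))
      (.pop (wr .res) (.push (wr .res) false) (.push (wr .res) false) (.push (wr .res) true)))
  | ps, i :: is, ex =>
    .seq (copy (wr .nb) (wr (.rm i)) (wr .t)) (.seq (.push (wr (.go i)) true)
    (.seq (.loop (wr (.go i)) Option.isSome (.seq (quantProg tab P c (ps ++ [i]) is (!ex))
      (.seq (.pop (wr .res) .nop
        (bif ex then .nop else .seq (drain (wr (.acc i))) (.push (wr (.acc i)) true))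
        (bif ex then .seq (drain (wr (.acc i))) (.push (wr (.acc i)) true) else .nop))
      (nextProg (wr (.x i)) (wr .t) (wr (.rm i)) (wr (.go i))))))
    (.pop (wr (.acc i)) (.push (wr .res) (!ex)) (.push (wr .res) ex) (.push (wr .res) ex))))

/-- The condition on the registers that is kept between the steps of `quantProg`. -/
structure QuantOk (s : Reg m (Nm n) → Str) (M D : ℕ) : Prop where
  t : s (wr .t) = []
  v : s (wr .v) = []
  len : s (wr .len) = []
  bd : s (wr .bd) = []
  nb : s (wr .nb) = ones M
  y : ∀ i, s (wr (.y i)) = []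
  le : ∀ r, (s r).length ≤ D

theorem length_zst_le {s : Reg m (Nm n) → Str} {z : ZStore} {D : ℕ} (hs : ∀ r, (s r).length ≤ D)
    (hz : ∀ r, (zst (m := m) (n := n) (fun _ => []) z r).length ≤ D) (r : Reg m (Nm n)) :
    (zst s z r).length ≤ D := by
  rcases r with i | r | _
  · exact hs _
  · have := hz (.wk r)
    cases r <;> first | exact this | exact hs _
  · exact hz .qry

theorem length_zst_nil (r : Reg m (Nm n)) : (zst (fun _ => []) ZStore.nil r).length = 0 := by
  rcases r with i | r | _
  · rfl
  · cases r <;> rfl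
  · rfl

theorem length_zst_res (b : Bool) (r : Reg m (Nm n)) :
    (zst (fun _ => []) { ZStore.nil with res := [b] } r).length ≤ 1 := by
  rcases r with i | r | _
  · exact Nat.zero_le _
  · cases r <;> first | exact Nat.zero_le _ | exact le_rfl
  · exact Nat.zero_le _

theorem relCost_mono (K l c k : ℕ) {N N' : ℕ} (h : N ≤ N') : relCost K l c k N ≤ relCost K l c k N' := by
  have h1 : N ^ c ≤ N' ^ c := Nat.pow_le_pow_left h c
  have h2 : (N + 1) ^ c ≤ (N' + 1) ^ c := Nat.pow_le_pow_left (by omega) c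
  unfold relCost initCost sweepCost
  gcongr

variable {i : Fin n} {s : Reg m (Nm n) → Str} {M D : ℕ}

/-- The store in which the registers for the quantifier number `i` have the given contents. -/
def quantStore (s : Reg m (Nm n) → Str) (i : Fin n) (u r g a : Str) : Reg m (Nm n) → Str
  | .wk (.x j) => if j = i then u else s (wr (.x j))
  | .wk (.rm j) => if j = i then r else s (wr (.rm j))
  | .wk (.go j) => if j = i then g else s (wr (.go j))
  | .wk (.acc j) => if j = i then a else s (wr (.acc j))
  | j => s j

section quantStore

variable (s) (i) (u r g a l : Str)

@[simp] theorem quantStore_x : quantStore s i u r g a (.wk (.x i)) = u := if_pos rfl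
@[simp] theorem quantStore_rm : quantStore s i u r g a (.wk (.rm i)) = r := if_pos rfl
@[simp] theorem quantStore_go : quantStore s i u r g a (.wk (.go i)) = g := if_pos rfl
@[simp] theorem quantStore_acc : quantStore s i u r g a (.wk (.acc i)) = a := if_pos rfl
@[simp] theorem quantStore_t : quantStore s i u r g a (.wk .t) = s (.wk .t) := rfl
@[simp] theorem quantStore_nb : quantStore s i u r g a (.wk .nb) = s (.wk .nb) := rfl

theorem update_quantStore_x :
    update (quantStore s i u r g a) (.wk (.x i)) l = quantStore s i l r g a := by
  funext j
  rcases j with j | j | _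
  · rfl
  · cases j <;> try rfl
    simp only [quantStore, update_apply, wr, Reg.wk.injEq, Nm.x.injEq]
    split_ifs <;> rfl
  · rfl

theorem update_quantStore_rm :
    update (quantStore s i u r g a) (.wk (.rm i)) l = quantStore s i u l g a := by
  funext j
  rcases j with j | j | _
  · rfl
  · cases j <;> try rfl
    simp only [quantStore, update_apply, wr, Reg.wk.injEq, Nm.rm.injEq]
    split_ifs <;> rfl
  · rfl

theorem update_quantStore_go :
    update (quantStore s i u r g a) (.wk (.go i)) l = quantStore s i u r l a := by
  funext j
  rcases j with j | j | _
  · rfl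
  · cases j <;> try rfl
    simp only [quantStore, update_apply, wr, Reg.wk.injEq, Nm.go.injEq]
    split_ifs <;> rfl
  · rfl

theorem update_quantStore_acc :
    update (quantStore s i u r g a) (.wk (.acc i)) l = quantStore s i u r g l := by
  funext j
  rcases j with j | j | _
  · rfl
  · cases j <;> try rfl
    simp only [quantStore, update_apply, wr, Reg.wk.injEq, Nm.acc.injEq]
    split_ifs <;> rfl
  · rfl

variable {s} {i} {u r g a}

theorem quantStore_self (hu : s (wr (.x i)) = u) (hr : s (wr (.rm i)) = r) (hg : s (wr (.go i)) = g)
    (ha : s (wr (.acc i)) = a) : quantStore s i u r g a = s := by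
  funext j
  rcases j with j | j | _
  · rfl
  · cases j <;> try rfl
    all_goals simp only [quantStore]; split_ifs with h <;> simp_all
  · rfl

theorem QuantOk.quantStore (h : QuantOk s M D) (hu : u.length ≤ D) (hr : r.length ≤ D)
    (hg : g.length ≤ D) (ha : a.length ≤ D) : QuantOk (quantStore s i u r g a) M D where
  t := h.t
  v := h.v
  len := h.len
  bd := h.bd
  nb := h.nb
  y := h.y
  le j := by
    rcases j with j | j | _
    · exact h.le _
    · cases j <;> first
        | exact h.le _
        | (simp only [OracleSep.quantStore]; split_ifs <;> first | assumption | exact h.le _)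
    · exact h.le _

end quantStore

-- The matrix of the formula. The absence of a verdict counts as `false`, in accordance with
-- `SweepRel`.
open Classical in
theorem ends_quantProg_nil (tab : List Str) (P : Str) (c : ℕ) {ps : List (Fin n)} {B : ℕ} {ex : Bool}
    (hps : ps.Nodup) (hs : QuantOk s M D)
    (hB : D + (ps.length * (10 * D + 2) + 1 +
      relCost (maxBlock tab) P.length c ps.length (ps.length * D) + 3) ≤ B) :
    Ends A .qry B (quantProg tab P c ps [] ex) (zst s .nil) (zst s { ZStore.nil with
      res := [decide (SweepRel A tab P c (ps.map fun i => s (wr (.x i))))] }) := by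
  have hsrc : ∀ r ∈ ps.map fun i => wr (m := m) (.y i), IsSource r := by
    intro r hr
    obtain ⟨i, -, rfl⟩ := List.mem_map.1 hr
    trivial
  have e1 := runs_copyXY (A := A) hps hs.t hs.y (fun i => hs.le _) le_rfl
  have e2 := runs_relProg (A := A) (s := xyStore ps s) (rs := ps.map fun i => wr (.y i)) tab P c
    (hps.map fun i j h => by simpa using h) hsrc hs.t hs.v hs.len hs.bd
  have h1 : (ps.map fun i => wr (m := m) (.y i)).map (xyStore ps s) = ps.map fun i => s (wr (.x i)) := by
    rw [List.map_map]
    exact List.map_congr_left fun i hi => if_pos hi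
  have h2 : clearAll (ps.map fun i => wr (.y i)) (xyStore ps s) = s := by
    funext r
    rcases r with i | r | _
    · simp [clearAll, xyStore]
    · cases r <;> simp [clearAll, xyStore, hs.y]
      exact fun h h' => absurd h' h
    · simp [clearAll, xyStore]
  rw [h1, h2] at e2
  have h3 : ((ps.map fun i => s (wr (.x i))).map List.length).sum ≤ ps.length * D := by
    rw [List.map_map, ← smul_eq_mul, ← List.length_map (f := List.length ∘ fun i => s (wr (.x i)))]
    exact List.sum_le_card_nsmul _ _ fun a ha => by
      obtain ⟨i, -, rfl⟩ := List.mem_map.1 ha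
      exact hs.le _
  have h4 := relCost_mono (maxBlock tab) P.length c ps.length h3
  refine .of_runs (D := D) (.seq e1 (.seq e2 (T2 := 3) ?_ le_rfl) le_rfl)
    (length_zst_le hs.le fun r => (length_zst_nil r).trans_le (Nat.zero_le _))
    (by simp only [List.length_map]; omega)
  have key : ∀ v : Option Bool, Runs A .qry (.pop (wr .res) (.push (wr .res) false)
      (.push (wr .res) false) (.push (wr .res) true)) (zst s { ZStore.nil with res := v.toList })
      (zst s { ZStore.nil with res := [decide (v = some true)] }) 3 := by
    rintro (_ | b)
    · exact .pop_nil (by simp) (.push le_rfl (by simp)) le_rfl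
    · refine .pop_cons (b := b) (l := []) (by simp) (T1 := 2) ?_ le_rfl
      cases b <;> exact .push le_rfl (by simp)
  convert key _ using 6
  simp only [SweepRel]
  congr!
  exact decide_eq_decide.2 .rfl

-- Depth-first evaluation of the quantifier tree. Time is not bounded; every round returns to a
-- store with registers of length at most `D`, so one bound `B` serves for all depths and all
-- rounds.
open Classical in
theorem ends_quantProg (tab : List Str) (P : Str) (c : ℕ) {ps is : List (Fin n)} {B : ℕ} {ex : Bool}
    (hps : (ps ++ is).Nodup) (hs : QuantOk s M D) (hx : ∀ i ∈ is, s (wr (.x i)) = [])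
    (hrm : ∀ i ∈ is, s (wr (.rm i)) = []) (hgo : ∀ i ∈ is, s (wr (.go i)) = [])
    (hacc : ∀ i ∈ is, s (wr (.acc i)) = []) (hM : M + 1 ≤ D)
    (hB : D + ((ps ++ is).length * (10 * D + 2) + 1 +
      relCost (maxBlock tab) P.length c (ps ++ is).length ((ps ++ is).length * D) + 3) ≤ B)
    (hB' : 20 * D + 50 ≤ B) :
    Ends A .qry B (quantProg tab P c ps is ex) (zst s .nil) (zst s { ZStore.nil with
      res := [decide (AltList M (SweepRel A tab P c) is.length ex
        (ps.map fun i => s (wr (.x i))))] }) := by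
  induction is generalizing ps s ex with
  | nil => 
    rw [List.append_nil] at hps hB
    exact ends_quantProg_nil tab P c hps hs hB
  | cons i is ih =>
    have hassoc : ps ++ i :: is = (ps ++ [i]) ++ is := by simp
    rw [hassoc] at hps hB
    have hips : i ∉ ps := by
      have := (List.nodup_append.1 hps).1
      simp [List.nodup_append] at this
      tauto
    have hiis : i ∉ is := fun h => (List.nodup_append.1 hps).2.2 i (by simp) i h rfl
    set pre := ps.map fun i => s (wr (.x i)) with hpre
    let val : Str → Prop := fun v => AltList M (SweepRel A tab P c) is.length (!ex) (pre ++ [v])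
    have zle : ∀ {u r g a : Str} {z : ZStore}, u.length ≤ D → r.length ≤ D → g.length ≤ D →
        a.length ≤ D → (∀ r, (zst (m := m) (n := n) (fun _ => []) z r).length ≤ D) →
        ∀ j, (zst (quantStore s i u r g a) z j).length ≤ D := fun hu hr hg ha hz =>
      length_zst_le (hs.quantStore hu hr hg ha).le hz
    have znil : ∀ r, (zst (m := m) (n := n) (fun _ => []) .nil r).length ≤ D :=
      fun r => (length_zst_nil r).trans_le (Nat.zero_le _)
    have hb : ∀ b : Bool, (if b then [true] else [] : Str).length ≤ D := by
      intro b; cases b <;> simp; omega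
    -- The candidates are tried from `u` onwards, and `k` bounds the number of those left. `acc`
    -- records whether the value `ex` has occurred: a witness for an existential quantifier, a
    -- counterexample for a universal one.
    have loop : ∀ k u (a : Bool), u.length ≤ M → 2 ^ (M + 1) ≤ rank u + 1 + k →
        Ends A .qry B (.loop (wr (.go i)) Option.isSome (.seq (quantProg tab P c (ps ++ [i]) is (!ex))
      (.seq (.pop (wr .res) .nop
        (bif ex then .nop else .seq (drain (wr (.acc i))) (.push (wr (.acc i)) true))
        (bif ex then .seq (drain (wr (.acc i))) (.push (wr (.acc i)) true) else .nop))
      (nextProg (wr (.x i)) (wr .t) (wr (.rm i)) (wr (.go i))))))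
        (zst (quantStore s i u (ones (M - u.length)) [true] (if a then [true] else [])) .nil)
        (zst (quantStore s i [] [] [] (if a = true ∨ ∃ v, v.length ≤ M ∧ rank u ≤ rank v ∧
          decide (val v) = ex then [true] else [])) .nil) := by
      intro k
      induction k with
      | zero =>
        intro u a hu h
        have := (rank_lt_iff u M).2 hu
        omega
      | succ k ihk =>
        intro u a hu h
        let a' : Bool := a || (decide (val u) == ex)
        have e1 : Ends A .qry B (quantProg tab P c (ps ++ [i]) is (!ex))
            (zst (quantStore s i u (ones (M - u.length)) [true] (if a then [true] else [])) .nil)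
            (zst (quantStore s i u (ones (M - u.length)) [true] (if a then [true] else []))
              { ZStore.nil with res := [decide (val u)] }) := by
          have := ih (ps := ps ++ [i]) (ex := !ex) hps
            (hs.quantStore (i := i) (u := u) (r := ones (M - u.length)) (g := [true])
              (a := if a then [true] else []) (by omega) (by simp; omega)
              (by simp; omega) (hb a))
            (fun j hj => by
              have : j ≠ i := fun h => hiis (h ▸ hj)
              simp only [quantStore, this, if_false]; exact hx j (by simp [hj])) 
            (fun j hj => by
              have : j ≠ i := fun h => hiis (h ▸ hj)
              simp only [quantStore, this, if_false]; exact hrm j (by simp [hj]))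
            (fun j hj => by
              have : j ≠ i := fun h => hiis (h ▸ hj)
              simp only [quantStore, this, if_false]; exact hgo j (by simp [hj]))
            (fun j hj => by
              have : j ≠ i := fun h => hiis (h ▸ hj)
              simp only [quantStore, this, if_false]; exact hacc j (by simp [hj])) hB
          have h2 : (ps ++ [i]).map (fun j => quantStore s i u (ones (M - u.length)) [true]
              (if a then [true] else []) (wr (.x j))) = pre ++ [u] := by
            rw [List.map_append, hpre]
            congr 1
            · refine List.map_congr_left fun j hj => if_neg fun h : j = i => hips (h ▸ hj)
            · simp
          rw [h2] at this
          exact this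
        have e2 : Ends A .qry B (.pop (wr .res) .nop
            (bif ex then .nop else .seq (drain (wr (.acc i))) (.push (wr (.acc i)) true))
            (bif ex then .seq (drain (wr (.acc i))) (.push (wr (.acc i)) true) else .nop))
            (zst (quantStore s i u (ones (M - u.length)) [true] (if a then [true] else []))
              { ZStore.nil with res := [decide (val u)] })
            (zst (quantStore s i u (ones (M - u.length)) [true] (if a' then [true] else [])) .nil) := by
          refine .of_runs (D := D) (T := 10) (.pop_cons (b := decide (val u)) (l := []) (by simp)
            (T1 := 9) ?_ (by omega)) (zle (by omega) (by simp; omega) (by simp; omega) (hb a)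
            fun r => (length_zst_res _ r).trans (by omega)) (by omega)
          have hdp : ∀ b : Bool, Runs A .qry
              (.seq (drain (wr (.acc i))) (.push (wr (.acc i)) true))
              (zst (quantStore s i u (ones (M - u.length)) [true] (if b then [true] else [])) .nil)
              (zst (quantStore s i u (ones (M - u.length)) [true] [true]) .nil) 9 := fun b =>
            .seq (T1 := 7) (T2 := 2) (runs_drain _ (by cases b <;> simp)) (.push le_rfl (by
              simp [update_quantStore_acc])) le_rfl
          have hz : update (zst (quantStore s i u (ones (M - u.length)) [true]
              (if a then [true] else [])) { ZStore.nil with res := [decide (val u)] }) (wr .res) [] =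
              zst (quantStore s i u (ones (M - u.length)) [true] (if a then [true] else [])) .nil := by
            simp [ZStore.nil]
          rw [hz]
          by_cases hv : val u
          · cases ex
            · simpa [hv, a'] using Runs.nop (by omega)
            · simpa [hv, a'] using hdp a
          · cases ex
            · simpa [hv, a'] using hdp a
            · simpa [hv, a'] using Runs.nop (by omega)
        have e3 := fun s' => runs_nextProg (A := A) (qr := .qry) (c := wr (m := m) (.x i)) (t := wr .t)
          (rem := wr (.rm i)) (go := wr (.go i)) (s' := s')
          (s := zst (quantStore s i u (ones (M - u.length)) [true] (if a' then [true] else [])) .nil)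
          (T := 10 * M + 30)
          (by simp) (by simp) (by simp) (by simp) (by simp) (by simpa using hs.t) (l := u)
          (N := M) (by simp) hu (by simp) (by simp)
        -- The candidates from `u` onwards are `u` itself, recorded in `a'`, and those from its
        -- successor onwards; `rank_injective` identifies a candidate of the same rank with `u`.
        have hor : (a' = true ∨ ∃ v, v.length ≤ M ∧ rank (nextStr u) ≤ rank v ∧
            decide (val v) = ex) ↔ (a = true ∨ ∃ v, v.length ≤ M ∧ rank u ≤ rank v ∧
            decide (val v) = ex) := by
          rw [rank_nextStr]
          constructor
          · rintro (h | ⟨v, h1, h2, h3⟩)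
            · simp only [a', Bool.or_eq_true, beq_iff_eq] at h
              rcases h with h | h
              · exact .inl h
              · exact .inr ⟨u, hu, le_rfl, h⟩
            · exact .inr ⟨v, h1, by omega, h3⟩
          · rintro (h | ⟨v, h1, h2, h3⟩)
            · simp [a', h]
            · rcases h2.eq_or_lt with h2 | h2
              · rw [← rank_injective h2] at h3
                simp [a', h3]
              · exact .inr ⟨v, h1, by omega, h3⟩
        have e3' : ∀ {s'}, _ → Ends A .qry B (nextProg (wr (.x i)) (wr .t) (wr (.rm i)) (wr (.go i)))
            (zst (quantStore s i u (ones (M - u.length)) [true] (if a' then [true] else [])) .nil) s' :=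
          fun h => .of_runs (e3 _ h) (zle (by omega) (by simp; omega) (by simp; omega) (hb a') znil)
            (by omega)
        refine .loop_step (by simp) (.seq e1 (.seq e2 (e3' rfl))) ?_
        by_cases h4 : (nextStr u).length ≤ M
        · have := ihk (nextStr u) a' h4 (by rw [rank_nextStr]; omega)
          rw [if_congr hor rfl rfl] at this
          rw [if_pos h4]
          simpa only [update_zst_x, update_zst_rm, update_quantStore_x, update_quantStore_rm] using this
        -- If `u` were shorter than `M`, its successor would still have length at most `M`.
        · have h6 : M - u.length = 0 := by
            by_contra h6
            have h8 := rank_bounds u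
            have h7 : 2 ^ (u.length + 2) ≤ 2 ^ (M + 1) := Nat.pow_le_pow_right (by omega) (by omega)
            refine h4 ((rank_lt_iff _ _).1 ?_)
            rw [rank_nextStr]
            have : 2 ^ (u.length + 2) = 2 * 2 ^ (u.length + 1) := by ring
            have : 2 ≤ 2 ^ (u.length + 1) := by
              rw [pow_succ]; have := Nat.one_le_two_pow (n := u.length); omega
            omega
          have h9 : a' = true ↔ (a = true ∨ ∃ v, v.length ≤ M ∧ rank u ≤ rank v ∧
            decide (val v) = ex) := by
            rw [← hor]
            refine ⟨.inl, fun h => h.resolve_right ?_⟩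
            rintro ⟨v, h1, h2, -⟩
            exact h4 ((length_le_of_rank_le h2).trans h1)
          rw [if_neg h4, ← if_congr h9 rfl rfl, h6]
          simp only [update_zst_x, update_zst_go, update_quantStore_x, update_quantStore_go]
          exact .loop_done (by simp)
    have hi0 := hx i (by simp)
    have hi1 := hrm i (by simp)
    have hi2 := hgo i (by simp)
    have hi3 := hacc i (by simp)
    have hMD : M ≤ D := by omega
    have hs0 : quantStore s i [] [] [] [] = s := quantStore_self hi0 hi1 hi2 hi3
    have e1 : Ends A .qry B (copy (wr .nb) (wr (.rm i)) (wr .t)) (zst s .nil)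
        (zst (quantStore s i [] (ones M) [] []) .nil) := by
      refine .of_runs (D := D) (runs_copy (T := 10 * M + 2) (by simp) (by simp) (by simp)
        (by simpa using hs.t) (by simp [hs.nb]) ?_) (length_zst_le hs.le znil) (by omega)
      have := update_quantStore_rm i s [] [] [] [] (ones M)
      rw [hs0] at this
      simp [this, hs.nb, hi1]
    have e2 : Ends A .qry B (.push (wr (.go i)) true) (zst (quantStore s i [] (ones M) [] []) .nil)
        (zst (quantStore s i [] (ones M) [true] []) .nil) :=
      .of_runs (D := D) (.push le_rfl (by simp [update_quantStore_go]))
        (zle (by simp) (by simpa using hMD) (by simp) (by simp) znil) (by omega)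
    have e3 := loop (2 ^ (M + 1)) [] false (by simp) (by omega)
    have hfin : (false = true ∨ ∃ v, v.length ≤ M ∧ rank [] ≤ rank v ∧ decide (val v) = ex) ↔
        ∃ v, v.length ≤ M ∧ decide (val v) = ex := by simp [rank]
    rw [if_congr hfin rfl rfl] at e3
    refine .seq e1 (.seq e2 (.seq e3 ?_))
    -- The quantifier has the value `ex` exactly if some instance has the value `ex`.
    have hres : decide (AltList M (SweepRel A tab P c) (i :: is).length ex pre) =
        if ∃ v, v.length ≤ M ∧ decide (val v) = ex then ex else !ex := by
      simp only [val]
      cases ex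
      · by_cases h : ∃ v, v.length ≤ M ∧ decide
          (AltList M (SweepRel A tab P c) is.length (!false) (pre ++ [v])) = false
        · rw [if_pos h, decide_eq_false_iff_not]
          obtain ⟨v, h1, h2⟩ := h
          exact fun h3 => (decide_eq_false_iff_not.1 h2) (h3 v h1)
        · rw [if_neg h]
          refine decide_eq_true fun v h1 => ?_
          by_contra h2
          exact h ⟨v, h1, decide_eq_false h2⟩
      · by_cases h : ∃ v, v.length ≤ M ∧ decide
          (AltList M (SweepRel A tab P c) is.length (!true) (pre ++ [v])) = true
        · rw [if_pos h]
          obtain ⟨v, h1, h2⟩ := h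
          exact decide_eq_true ⟨v, h1, of_decide_eq_true h2⟩
        · rw [if_neg h]
          refine decide_eq_false ?_
          rintro ⟨v, h1, h2⟩
          exact h ⟨v, h1, decide_eq_true h2⟩
    rw [hres]
    refine .of_runs (D := D) (T := 3) ?_ (zle (by simp) (by simp) (by simp)
      (by split_ifs <;> simp; omega) znil) (by omega)
    split_ifs with h
    · refine .pop_cons (b := true) (l := []) (by simp) (T1 := 2) (.push le_rfl ?_) le_rfl
      simp [update_quantStore_acc, hs0, ZStore.nil]
    · refine .pop_nil (by simp) (T1 := 2) (.push le_rfl ?_) le_rfl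
      simp [hs0, ZStore.nil]

end OracleSep

namespace OracleSep
open Function
variable {A : Set Str}

/-- The string `y` is stored as the value number `0`, and the quantifiers use the numbers `1, …, l`.
Before the evaluation, the bound `|y| ^ k + k` is written to `nb` in unary. -/
theorem mem_pspace_of_altList (A : Set Str) (tab : List Str) (P : Str) (c l k : ℕ) :
    {y | AltList (y.length ^ k + k) (SweepRel A tab P c) l true [y]} ∈ PSPACE A := by
  classical
  let is : List (Fin (l + 1)) := (List.finRange l).map Fin.succ
  have his : is.length = l := by simp [is]
  have hnd : ([0] ++ is).Nodup := by
    simp only [List.singleton_append, List.nodup_cons, is]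
    exact ⟨by simp, (List.nodup_finRange l).map (Fin.succ_injective l)⟩
  -- `D` bounds the registers between rounds, `E` the space for an evaluation of the matrix, and
  -- `pre` the space for the preparation.
  let D : ℕ → ℕ := fun N => N + (N ^ k + k) + 1
  let E : ℕ → ℕ := fun N => D N + ((l + 1) * (10 * D N + 2) + 1 +
    relCost (maxBlock tab) P.length c (l + 1) ((l + 1) * D N) + 3)
  let pre : ℕ → ℕ := fun N => (10 * N + 2) + (10 * N + 2) + (20 * (k * (N + 1) ^ k) + 2 * k + 4) +
    (3 * N + 1) + N
  have hD : PolyBdd D := (PolyBdd.id'.add ⟨k, fun _ => le_rfl⟩).add (.const 1)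
  have hpre : PolyBdd pre := by
    have id := PolyBdd.id'
    have cc := fun a => PolyBdd.const a
    repeat first
      | exact cc _
      | exact id
      | refine PolyBdd.add ?_ ?_
      | refine PolyBdd.mul ?_ ?_
      | refine PolyBdd.pow ?_ _
  have hE : PolyBdd E :=
    hD.add ((((PolyBdd.const (l + 1)).mul (((PolyBdd.const 10).mul hD).add (.const 2))).add
      (.const 1)).add ((polyBdd_relCost _ _ _ _).comp ((PolyBdd.const (l + 1)).mul hD)) |>.add
      (.const 3))
  refine mem_pspace_of_exec (κ := Nm (l + 1))
    (.seq (.seq (copy (.inp 0) (wr (.x 0)) (wr .t)) (.seq (addLen (.inp 0) (wr .len) (wr .t))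
      (.seq (polyUnary (wr .len) (wr .nb) (wr .v) (wr .t) k) (drain (wr .len)))))
      (quantProg tab P c [0] is true)) .res
    (f := fun N => pre N + E N + (20 * D N + 50))
    ((hpre.add hE).add (((PolyBdd.const 20).mul hD).add (.const 50))) fun y => ?_
  set N := y.length with hN
  set M := N ^ k + k with hM
  have hDN : D N = N + M + 1 := rfl
  have hEN : E N = D N + ((l + 1) * (10 * D N + 2) + 1 +
    relCost (maxBlock tab) P.length c (l + 1) ((l + 1) * D N) + 3) := rfl
  have hpN : pre N = (10 * N + 2) + (10 * N + 2) + (20 * (k * (N + 1) ^ k) + 2 * k + 4) +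
    (3 * N + 1) + N := rfl
  refine ⟨by omega, by omega, ?_⟩
  set s0 : Reg 1 (Nm (l + 1)) → Str := inputStore fun _ => y with hs0
  have hs : s0 = zst s0 .nil := by
    funext r
    rcases r with i | r | _
    · rfl
    · cases r <;> rfl
    · rfl
  have h0i : s0 (.inp 0) = y := rfl
  have h0w : ∀ j, s0 (.wk j) = [] := fun _ => rfl
  let s1 := update s0 (wr (.x 0)) y
  let s2 := update s1 (wr .nb) (ones M)
  have e1 : Runs A .qry (copy (.inp 0) (wr (.x 0)) (wr .t)) (zst s0 .nil) (zst s1 .nil) (10 * N + 2) :=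
    runs_copy (by simp) (by simp) (by simp) (by simp [h0w]) (by simp [h0i, hN])
      (by simp [s1, h0i, h0w])
  have e2 : Runs A .qry (addLen (.inp 0) (wr .len) (wr .t)) (zst s1 .nil)
      (zst (update s1 (wr .len) (ones N)) .nil) (10 * N + 2) :=
    runs_addLen (by simp) (by simp) (by simp) (by simp [s1, h0w]) (by simp [s1, h0i, hN])
      (by simp [s1, h0w, h0i, hN])
  have e3 := runs_polyUnary (A := A) (qr := .qry) (n := wr (m := 1) (n := l + 1) .len) (u := wr .nb)
    (v := wr .v) (t := wr .t) (s := zst (update s1 (wr .len) (ones N)) .nil)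
    (by simp) (by simp) (by simp) (by simp) (by simp) (by simp) (by simp [s1, h0w])
    (by simp [s1, h0w]) k (by simp [s1, h0w]) le_rfl rfl
  simp only [zst_len, update_self, update_zst_nb, List.length_replicate, ← hM] at e3
  have e4 := runs_drain (A := A) (qr := .qry) (T := 3 * N + 1) (wr (m := 1) (n := l + 1) .len)
    (s := zst (update (update s1 (wr .len) (ones N)) (wr .nb) (ones M)) .nil) (by simp)
  have hs2 : update (zst (update (update s1 (wr .len) (ones N)) (wr .nb) (ones M)) .nil) (wr .len) [] =
      zst s2 .nil := by
    rw [update_zst_len]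
    congr 1
    funext j
    simp only [s2, s1]
    have := h0w .len
    grind [Function.update_apply]
  rw [hs2] at e4
  have hok : QuantOk s2 M (D N) := by
    refine ⟨by simp [s2, s1, h0w], by simp [s2, s1, h0w], by simp [s2, s1, h0w],
      by simp [s2, s1, h0w], by simp [s2], fun i => by simp [s2, s1, h0w], fun r => ?_⟩
    simp only [s2, s1, update_apply]
    split_ifs
    · simp; omega
    · omega
    · rcases r with i | r | _
      · exact (by omega : N ≤ D N)
      · exact Nat.zero_le _
      · exact Nat.zero_le _
  have hlen : ([0] ++ is).length = l + 1 := by simp [his]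
  have e5 := ends_quantProg (A := A) tab P c (B := pre N + E N + (20 * D N + 50)) (ex := true) hnd hok
    (fun i hi => by
      obtain ⟨j, -, rfl⟩ := List.mem_map.1 hi
      simp [s2, s1, h0w])
    (fun i hi => by simp [s2, s1, h0w]) (fun i hi => by simp [s2, s1, h0w])
    (fun i hi => by simp [s2, s1, h0w]) (by omega)
    (by rw [hlen, hEN]; omega) (by omega)
  have e6 : Ends A .qry (pre N + E N + (20 * D N + 50) : ℕ) _ (zst s0 .nil) (zst s2 .nil) :=
    .of_runs (D := N) (.seq e1 (.seq e2 (.seq e3 e4 le_rfl) le_rfl) le_rfl)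
      (fun r => by
        rw [← hs]
        rcases r with i | r | _
        · exact le_rfl
        · exact Nat.zero_le _
        · exact Nat.zero_le _)
      (by omega)
  obtain ⟨t, h⟩ := e6.seq e5
  rw [← hs] at h
  refine ⟨_, t, h, ?_⟩
  simp [his, s2, s1]
  rfl

end OracleSep

namespace OracleSep
open Function
variable {A : Set Str} {m n : ℕ}

/-! ### A complete language for polynomial space -/

/-- Read a string as a sequence of pairs of symbols; the first symbol of a pair tells onto which of two
stacks the second symbol is pushed. -/
def parse : Str → Str × Str → Str × Str
  | f :: b :: l, a => parse l (bif f then (b :: a.1, a.2) else (a.1, b :: a.2))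
  | _, a => a

/-- The string that `parse` splits into `p` and `w`. -/
def pad (p w : Str) : Str :=
  p.reverse.flatMap (fun b => [true, b]) ++ w.reverse.flatMap fun b => [false, b]

/-- `parse` pushes, which reverses the order; this is why `pad` reverses both strings. -/
theorem parse_pad (p w : Str) : parse (pad p w) ([], []) = (p, w) := by
  have h1 : ∀ (p : Str) (l : Str) (a : Str × Str),
      parse (p.flatMap (fun b => [true, b]) ++ l) a = parse l (p.reverse ++ a.1, a.2) := by
    intro p
    induction p with
    | nil => intro l a; rfl
    | cons b p ih => intro l a; simp [parse, ih]
  have h2 : ∀ (w : Str) (a : Str × Str),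
      parse (w.flatMap fun b => [false, b]) a = (a.1, w.reverse ++ a.2) := by
    intro w
    induction w with
    | nil => intro a; rfl
    | cons b w ih => intro a; simp [parse, ih]
  rw [pad, h1, h2]
  simp

theorem length_parse_le (y : Str) (a : Str × Str) :
    (parse y a).1.length ≤ y.length + a.1.length ∧ (parse y a).2.length ≤ y.length + a.2.length := by
  fun_induction parse y a with
  | case1 f b l a ih => 
    cases f <;> simp at ih ⊢ <;> omega
  | case2 => omega

/-- The language of the strings for which the sweeping machine that they describe accepts the word that
they describe within an exponential number of sweeps. -/
def univ (A : Set Str) : Set Str :=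
  {y | verdict A (parse y ([], [])).1
    (2 ^ ((parse y ([], [])).1.length + (parse y ([], [])).2.length + 1) - 1)
    (0, (parse y ([], [])).2) = some true}

/-- Split the string in `r`. -/
def parseProg (r : Reg m (Nm n)) : Prog (Reg m (Nm n)) :=
  .loop r Option.isSome (.pop r .nop
    (.pop r .nop (.push (wr .w) false) (.push (wr .w) true))
    (.pop r .nop (.push (wr .p) false) (.push (wr .p) true)))

theorem runs_parseProg {s : Reg m (Nm n) → Str} {T : ℕ} (i : Fin m) (z : ZStore) (y : Str)
    (hy : s (.inp i) = y) (hT : 5 * y.length + 1 ≤ T) :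
    Runs A .qry (parseProg (.inp i)) (zst s z) (zst (update s (.inp i) [])
      { z with p := (parse y (z.p, z.w)).1, w := (parse y (z.p, z.w)).2 }) T := by
  obtain ⟨zp, zp', zs, zo1, zo2, zo3, zw, zout, zrev, zrun, zres, zclk, zq⟩ := z
  simp only
  have hs : s = update s (.inp i) y := by rw [← hy, update_eq_self]
  rw [hs, update_idem]
  clear hy hs
  generalize ha : (zp, zw) = a
  obtain ⟨rfl, rfl⟩ : zp = a.1 ∧ zw = a.2 := by rw [← ha]; exact ⟨rfl, rfl⟩
  clear ha
  fun_induction parse y a generalizing T with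
  | case1 f b l a ih =>
    simp only [List.length_cons] at hT
    refine .loop_step (by simp) (T1 := 5) (T2 := 5 * l.length + 1) ?_ (ih le_rfl) (by omega)
    refine .pop_cons (b := f) (l := b :: l) (by simp) (T1 := 4) ?_ (by omega)
    cases f <;> refine .pop_cons (b := b) (l := l) (by simp) (T1 := 2) ?_ (by omega) <;>
      cases b <;> exact .push le_rfl (by simp)
  | case2 l a h =>
    rcases l with _ | ⟨f, _ | ⟨b, l⟩⟩
    · exact .loop_done (by simp) (by omega)
    · simp only [List.length_cons, List.length_nil] at hT
      refine .loop_step (by simp) (T1 := 3) (T2 := 1) ?_ (.loop_done (by simp) (by omega)) (by omega)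
      refine .pop_cons (b := f) (l := []) (by simp) (T1 := 2) ?_ (by omega)
      cases f <;> exact .pop_nil (by simp) (T1 := 1) (by simpa using Runs.nop le_rfl) (by omega)
    · exact (h f b l rfl).elim

/-- The clock `clk` runs through all strings of length at most `N` and so counts `2 ^ (N + 1) - 1`
sweeps in linear space. The loop is left when `run` is emptied, either by a verdict or by the
overflow of the clock. -/
theorem ends_sweeps {s : Reg m (Nm n) → Str} {P : Str} {N D B : ℕ} (ht : s (wr .t) = [])
    (hD : ∀ r, (s r).length ≤ D) (hP : P.length ≤ D) (hN : N ≤ D) (h1 : 1 ≤ D)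
    (hB : D + (sweepCost P.length N + 10 * N + 30) ≤ B) (k : ℕ) (c : ℕ × Str) (hc : c.1 ≤ P.length)
    (hw : c.2.length ≤ N) (u : Str) (hu : u.length ≤ N) (hk : rank u + 1 + k = 2 ^ (N + 1)) : ∃ s',
    Ends A .qry B (.loop (wr .run) Option.isSome (.seq sweepProg
      (nextProg (wr .clk) (wr .t) (wr .rem) (wr .run))))
      (zst (update s (wr .rem) (ones (N - u.length))) { ZStore.nil with
        p := P
        clk := u
        run := [true]
        w := c.2
        st := ones c.1 }) s' ∧ s' (wr .res) = (verdict A P k c).toList := by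
  induction k generalizing c u with
  | zero => have := (rank_lt_iff u N).2 hu; omega
  | succ k ih =>
    have e1 := runs_sweepProg (A := A) (s := update s (wr .rem) (ones (N - u.length)))
      (z := { ZStore.nil with p := P, clk := u, run := [true] }) (P := P) (c := c)
      rfl rfl rfl rfl rfl hc rfl rfl rfl rfl rfl le_rfl
    simp only at e1
    replace e1 := e1.mono (show _ ≤ sweepCost P.length N from
      Nat.mul_le_mul_right _ (Nat.succ_le_succ hw))
    set c' := sweep A P c with hc'
    have e2 := fun s' => runs_nextProg (A := A) (qr := .qry) (c := wr (m := m) (n := n) .clk)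
      (t := wr .t) (rem := wr .rem) (go := wr .run) (s' := s')
      (s := zst (update s (wr .rem) (ones (N - u.length))) { ZStore.nil with
        p := P
        clk := u
        run := if c'.1.isSome then [] else [true]
        res := c'.1.toList
        w := c'.2.2
        st := ones c'.2.1 }) (T := 10 * N + 30)
      (by simp) (by simp) (by simp) (by simp) (by simp) (by simpa using ht)
      (l := u) (N := N) (by simp) hu (by simp) (by simp; split_ifs <;> simp)
    have e3 : ∀ {s'}, _ → Ends A .qry B (.seq sweepProg _) _ s' := fun {s'} h =>
      .of_runs (D := D) (.seq e1 (e2 s' h) le_rfl) (fun r => by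
        rcases r with i | r | _
        · exact hD _
        · have h2 := hD (wr r)
          cases r <;> simp [ZStore.nil] <;> first | exact h2 | omega
        · exact Nat.zero_le _) (by omega)
    have hv : verdict A P (k + 1) c = c'.1.or (verdict A P k c'.2) := rfl
    rcases h5 : c'.1 with _ | b
    · by_cases h4 : (nextStr u).length ≤ N
      · obtain ⟨s', e4, e5⟩ := ih c'.2 (sweep_fst_le _ _) ((sweep_length _ _).trans_le hw) (nextStr u) h4
          (by rw [rank_nextStr]; omega)
        refine ⟨s', .loop_step (by simp) (e3 rfl) ?_, ?_⟩
        · rw [if_pos h4]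
          simpa [h5, ZStore.nil] using e4
        · rw [e5, hv, h5]; rfl
      -- The clock overflows precisely when the `k` sweeps have been used up.
      · have hk0 : k = 0 := by
          by_contra hk0
          exact h4 ((rank_lt_iff _ _).1 (by rw [rank_nextStr]; omega))
        subst hk0
        refine ⟨_, .loop_step (by simp) (e3 rfl) (.loop_done ?_), ?_⟩
        · rw [if_neg h4]; simp
        · rw [if_neg h4]; simp [h5, verdict, ← hc']
    · refine ⟨_, .loop_step (by simp) (e3 rfl) (.loop_done ?_), ?_⟩
      · split_ifs <;> simp_all
      · split_ifs <;> simp [h5, hv]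

theorem univ_mem_pspace (A : Set Str) : univ A ∈ PSPACE A := by
  -- `parse` yields two strings that are each at most as long as `y`, so table and word have total
  -- length at most `2 N`.
  let f : ℕ → ℕ := fun N => (2 * N + 1) + (sweepCost (2 * N) (2 * N) + 20 * N + 30) + 30 * N + 10
  have hf : PolyBdd f := by
    have id := PolyBdd.id'
    have cc := fun a => PolyBdd.const a
    simp only [f, sweepCost, entryCost]
    repeat first
      | exact cc _
      | exact id
      | refine PolyBdd.add ?_ ?_
      | refine PolyBdd.mul ?_ ?_
  refine mem_pspace_of_exec (κ := Nm 0)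
    (.seq (.seq (parseProg (.inp 0)) (.seq (addLen (wr .w) (wr .rem) (wr .t))
      (.seq (addLen (wr .p) (wr .rem) (wr .t)) (.push (wr .run) true))))
      (.loop (wr .run) Option.isSome (.seq sweepProg
        (nextProg (wr .clk) (wr .t) (wr .rem) (wr .run))))) .res (f := f) hf fun y => ?_
  have hfy : f y.length = (2 * y.length + 1) +
    (sweepCost (2 * y.length) (2 * y.length) + 20 * y.length + 30) + 30 * y.length + 10 := rfl
  refine ⟨by omega, by omega, ?_⟩
  set s0 : Reg 1 (Nm 0) → Str := inputStore fun _ => y with hs0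
  have hs : s0 = zst s0 .nil := by
    funext r
    rcases r with i | r | _
    · rfl
    · cases r <;> rfl
    · rfl
  have h0w : ∀ j, s0 (.wk j) = [] := fun _ => rfl
  obtain ⟨h1, h2⟩ := length_parse_le y ([], [])
  simp only [List.length_nil, add_zero] at h1 h2
  have e1 := runs_parseProg (A := A) (s := s0) 0 .nil y rfl le_rfl
  set s1 := update s0 (.inp 0) [] with hs1
  have h1w : ∀ j, s1 (.wk j) = [] := fun j => by simp [hs1, h0w]
  have hn : (ZStore.nil.p, ZStore.nil.w) = (([], []) : Str × Str) := rfl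
  rw [hn] at e1
  set a := parse y ([], []) with ha
  have e2 := runs_addLen (A := A) (qr := .qry) (r := wr (m := 1) (n := 0) .w) (u := wr .rem) (t := wr .t)
    (s := zst s1 { ZStore.nil with p := a.1, w := a.2 }) (by simp) (by simp) (by simp)
    (by simp [h1w]) (T := 10 * y.length + 2) (by simp; omega) rfl
  simp only [zst_w, zst_rem, h1w, List.append_nil, update_zst_rem] at e2
  set N := a.1.length + a.2.length with hN
  have e3 : Runs A .qry (addLen (wr .p) (wr .rem) (wr .t)) _
      (zst (update s1 (wr .rem) (ones N)) { ZStore.nil with p := a.1, w := a.2 }) (10 * y.length + 2) :=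
    runs_addLen (s := zst (update s1 (wr .rem) (ones a.2.length)) { ZStore.nil with p := a.1, w := a.2 })
      (by simp) (by simp) (by simp) (by simp [h1w]) (by simp; omega) (by
        simp only [update_zst_rem, update_idem, zst_p, zst_rem, update_self, hN, ones_add])
  have e3' : Runs A .qry (.push (wr .run) true)
      (zst (update s1 (wr .rem) (ones N)) { ZStore.nil with p := a.1, w := a.2 }) (zst (update s1 (wr .rem)
      (ones (N - ([] : Str).length))) { ZStore.nil with
        p := a.1
        clk := []
        run := [true]
        w := a.2
        st := ones 0 }) 2 := .push le_rfl (by simp [ZStore.nil])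
  have hs1l : ∀ r, (s1 r).length ≤ 2 * y.length + 1 := fun r => by
    rcases r with i | r | _
    · obtain rfl : i = 0 := Subsingleton.elim _ _
      simp [hs1]
    · exact Nat.zero_le _
    · exact Nat.zero_le _
  have hmono : sweepCost a.1.length N ≤ sweepCost (2 * y.length) (2 * y.length) := by
    unfold sweepCost entryCost
    gcongr <;> omega
  obtain ⟨s', e4, e5⟩ := ends_sweeps (A := A) (B := f y.length) (D := 2 * y.length + 1) (P := a.1)
    (N := N) (h1w _) hs1l (by omega) (by omega) (by omega) (by omega)
    (2 ^ (N + 1) - 1) (0, a.2) (Nat.zero_le _) (by simp [hN]) [] (Nat.zero_le _) (by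
      have := Nat.one_le_two_pow (n := N + 1)
      simp only [rank]; omega)
  have e6 : Ends A .qry (f y.length : ℕ) _ (zst s0 .nil) _ :=
    .of_runs (D := y.length) (.seq e1 (.seq e2 (.seq e3 e3' le_rfl) le_rfl) le_rfl)
      (fun r => by
        rw [← hs]
        rcases r with i | r | _
        · exact le_rfl
        · exact Nat.zero_le _
        · exact Nat.zero_le _) (by omega)
  obtain ⟨t, h⟩ := e6.seq e4
  rw [← hs] at h
  refine ⟨_, t, h, ?_⟩
  rw [e5]
  simp only [univ, Set.mem_ofPred_eq, ← ha, ← hN]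
  cases verdict A a.1 (2 ^ (N + 1) - 1) (0, a.2) <;> simp

end OracleSep

namespace OracleSep
open Function
variable {A : Set Str} {m n : ℕ}

/-! ### Padding -/

/-- Move the contents of `w` to `py`, with the flag `false` at each symbol. -/
def flagProg : Prog (Reg m (Nm n)) :=
  .loop (wr .w) Option.isSome (.seq (.pop (wr .w) .nop (.push (wr .py) false) (.push (wr .py) true))
    (.push (wr .py) false))

theorem runs_flagProg {s : Reg m (Nm n) → Str} {T : ℕ} (z : ZStore)
    (hT : 6 * z.w.length + 1 ≤ T) :
    Runs A .qry flagProg (zst s z) (zst (update s (wr .py)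
      (z.w.reverse.flatMap (fun b => [false, b]) ++ s (wr .py))) { z with w := [] }) T := by
  obtain ⟨zp, zp', zs, zo1, zo2, zo3, zw, zout, zrev, zrun, zres, zclk, zq⟩ := z
  simp only at hT ⊢
  induction zw generalizing s T with
  | nil => simpa [flagProg] using Runs.loop_done (by simp) (by omega)
  | cons b w ih =>
    simp only [List.length_cons] at hT
    refine .loop_step (by simp) (T1 := 5) (.seq (T1 := 3) (T2 := 2)
      (s1 := zst (update s (wr .py) (b :: s (wr .py)))
        ⟨zp, zp', zs, zo1, zo2, zo3, w, zout, zrev, zrun, zres, zclk, zq⟩)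
      (.pop_cons (b := b) (l := w) (by simp) (T1 := 2) ?_ le_rfl) (.push le_rfl rfl) le_rfl)
      (T2 := 6 * w.length + 1) ?_ (by omega)
    · cases b <;> exact .push le_rfl (by simp)
    · simpa [flagProg] using ih (s := update s (wr .py) (false :: b :: s (wr .py))) le_rfl

/-- Shorten the string in `r` to the length of the string in `nb`. -/
def truncProg (r : Reg m (Nm n)) : Prog (Reg m (Nm n)) :=
  .seq (copy (wr .nb) (wr .rem) (wr .t))
  (.seq (.loop (wr .rem) Option.isSome
    (.seq (.pop (wr .rem) .nop .nop .nop) (.pop r .nop (.push (wr .v) false) (.push (wr .v) true))))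
  (.seq (drain r) (unload (wr .v) r)))

theorem runs_truncProg {s : Reg m (Nm n) → Str} {i : Fin m} {M N T : ℕ} (hnb : s (wr .nb) = ones M)
    (ht : s (wr .t) = []) (hv : s (wr .v) = []) (hrem : s (wr .rem) = []) (hN : (s (.inp i)).length ≤ N)
    (hT : 16 * M + 8 * N + 20 ≤ T) :
    Runs A .qry (truncProg (.inp i)) s (update s (.inp i) ((s (.inp i)).take M)) T := by
  have key : ∀ M (x acc : Str), Runs A .qry (.loop (wr .rem) Option.isSome
      (.seq (.pop (wr .rem) .nop .nop .nop) (.pop (.inp i) .nop (.push (wr .v) false)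
        (.push (wr .v) true))))
      (update (update (update s (wr .rem) (ones M)) (.inp i) x) (wr .v) acc)
      (update (update (update s (wr .rem) []) (.inp i) (x.drop M)) (wr .v) ((x.take M).reverse ++ acc))
      (6 * M + 1) := by
    intro M
    induction M with
    | zero => intro x acc; simpa using Runs.loop_done (by simp) (by omega)
    | succ M ih =>
      intro x acc
      rcases x with _ | ⟨b, x⟩
      · refine .loop_step (by simp [List.replicate_succ]) (T1 := 5) (.seq (T1 := 2) (T2 := 3)
          (.pop_cons (b := true) (l := ones M) (by simp [List.replicate_succ])
            (.nop le_rfl) le_rfl) (.pop_nil (by simp) (.nop le_rfl) (by omega)) le_rfl)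
          (T2 := 6 * M + 1) ?_ (by omega)
        convert ih [] acc using 1
        · funext j; grind [Function.update_apply]
        · simp
      · refine .loop_step (by simp [List.replicate_succ]) (T1 := 5) (.seq (T1 := 2) (T2 := 3)
          (.pop_cons (b := true) (l := ones M) (by simp [List.replicate_succ])
            (.nop le_rfl) le_rfl) (.pop_cons (b := b) (l := x) (by simp) (T1 := 2)
              (s' := update (update (update s (wr .rem) (ones M)) (.inp i) x) (wr .v) (b :: acc)) ?_
              le_rfl) le_rfl)
          (T2 := 6 * M + 1) ?_ (by omega)
        · cases b <;> exact .push le_rfl (by funext j; grind [Function.update_apply])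
        · convert ih x (b :: acc) using 1
          simp
  have e1 : Runs A .qry (copy (wr .nb) (wr .rem) (wr .t)) s (update s (wr .rem) (ones M)) (10 * M + 2) :=
    runs_copy (by simp) (by simp) (by simp) ht (by simp [hnb]) (by rw [hnb, hrem]; simp)
  have e2 := key M (s (.inp i)) []
  have h2 : update (update (update s (wr .rem) (ones M)) (.inp i) (s (.inp i))) (wr .v) [] =
      update s (wr .rem) (ones M) := by
    funext j; grind [Function.update_apply]
  rw [h2, List.append_nil] at e2
  refine .seq e1 (.seq e2 (.seq (T1 := 3 * N + 1) (T2 := 4 * N + 1) (runs_drain _ ?_)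
    (runs_unload (by simp) ?_ ?_) le_rfl) le_rfl) (by omega)
  · simp; omega
  · simp; omega
  · funext j
    simp only [update_apply]
    by_cases h1 : j = .inp i
    · subst h1; simp
    by_cases h2 : j = wr .v
    · subst h2; simp [hv]
    by_cases h3 : j = wr .rem
    · subst h3; simp [hrem]
    simp [h1, h2, h3]

/-- Shorten the strings in several registers. -/
def truncAll : List (Fin m) → Prog (Reg m (Nm n))
  | [] => .nop
  | i :: is => .seq (truncAll is) (truncProg (.inp i))

/-- The store in which the inputs with numbers in a list have been shortened. -/
def truncStore (is : List (Fin m)) (M : ℕ) (s : Reg m (Nm n) → Str) : Reg m (Nm n) → Str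
  | .inp i => if i ∈ is then (s (.inp i)).take M else s (.inp i)
  | r => s r

theorem runs_truncAll {is : List (Fin m)} (his : is.Nodup) {s : Reg m (Nm n) → Str} {M N T : ℕ}
    (hnb : s (wr .nb) = ones M) (ht : s (wr .t) = []) (hv : s (wr .v) = []) (hrem : s (wr .rem) = [])
    (hN : ∀ i, (s (.inp i)).length ≤ N) (hT : is.length * (16 * M + 8 * N + 20) + 1 ≤ T) :
    Runs A .qry (truncAll is) s (truncStore is M s) T := by
  induction is generalizing T with
  | nil =>
    have : truncStore [] M s = s := by funext r; rcases r with i | r | _ <;> simp [truncStore]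
    rw [this]
    exact .nop (by omega)
  | cons i is ih =>
    rw [List.nodup_cons] at his
    simp only [List.length_cons, add_mul] at hT
    have e := runs_truncProg (A := A) (s := truncStore is M s) (i := i) (N := N) hnb ht hv hrem
      (by simpa [truncStore, his.1] using hN i) le_rfl
    have h : update (truncStore is M s) (.inp i) ((truncStore is M s (.inp i)).take M) =
        truncStore (i :: is) M s := by
      funext r
      rcases r with j | r | _
      · by_cases hj : j = i
        · subst hj; simp [truncStore, his.1]
        · simp [truncStore, hj]
      · rfl
      · rfl
    rw [h] at e
    exact .seq (ih his.2 le_rfl) e (by omega)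

/-- The matrix of a formula composed with a reduction to `univ A`. The other arguments are cut to
the length that the formula allows for the padded string, because in the composed formula they range
over a larger set; see `altQuant_take`. -/
theorem polyTimeRel_pad (A : Set Str) (tab tab' : List Str) (p P : Str) (k k' c m : ℕ) :
    PolyTimeRel A fun xs : Fin (m + 1) → Str => SweepRel A tab' P c
      (pad p (initWord tab [xs 0] ((xs 0).length ^ k + k)) :: List.ofFn fun i => (xs (Fin.succ i)).take
        ((pad p (initWord tab [xs 0] ((xs 0).length ^ k + k))).length ^ k' + k')) := by
  let rs : List (Reg (m + 1) (Nm 0)) := wr .py :: List.ofFn fun i : Fin m => .inp i.succ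
  have hsrc : ∀ r ∈ rs, IsSource r := by
    intro r hr
    rcases List.mem_cons.1 hr with rfl | hr
    · trivial
    obtain ⟨i, rfl⟩ := List.mem_ofFn.1 hr
    trivial
  have hnd : rs.Nodup := by
    refine List.nodup_cons.2 ⟨fun h => ?_, List.nodup_ofFn.2 fun i j h => by simpa using h⟩
    obtain ⟨i, hi⟩ := List.mem_ofFn.1 h
    cases hi
  let K := maxBlock tab
  let S : ℕ → ℕ := fun N => N ^ k + k
  let len : ℕ → ℕ := fun N => 2 * p.length + 2 * ((2 * S N + 1) * K) + N
  let g : ℕ → ℕ := fun N => (10 * len N + 2) + (20 * (k' * (len N + 1) ^ k') + 2 * k' + 4) +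
    (3 * len N + 1) + (m * (16 * (len N ^ k' + k') + 8 * N + 20) + 1)
  let f : ℕ → ℕ := fun N => g N + (10 * N + 2) + (20 * (k * (N + 1) ^ k) + 2 * k + 4) + (3 * N + 1) +
    initCost K 1 (S N) + (3 * N + 1) + (3 * S N + 1) + (6 * ((2 * S N + 1) * K) + 1) +
    (4 * p.length + 1) + relCost (maxBlock tab') P.length c (m + 1) (len N)
  have hS : PolyBdd S := ⟨k, fun N => le_rfl⟩
  have id := PolyBdd.id'
  have cc := fun a => PolyBdd.const a
  have hlen : PolyBdd len := by
    repeat first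
      | exact cc _
      | exact id
      | exact hS
      | refine PolyBdd.add ?_ ?_
      | refine PolyBdd.mul ?_ ?_
  have hg : PolyBdd g := by
    repeat first
      | exact cc _
      | exact id
      | exact hlen
      | refine PolyBdd.add ?_ ?_
      | refine PolyBdd.mul ?_ ?_
      | refine PolyBdd.pow ?_ _
  have hf : PolyBdd fun N => f N + 2 := by
    have hr : PolyBdd fun N => relCost (maxBlock tab') P.length c (m + 1) (len N) :=
      (polyBdd_relCost _ _ _ _).comp hlen
    simp only [f, initCost]
    repeat first
      | exact cc _
      | exact id
      | exact hS
      | exact hr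
      | exact hg
      | refine PolyBdd.add ?_ ?_
      | refine PolyBdd.mul ?_ ?_
      | refine PolyBdd.pow ?_ _
  refine polyTimeRel_of_exec (.seq (addLen (.inp 0) (wr .len) (wr .t))
    (.seq (polyUnary (wr .len) (wr .bd) (wr .v) (wr .t) k)
    (.seq (drain (wr .len))
    (.seq (initProg tab [.inp 0])
    (.seq (drain (.inp 0))
    (.seq (drain (wr .bd))
    (.seq flagProg
    (.seq (pushAll (wr .py) (p.reverse.flatMap fun b => [true, b]))
    (.seq (addLen (wr .py) (wr .len) (wr .t))
    (.seq (polyUnary (wr .len) (wr .nb) (wr .v) (wr .t) k')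
    (.seq (drain (wr .len))
    (.seq (truncAll ((List.finRange m).map Fin.succ)) (relProg tab' P c rs))))))))))))) .res
    hf fun xs => ?_
  set s0 : Reg (m + 1) (Nm 0) → Str := inputStore xs with hs0
  have hs : s0 = zst s0 .nil := by
    funext r
    rcases r with i | r | _
    · rfl
    · cases r <;> rfl
    · rfl
  have h0w : ∀ j, s0 (.wk j) = [] := fun _ => rfl
  have h0i : ∀ i, s0 (.inp i) = xs i := fun _ => rfl
  set y := xs 0 with hy
  set N := ∑ i, (xs i).length with hN
  have hyN : y.length ≤ N := 
    Finset.single_le_sum (f := fun i => (xs i).length) (fun _ _ => Nat.zero_le _) (Finset.mem_univ 0)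
  set Sy := y.length ^ k + k with hSy
  have hSN : Sy ≤ S N := Nat.add_le_add_right (Nat.pow_le_pow_left hyN _) _
  set W := initWord tab [y] Sy with hW
  have hWl : W.length ≤ (2 * S N + 1) * K :=
    (length_initWord_le _ _ _).trans (Nat.mul_le_mul_right _ (by omega))
  have e1 : Runs A .qry (addLen (.inp 0) (wr .len) (wr .t)) (zst s0 .nil)
      (zst (update s0 (wr .len) (ones y.length)) .nil) (10 * N + 2) :=
    runs_addLen (by simp) (by simp) (by simp) (by simp [h0w]) (by simp [h0i, ← hy]; omega)
      (by simp [h0w, h0i, hy])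
  have e2 := runs_polyUnary (A := A) (qr := .qry) (n := wr (m := m + 1) (n := 0) .len) (u := wr .bd)
    (v := wr .v) (t := wr .t) (s := zst (update s0 (wr .len) (ones y.length)) .nil)
    (by simp) (by simp) (by simp) (by simp) (by simp) (by simp) (by simp [h0w])
    (by simp [h0w]) k (by simp [h0w]) (T := 20 * (k * (N + 1) ^ k) + 2 * k + 4) (by
      simp only [zst_len, update_self, List.length_replicate]; gcongr) rfl
  simp only [zst_len, update_self, update_zst_bd, List.length_replicate, ← hSy] at e2
  have e3 := runs_drain (A := A) (qr := .qry) (T := 3 * N + 1) (wr (m := m + 1) (n := 0) .len)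
    (s := zst (update (update s0 (wr .len) (ones y.length)) (wr .bd) (ones Sy)) .nil) (by simp; omega)
  set s3 := update s0 (wr .bd) (ones Sy) with hs3
  have hs3' : update (zst (update (update s0 (wr .len) (ones y.length)) (wr .bd) (ones Sy)) .nil)
      (wr .len) [] = zst s3 .nil := by
    rw [update_zst_len]
    congr 1
    funext j
    have := h0w .len
    grind [Function.update_apply]
  rw [hs3'] at e3
  have e4 := runs_initProg (A := A) (s := s3) (z := .nil) (rs := [.inp 0]) tab (by simp)
    (by simp [IsSource]) (S := Sy) rfl (by simp [hs3, h0w]) (by simp [hs3, h0w]) (by simp [hs3])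
    (T := initCost K 1 (S N)) (by unfold initCost; gcongr; simp)
  have h3i : s3 (.inp 0) = y := by simp [hs3, h0i, hy]
  simp only [List.map_cons, List.map_nil, h3i, ← hW] at e4
  set s4 := dropAll [.inp 0] (Sy + 1) s3 with hs4
  have e5 := runs_drain (A := A) (qr := .qry) (T := 3 * N + 1) (.inp 0)
    (s := zst s4 { ZStore.nil with w := W }) (by simp [hs4, dropAll, h3i]; omega)
  have e6 := runs_drain (A := A) (qr := .qry) (T := 3 * S N + 1) (wr .bd)
    (s := zst (update s4 (.inp 0) []) { ZStore.nil with w := W }) (by simp [hs4, dropAll, hs3]; omega)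
  set s6 := update s0 (.inp 0) [] with hs6
  have hs6' : update (update s4 (.inp 0) []) (wr .bd) [] = s6 := by
    have := h0w .bd
    funext j
    by_cases h1 : j = .inp 0
    · subst h1; simp [hs6]
    by_cases h2 : j = wr .bd
    · subst h2; simp [hs6, this]
    simp [hs6, hs4, hs3, dropAll, h1, h2]
  simp only [update_zst_inp] at e5
  rw [update_zst_bd, hs6'] at e6
  have e7 := runs_flagProg (A := A) (s := s6) { ZStore.nil with w := W }
    (T := 6 * ((2 * S N + 1) * K) + 1) (by simp only; omega)
  have e8 : Runs A .qry (pushAll (wr .py) (p.reverse.flatMap fun b => [true, b])) _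
      (zst (update s6 (wr .py) (pad p W)) .nil) (4 * p.length + 1) :=
    runs_pushAll (s := zst (update s6 (wr .py)
      (W.reverse.flatMap (fun b => [false, b]) ++ s6 (wr .py))) { ZStore.nil with w := [] }) _ _
      (by simp; omega) (by simp [hs6, h0w, pad, ZStore.nil])
  set s8 := update s6 (wr .py) (pad p W) with hs8
  have hpl : (pad p W).length = 2 * p.length + 2 * W.length := by simp [pad]; omega
  have hlN : len N = 2 * p.length + 2 * ((2 * S N + 1) * K) + N := rfl
  set l := (pad p W).length with hl
  have hllen : l ≤ len N := by omega
  set Q := l ^ k' + k' with hQ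
  have h8w : s8 (wr .py) = pad p W := by simp [hs8]
  have f1 : Runs A .qry (addLen (wr .py) (wr .len) (wr .t)) (zst s8 .nil)
      (zst (update s8 (wr .len) (ones l)) .nil) (10 * len N + 2) :=
    runs_addLen (by simp) (by simp) (by simp) (by simp [hs8, hs6, h0w]) (by simp [h8w]; omega) (by
      simp only [zst_py, h8w, zst_len, ← hl, update_zst_len]
      simp [hs8, hs6, h0w])
  have f2 := runs_polyUnary (A := A) (qr := .qry) (n := wr (m := m + 1) (n := 0) .len) (u := wr .nb)
    (v := wr .v) (t := wr .t) (s := zst (update s8 (wr .len) (ones l)) .nil)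
    (by simp) (by simp) (by simp) (by simp) (by simp) (by simp) (by simp [hs8, hs6, h0w])
    (by simp [hs8, hs6, h0w]) k' (by simp [hs8, hs6, h0w])
    (T := 20 * (k' * (len N + 1) ^ k') + 2 * k' + 4) (by
      simp only [zst_len, update_self, List.length_replicate]; gcongr) rfl
  simp only [zst_len, update_self, update_zst_nb, List.length_replicate, ← hQ] at f2
  have f3 := runs_drain (A := A) (qr := .qry) (T := 3 * len N + 1) (wr (m := m + 1) (n := 0) .len)
    (s := zst (update (update s8 (wr .len) (ones l)) (wr .nb) (ones Q)) .nil) (by simp; omega)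
  set s9 := update s8 (wr .nb) (ones Q) with hs9
  have hs9' : update (zst (update (update s8 (wr .len) (ones l)) (wr .nb) (ones Q)) .nil)
      (wr .len) [] = zst s9 .nil := by
    rw [update_zst_len]
    congr 1
    have : s8 (wr .len) = [] := by simp [hs8, hs6, h0w]
    clear_value s8
    funext j
    by_cases h1 : j = wr .len
    · subst h1; simp [hs9, this]
    by_cases h2 : j = wr .nb
    · subst h2; simp [hs9]
    simp [hs9, h1, h2]
  rw [hs9'] at f3
  have f4 := runs_truncAll (A := A) (s := zst s9 .nil) (is := (List.finRange m).map Fin.succ) (M := Q)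
    (N := N) (T := m * (16 * (len N ^ k' + k') + 8 * N + 20) + 1)
    ((List.nodup_finRange m).map (Fin.succ_injective m)) (by simp [hs9])
    (by simp [hs9, hs8, hs6, h0w]) (by simp [hs9, hs8, hs6, h0w]) (by simp [hs9, hs8, hs6, h0w])
    (fun i => by
      by_cases hi : i = 0
      · subst hi; simp [hs9, hs8, hs6]
      · simp only [zst_inp, hs9, hs8, hs6, h0i, ne_eq, reduceCtorEq, not_false_eq_true, update_of_ne,
          Reg.inp.injEq, hi]
        exact Finset.single_le_sum (f := fun i => (xs i).length) (fun _ _ => Nat.zero_le _)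
          (Finset.mem_univ i))
    (by simp only [List.length_map, List.length_finRange, hQ]; gcongr)
  have hz : truncStore ((List.finRange m).map Fin.succ) Q (zst s9 .nil) =
      zst (truncStore ((List.finRange m).map Fin.succ) Q s9) .nil := by
    funext r
    rcases r with i | r | _
    · rfl
    · cases r <;> rfl
    · rfl
  rw [hz] at f4
  set s10 := truncStore ((List.finRange m).map Fin.succ) Q s9 with hs10
  have h10w : ∀ j, s10 (.wk j) = s9 (.wk j) := fun j => rfl
  have e9 := runs_relProg (A := A) (s := s10) tab' P c hnd hsrc (by simp [h10w, hs9, hs8, hs6, h0w])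
    (by simp [h10w, hs9, hs8, hs6, h0w]) (by simp [h10w, hs9, hs8, hs6, h0w])
    (by simp [h10w, hs9, hs8, hs6, h0w])
  have hmap : rs.map s10 = pad p W :: List.ofFn fun i => (xs (Fin.succ i)).take Q := by
    simp only [rs, List.map_cons, List.map_ofFn, h10w, comp_def]
    congr 1
    simp [hs10, truncStore, hs9, hs8, hs6, h0i]
  rw [hmap] at e9
  have hle : ((pad p W :: List.ofFn fun i => (xs (Fin.succ i)).take Q).map List.length).sum ≤ len N := by
    have h2 : N = y.length + ∑ i : Fin m, (xs i.succ).length := by rw [hN, hy, Fin.sum_univ_succ]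
    have h3 : ∑ i : Fin m, ((xs i.succ).take Q).length ≤ ∑ i : Fin m, (xs i.succ).length :=
      Finset.sum_le_sum fun i _ => by simp
    simp only [List.map_cons, List.sum_cons, List.map_ofFn, List.sum_ofFn, comp_apply]
    omega
  have hrl : rs.length = m + 1 := by simp [rs]
  rw [hrl] at e9
  have hmono := relCost_mono (maxBlock tab') P.length c (m + 1) hle
  obtain ⟨t, ht, h⟩ := Runs.seq e1 (.seq e2 (.seq e3 (.seq e4 (.seq e5 (.seq e6 (.seq e7
    (.seq e8 (.seq f1 (.seq f2 (.seq f3 (.seq f4 e9 le_rfl) le_rfl) le_rfl) le_rfl) le_rfl) le_rfl)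
    le_rfl) le_rfl) le_rfl) le_rfl) le_rfl) le_rfl
  rw [← hs] at h
  refine ⟨_, t, h, ?_, ?_⟩
  · have hfN : f N = g N + (10 * N + 2) + (20 * (k * (N + 1) ^ k) + 2 * k + 4) + (3 * N + 1) +
      initCost K 1 (S N) + (3 * N + 1) + (3 * S N + 1) + (6 * ((2 * S N + 1) * K) + 1) +
      (4 * p.length + 1) + relCost (maxBlock tab') P.length c (m + 1) (len N) := rfl
    have hgN : g N = (10 * len N + 2) + (20 * (k' * (len N + 1) ^ k') + 2 * k' + 4) +
      (3 * len N + 1) + (m * (16 * (len N ^ k' + k') + 8 * N + 20) + 1) := rfl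
    omega
  · simp only [zst_res, SweepRel]
    generalize verdict A P _ _ = v
    cases v <;> simp

end OracleSep

namespace OracleSep
open Function
variable {A : Set Str}

/-! ### Sweeping automata over finite alphabets -/

/-- A finite automaton that sweeps over a word, rewriting its letters and emitting bits, and that asks at
each end of the word for a bit. -/
structure SweepAut (Q Γ : Type) where
  step : Q → Γ → Q × Γ × Option Bool
  turn : Q → Bool → Q × Option Bool

namespace SweepAut

variable {Q Γ : Type} (M : SweepAut Q Γ)

/-- Process one letter; compare `bitStep`. -/
def letterStep (a : Q × List Γ × Str) (g : Γ) : Q × List Γ × Str :=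
  ((M.step a.1 g).1, (M.step a.1 g).2.1 :: a.2.1, (M.step a.1 g).2.2.toList ++ a.2.2)

open Classical in
/-- One sweep. -/
noncomputable def sweep (A : Set Str) (c : Q × List Γ) : Option Bool × Q × List Γ :=
  let a := c.2.foldl M.letterStep (c.1, [], [])
  ((M.turn a.1 (decide (a.2.2.reverse ∈ A))).2, (M.turn a.1 (decide (a.2.2.reverse ∈ A))).1, a.2.1)

/-- The verdict after at most `T` sweeps. -/
noncomputable def verdict (A : Set Str) : ℕ → Q × List Γ → Option Bool
  | 0, _ => none
  | T + 1, c => (M.sweep A c).1.or (verdict A T (M.sweep A c).2)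

/-- A whole sweep is verified locally: it suffices to guess the state before each letter, the new
letters and the emitted bits, and to check single steps. -/
theorem foldl_letterStep {st : ℕ → Q} {f g : ℕ → Γ} {em : ℕ → Option Bool} {n : ℕ}
    (h : ∀ j < n, M.step (st j) (f j) = (st (j + 1), g j, em j)) :
    ((List.range n).map f).foldl M.letterStep (st 0, [], []) =
      (st n, ((List.range n).map g).reverse, ((List.range n).filterMap em).reverse) := by
  induction n with
  | zero => rfl
  | succ n ih =>
    rw [List.range_succ, List.map_append, List.foldl_append, ih fun j hj => h j (by omega)]
    simp only [List.map_cons, List.map_nil, List.foldl_cons, List.foldl_nil, letterStep,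
      h n (Nat.lt_succ_self n), List.filterMap_append, List.map_append, List.reverse_append]
    cases hem : em n <;> simp [hem]

end SweepAut

/-- The representation of an entry of a table. -/
def encEntry (e : ℕ × Bool × Bool × Bool) : Str := ones e.1 ++ [false, e.2.1, e.2.2.1, e.2.2.2]

theorem skipEntry_encEntry (e) (l : Str) : skipEntry (encEntry e ++ l) = l := by
  obtain ⟨n, b1, b2, b3⟩ := e
  have : (encEntry (n, b1, b2, b3) ++ l).dropWhile id = [false, b1, b2, b3] ++ l := by
    simp only [encEntry]
    induction n with
    | zero => rfl
    | succ n ih => simp [List.replicate_succ]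
  rw [skipEntry, this]
  rfl

theorem readEntry_encEntry (e) (l : Str) : readEntry (encEntry e ++ l) = e := by
  obtain ⟨n, b1, b2, b3⟩ := e
  have h1 : (encEntry (n, b1, b2, b3) ++ l).dropWhile id = [false, b1, b2, b3] ++ l := by
    simp only [encEntry]
    induction n with
    | zero => rfl
    | succ n ih => simp [List.replicate_succ]
  have h2 : (encEntry (n, b1, b2, b3) ++ l).takeWhile id = ones n := by
    simp only [encEntry]
    clear h1
    induction n with
    | zero => rfl
    | succ n ih => simp [List.replicate_succ]
  simp [readEntry, h1, h2]

theorem entry_flatMap (f : ℕ → ℕ × Bool × Bool × Bool) {N j : ℕ} (h : j < N) :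
    entry ((List.range N).flatMap fun i => encEntry (f i)) j = f j := by
  have key : ∀ (l : List ℕ) (j : ℕ) (h : j < l.length),
      entry (l.flatMap fun i => encEntry (f i)) j = f l[j] := by
    intro l
    induction l with
    | nil => intro j h; simp at h
    | cons a l ih =>
      intro j h
      cases j with
      | zero => simp [entry, readEntry_encEntry]
      | succ j =>
        have := ih j (by simpa using h)
        simpa [entry, skipEntry_encEntry] using this
  rw [key (List.range N) j (by simpa using h), List.getElem_range]

/-- Every state owns four consecutive entries, two for the bits and two for the answers of the
oracle, so its number is a multiple of `4`. -/
theorem exists_table {X : Type} [Finite X] (x0 : X) (step : X → Bool → X × Bool × Option Bool)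
    (turn : X → Bool → X × Option Bool) : ∃ (P : Str) (code : X → ℕ), code x0 = 0 ∧
    (∀ x b, entry P (code x + b.toNat) = (code (step x b).1, (step x b).2.1,
      (step x b).2.2.isSome, (step x b).2.2.getD false)) ∧
    ∀ x a, entry P (code x + bif a then 3 else 2) = (code (turn x a).1, (turn x a).2.isSome,
      (turn x a).2.getD false, false) := by
  obtain ⟨N, ⟨e⟩⟩ := Finite.exists_equiv_fin X
  have hN : 0 < N := (e x0).pos
  -- The swap gives the initial state the number `0`.
  let e' : X ≃ Fin N := e.trans (Equiv.swap (e x0) ⟨0, hN⟩)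
  let code : X → ℕ := fun x => 4 * e' x
  let dec : ℕ → X := fun j => if h : j / 4 < N then e'.symm ⟨j / 4, h⟩ else x0
  let f : ℕ → ℕ × Bool × Bool × Bool := fun j =>
    if j % 4 < 2 then
      let r := step (dec j) (decide (j % 4 = 1))
      (code r.1, r.2.1, r.2.2.isSome, r.2.2.getD false)
    else
      let r := turn (dec j) (decide (j % 4 = 3))
      (code r.1, r.2.isSome, r.2.getD false, false)
  have hdec : ∀ x k, k < 4 → dec (code x + k) = x := by
    intro x k hk
    have h1 : (4 * (e' x : ℕ) + k) / 4 = e' x := by omega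
    simp only [dec, code, h1, (e' x).2, dif_pos, Fin.eta, Equiv.symm_apply_apply]
  have hlt : ∀ x k, k < 4 → code x + k < 4 * N := by
    intro x k hk
    have := (e' x).2
    simp only [code]; omega
  refine ⟨(List.range (4 * N)).flatMap fun i => encEntry (f i), code, ?_, fun x b => ?_, fun x a => ?_⟩
  · simp [code, e']
  · have hb : b.toNat < 2 := Bool.toNat_lt b
    have h2 : (code x + b.toNat) % 4 = b.toNat := by simp only [code]; omega
    rw [entry_flatMap f (hlt x _ (by omega))]
    simp only [f, hdec x b.toNat (by omega), h2, hb, if_true]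
    cases b <;> rfl
  · have ha : (bif a then 3 else 2) < 4 := by cases a <;> simp
    have h2 : (code x + bif a then 3 else 2) % 4 = bif a then 3 else 2 := by simp only [code]; omega
    rw [entry_flatMap f (hlt x _ ha)]
    simp only [f, hdec x _ ha, h2]
    cases a <;> rfl

/-- Words over an alphabet as bit strings: the code of each letter is followed by a block of the same
length that has no meaning. -/
inductive Rep {Γ : Type} (enc : Γ → Str) (B : ℕ) : List Γ → Str → Prop
  | nil : Rep enc B [] []
  | cons {g gs j w} : j.length = B → Rep enc B gs w → Rep enc B (g :: gs) (enc g ++ (j ++ w))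

theorem Rep.append {Γ : Type} {enc : Γ → Str} {B : ℕ} {gs hs : List Γ} {v w : Str} (h1 : Rep enc B gs v)
    (h2 : Rep enc B hs w) : Rep enc B (gs ++ hs) (v ++ w) := by
  induction h1 with
  | nil => exact h2
  | cons hj _ ih => simpa using Rep.cons hj ih

/-- A bit must be replaced at the moment it is read, before the letter is known. So each code is
followed by an idle block: over the code the automaton writes zeros and learns the letter, and over
the idle block it writes the new code. Seen from the other end, the new word again has each code in
front of an idle block. -/
theorem exists_sweep_table {Q Γ : Type} [Finite Q] [Finite Γ] [Nonempty Γ] (M : SweepAut Q Γ) (q0 : Q) :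
    ∃ (P : Str) (B : ℕ) (enc : Γ → Str), ∀ A T gs w, Rep enc B gs w →
      verdict A P T (0, w) = M.verdict A T (q0, gs) := by
  classical
  obtain ⟨B, ⟨e⟩⟩ := Finite.exists_equiv_fin Γ
  have hB : 0 < B := (e (Classical.arbitrary Γ)).pos
  -- One-hot codes; all that matters is that the map is injective and its values have the same
  -- length `B`.
  let enc : Γ → Str := fun g => List.ofFn fun i => decide (e g = i)
  have henc : ∀ g, (enc g).length = B := fun g => by simp [enc]
  have hinj : Injective enc := fun g g' h => by
    have := congrFun (List.ofFn_injective h) (e g')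
    simpa using this
  let dec : Str → Γ := invFun enc
  have hdec : ∀ g, dec (enc g) = g := leftInverse_invFun hinj
  -- The flag distinguishes writing (`true`) from reading (`false`); the buffer holds the bits still
  -- to be written or already read, and bounding it keeps the states finite.
  let X := {x : Q × Bool × Str // x.2.2.length ≤ B}
  have hX : Finite X := by
    have hf := List.finite_length_le Bool B
    have : Finite {l : Str // l.length ≤ B} := hf.to_subtype
    refine Finite.of_injective (β := Q × Bool × {l : Str // l.length ≤ B})
      (fun x => (x.1.1, x.1.2.1, ⟨x.1.2.2, x.2⟩)) fun x y h => ?_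
    obtain ⟨⟨_, _, _⟩, _⟩ := x
    obtain ⟨⟨_, _, _⟩, _⟩ := y
    exact Subtype.ext (by simpa using h)
  let cap : Q → Bool → Str → X := fun q ph l => ⟨(q, ph, l.take B), by simp⟩
  let step : X → Bool → X × Bool × Option Bool := fun x b =>
    if x.1.2.1 then (match x.1.2.2 with
      | [] => (cap x.1.1 false [], false, none)
      | [a] => (cap x.1.1 false [], a, none)
      | a :: v => (cap x.1.1 true v, a, none))
    else if x.1.2.2.length + 1 = B then
      let r := M.step x.1.1 (dec (x.1.2.2 ++ [b]))
      (cap r.1 true (enc r.2.1).reverse, false, r.2.2)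
    else (cap x.1.1 false (x.1.2.2 ++ [b]), false, none)
  let turn : X → Bool → X × Option Bool := fun x a =>
    (cap (M.turn x.1.1 a).1 false [], (M.turn x.1.1 a).2)
  obtain ⟨P, code, h0, h1, h2⟩ := exists_table (cap q0 false []) step turn
  -- The buffer `v` is the reversed code. As the output is accumulated with its last bit first,
  -- `v.reverse` appears there, which is the code as the next sweep will read it.
  have hwrite : ∀ (v j : Str) (q : Q) (out em : Str), v ≠ [] → v.length ≤ B → j.length = v.length →
      j.foldl (bitStep P) (code (cap q true v), out, em) = (code (cap q false []), v.reverse ++ out, em) := by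
    intro v
    induction v with
    | nil => intro j q out em h; exact absurd rfl h
    | cons a v ih =>
      intro j q out em _ hl hj
      obtain _ | ⟨b, j⟩ := j
      · simp at hj
      have hc : (cap q true (a :: v)).1 = (q, true, a :: v) := by
        simp only [cap]; rw [List.take_of_length_le hl]
      simp only [List.foldl_cons, bitStep, h1]
      rcases v with _ | ⟨a', v⟩
      · obtain rfl : j = [] := by simpa using hj
        simp [step, hc]
      · have := ih j q (a :: out) em (by simp) (by simp at hl ⊢; omega) (by simpa using hj)
        simpa [step, hc] using this
  have hread : ∀ (l u : Str) (q : Q) (out em : Str), l ≠ [] → u.length + l.length = B →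
      l.foldl (bitStep P) (code (cap q false u), out, em) =
        (code (cap (M.step q (dec (u ++ l))).1 true (enc (M.step q (dec (u ++ l))).2.1).reverse),
          List.replicate l.length false ++ out, (M.step q (dec (u ++ l))).2.2.toList ++ em) := by
    intro l
    induction l with
    | nil => intro u q out em h; exact absurd rfl h
    | cons b l ih =>
      intro u q out em _ hl
      rw [List.length_cons] at hl
      have hc : (cap q false u).1 = (q, false, u) := by
        simp only [cap]; rw [List.take_of_length_le (by omega)]
      simp only [List.foldl_cons, bitStep, h1]
      rcases l with _ | ⟨b', l⟩
      · have hl' : u.length + 1 = B := hl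
        simp only [step, hc, hl', if_true, Bool.false_eq_true, if_false, List.foldl_nil]
        cases (M.step q (dec (u ++ [b]))).2.2 <;> rfl
      · have hl' : ¬ u.length + 1 = B := by rw [List.length_cons] at hl; omega
        have := ih (u ++ [b]) q (false :: out) em (by simp) (by simp at hl ⊢; omega)
        simp only [step, hc, hl', Bool.false_eq_true, if_false, Option.isSome_none]
        rw [this]
        simp [List.replicate_succ']
  have hpass : ∀ gs w, Rep enc B gs w → ∀ q os out em, Rep enc B os out → ∃ out',
      w.foldl (bitStep P) (code (cap q false []), out, em) =
        (code (cap (gs.foldl M.letterStep (q, os, em)).1 false []), out',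
          (gs.foldl M.letterStep (q, os, em)).2.2) ∧
      Rep enc B (gs.foldl M.letterStep (q, os, em)).2.1 out' := by
    intro gs w h
    induction h with
    | nil => intro q os out em h; exact ⟨out, rfl, h⟩
    | @cons g gs j w hj _ ih =>
      intro q os out em h
      have hne : enc g ≠ [] := fun h => by have := henc g; rw [h] at this; simp at this; omega
      have hne' : (enc (M.step q g).2.1).reverse ≠ [] := fun h => by
        have := henc (M.step q g).2.1
        rw [List.reverse_eq_nil_iff.1 h] at this; simp at this; omega
      have e1 := hread (enc g) [] q out em hne (by simp [henc])
      rw [List.nil_append, hdec, henc] at e1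
      have e2 := hwrite _ j (M.step q g).1 (List.replicate B false ++ out)
        ((M.step q g).2.2.toList ++ em) hne' (by simp [henc]) (by simp [henc, hj])
      rw [List.reverse_reverse] at e2
      rw [List.foldl_append, List.foldl_append, e1, e2]
      exact ih _ _ _ _ (.cons (by simp) h)
  refine ⟨P, B, enc, fun A T => ?_⟩
  have key : ∀ q gs w, Rep enc B gs w →
      verdict A P T (code (cap q false []), w) = M.verdict A T (q, gs) := by
    induction T with
    | zero => intro q gs w h; rfl
    | succ T ih =>
      intro q gs w h
      obtain ⟨out', h3, h4⟩ := hpass gs w h q [] [] [] .nil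
      have h5 : ∀ x, (if x ∈ A then 3 else 2) = bif decide (x ∈ A) then 3 else 2 := by
        intro x; by_cases hx : x ∈ A <;> simp [hx]
      have hcq : ∀ q, (cap q false []).1.1 = q := fun _ => rfl
      simp only [verdict, SweepAut.verdict, sweep, SweepAut.sweep, passOver, h3]
      rw [h5, h2]
      simp only [turn, hcq]
      rw [ih _ _ _ h4]
      congr 1
      cases (M.turn _ _).2 <;> rfl
  intro gs w h
  rw [← h0]
  exact key q0 gs w h

end OracleSep

namespace OracleSep
open Function

/-! ### Sweeping automata that simulate oracle machines -/

/-- The letters: for each tape a symbol and a mark for the place of the head, and a mark for the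
origin. -/
abbrev Cell (T : Type) : Type := (T → Option Bool × Bool) × Bool

/-- The cell number `z` when the tapes and heads are as given. -/
def cellAt {T : Type} (tape : T → ℤ → Option Bool) (head : T → ℤ) (z : ℤ) : Cell T :=
  (fun i => (tape i z, decide (head i = z)), decide (z = 0))

/-- The states in a sweep to the left: the state of the machine, the directions in which the heads have
to be moved, the heads that are being moved, and the scanned symbols found so far. -/
structure LeftSt (Q T : Type) where
  state : Q
  dir : T → SignType
  carry : T → Bool
  scan : T → Option Bool

/-- The states in a sweep to the right: the next state of the machine, if the answer of the oracle is yes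
or no; the symbols that have to be written and the directions in which the heads have to be moved; the
heads that are being moved; and whether the query word has already begun and not yet ended. -/
structure RightSt (Q T : Type) where
  yes : Q
  no : Q
  write : T → Option Bool
  dir : T → SignType
  carry : T → Bool
  phase : Option Bool

variable {m : ℕ} (M : OracleTM m)

/-- The tapes of `M`. -/
abbrev OracleTM.Tp : Type := TapeIx m M.k

/-- What has to be done in a step, given the state and the scanned symbols. -/
def OracleTM.plan (q : M.State) (sc : M.Tp → Option Bool) :
    Bool ⊕ RightSt M.State M.Tp :=
  match M.act q with
  | .halt b => .inl b
  | .query yes no => .inr ⟨yes, no, sc, fun _ => 0, fun _ => false, none⟩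
  | .move δ => .inr ⟨(δ sc).1, (δ sc).1, (δ sc).2.1, (δ sc).2.2, fun _ => false, none⟩

/-- The action of the automaton in a sweep to the left. -/
def leftStep (s : LeftSt M.State M.Tp) (g : Cell M.Tp) : LeftSt M.State M.Tp × Cell M.Tp :=
  let mark : M.Tp → Bool := fun i => if s.dir i = -1 then s.carry i else (g.1 i).2
  ({ s with
      carry := fun i => if s.dir i = -1 then (g.1 i).2 else false
      scan := fun i => if mark i then (g.1 i).1 else s.scan i },
    (fun i => ((g.1 i).1, mark i), g.2))

/-- The action of the automaton in a sweep to the right. -/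
def rightStep (s : RightSt M.State M.Tp) (g : Cell M.Tp) :
    RightSt M.State M.Tp × Cell M.Tp × Option Bool :=
  let ph : Option Bool := if g.2 then some true else s.phase
  let q := (g.1 .query).1
  ({ s with
      carry := fun i => if s.dir i = 1 then (g.1 i).2 else false
      phase := if ph = some true ∧ q = none then some false else ph },
    (fun i => (if (g.1 i).2 then s.write i else (g.1 i).1,
      if s.dir i = 1 then s.carry i else (g.1 i).2), g.2),
    if ph = some true then q else none)

/-- The automaton that simulates `M`. -/
def OracleTM.sweepAut : SweepAut (LeftSt M.State M.Tp ⊕ RightSt M.State M.Tp) (Cell M.Tp) where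
  step
    | .inl s, g => (.inl (leftStep M s g).1, (leftStep M s g).2, none)
    | .inr s, g => (.inr (rightStep M s g).1, (rightStep M s g).2.1, (rightStep M s g).2.2)
  turn
    | .inl s, _ => match M.plan s.state s.scan with
      | .inl b => (.inl s, some b)
      | .inr r => (.inr r, none)
    | .inr s, a => (.inl ⟨if a then s.yes else s.no, s.dir, fun _ => false, fun _ => none⟩, none)

/-- The cells `S, …, -S`. -/
def cellsDown {T : Type} (tape : T → ℤ → Option Bool) (head : T → ℤ) (S : ℕ) : List (Cell T) :=
  (List.range (2 * S + 1)).map fun j : ℕ => cellAt tape head (S - j)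

/-- The cells `-S, …, S`. -/
def cellsUp {T : Type} (tape : T → ℤ → Option Bool) (head : T → ℤ) (S : ℕ) : List (Cell T) :=
  (List.range (2 * S + 1)).map fun j : ℕ => cellAt tape head (j - S)

theorem reverse_cellsDown {T : Type} (tape : T → ℤ → Option Bool) (head : T → ℤ) (S : ℕ) :
    (cellsDown tape head S).reverse = cellsUp tape head S := by
  refine List.ext_getElem (by simp [cellsUp, cellsDown]) fun i h1 h2 => ?_
  simp only [cellsUp, List.length_map, List.length_range] at h2
  simp only [cellsDown, cellsUp, List.getElem_reverse, List.getElem_map, List.getElem_range,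
    List.length_map, List.length_range]
  congr 1
  omega

theorem reverse_cellsUp {T : Type} (tape : T → ℤ → Option Bool) (head : T → ℤ) (S : ℕ) :
    (cellsUp tape head S).reverse = cellsDown tape head S := by
  rw [← reverse_cellsDown, List.reverse_reverse]

variable {M}

/-- A sweep to the left can move marks only to the left: the mark is taken off at the old place and
set one cell later. The symbols under the heads are collected at the same time, at the final
positions. -/
theorem foldl_left (q : M.State) (tape : M.Tp → ℤ → Option Bool) (head head' : M.Tp → ℤ)
    (d : M.Tp → SignType) (S : ℕ) (h1 : ∀ i, |head i| ≤ S) (h2 : ∀ i, |head' i| ≤ S)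
    (h : ∀ i, head' i = head i + if d i = -1 then -1 else 0) :
    (cellsDown tape head S).foldl M.sweepAut.letterStep
      (.inl ⟨q, d, fun _ => false, fun _ => none⟩, [], []) =
      (.inl ⟨q, d, fun _ => false, fun i => tape i (head' i)⟩, cellsUp tape head' S, []) := by
  -- Before cell `S - j` is read, the mark of a head is being carried iff it stood in the cell just
  -- passed, and a symbol is known iff its place has been passed.
  let st : ℕ → LeftSt M.State M.Tp ⊕ RightSt M.State M.Tp := fun j => .inl ⟨q, d,
    fun i => decide (d i = -1 ∧ head i = S - j + 1),
    fun i => if head' i > S - j then tape i (head' i) else none⟩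
  have h0 : ∀ i, -(S : ℤ) ≤ head i ∧ head i ≤ S := fun i => abs_le.1 (h1 i)
  have h0' : ∀ i, -(S : ℤ) ≤ head' i ∧ head' i ≤ S := fun i => abs_le.1 (h2 i)
  have hm : ∀ i (j : ℕ), (if d i = -1 then decide (d i = -1 ∧ head i = S - j + 1) else
      decide (head i = S - j)) = decide (head' i = S - j) := by
    intro i j
    rw [h i]
    split_ifs with hd <;> simp [hd]
    omega
  have key := M.sweepAut.foldl_letterStep (st := st) (n := 2 * S + 1)
    (f := fun j : ℕ => cellAt tape head (S - j)) (g := fun j : ℕ => cellAt tape head' (S - j))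
    (em := fun _ => none) fun j hj => by
      simp only [OracleTM.sweepAut, st, leftStep, cellAt, Prod.mk.injEq, Sum.inl.injEq,
        LeftSt.mk.injEq, true_and, and_true, hm]
      refine ⟨funext fun i => ?_, funext fun i => ?_⟩
      · push_cast; split_ifs with hd <;> simp [hd]; omega
      · push_cast
        by_cases h3 : head' i = S - j
        · have h4 : head' i > S - (j + 1) := by omega
          simp only [h3, decide_true, if_true]
          rw [← h3, if_pos h4]
        · simp only [h3, decide_false, Bool.false_eq_true, if_false]
          refine if_congr ?_ rfl rfl
          omega
  have hst : st 0 = .inl ⟨q, d, fun _ => false, fun _ => none⟩ := by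
    simp only [st, Sum.inl.injEq, LeftSt.mk.injEq, true_and, Nat.cast_zero, sub_zero]
    refine ⟨funext fun i => decide_eq_false fun h3 => ?_, funext fun i => if_neg ?_⟩
    · have := h0 i; omega
    · have := h0' i; omega
  have hst' : st (2 * S + 1) = .inl ⟨q, d, fun _ => false, fun i => tape i (head' i)⟩ := by
    simp only [st, Sum.inl.injEq, LeftSt.mk.injEq, true_and]
    refine ⟨funext fun i => decide_eq_false fun h3 => ?_, funext fun i => if_pos ?_⟩
    · have h4 := h0' i
      have h5 := h i
      rw [if_pos h3.1] at h5
      push_cast at h3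
      omega
    · have := h0' i; push_cast; omega
  rw [hst, hst', show (List.range (2 * S + 1)).map (fun j : ℕ => cellAt tape head' (S - j)) =
    cellsDown tape head' S from rfl, reverse_cellsDown] at key
  rw [cellsDown, key]
  simp

/-- The cell just outside the range of the heads is blank, so the word on the tape ends inside the
represented part. -/
theorem exists_query_word {t : ℤ → Option Bool} {S : ℕ} (hS : t (S + 1) = none) :
    ∃ N : ℕ, N ≤ S + 1 ∧ t N = none ∧ ∀ i < N, t i ≠ none := by
  classical
  have : ∃ N : ℕ, t N = none := ⟨S + 1, by exact_mod_cast hS⟩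
  exact ⟨Nat.find this, Nat.find_min' this (by exact_mod_cast hS), Nat.find_spec this,
    fun i hi => Nat.find_min this hi⟩

theorem isWordOn_filterMap {t : ℤ → Option Bool} {N S : ℕ} (hN : N ≤ S + 1) (h1 : t N = none)
    (h2 : ∀ i < N, t (i : ℕ) ≠ none) : IsWordOn t ((List.range (2 * S + 1)).filterMap fun j : ℕ =>
      if 0 ≤ (j : ℤ) - S ∧ (j : ℤ) - S < N then t (j - S) else none) := by
  have key : ∀ k : ℕ, k ≤ N → ((List.range (S + k)).filterMap fun j : ℕ =>
      if 0 ≤ (j : ℤ) - S ∧ (j : ℤ) - S < N then t (j - S) else none).length = k ∧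
      ∀ i < k, t i = ((List.range (S + k)).filterMap fun j : ℕ =>
      if 0 ≤ (j : ℤ) - S ∧ (j : ℤ) - S < N then t (j - S) else none)[i]? := by
    intro k
    induction k with
    | zero =>
      intro _
      simp only [List.length_eq_zero_iff, List.filterMap_eq_nil_iff, List.mem_range, add_zero]
      exact ⟨fun j hj => if_neg (by omega), fun i hi => absurd hi (by omega)⟩
    | succ k ih =>
      intro hk
      obtain ⟨h3, h4⟩ := ih (by omega)
      obtain ⟨b, hb⟩ := Option.ne_none_iff_exists'.1 (h2 k (by omega))
      have hc : 0 ≤ ((S + k : ℕ) : ℤ) - S ∧ ((S + k : ℕ) : ℤ) - S < N := by push_cast; omega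
      have hz : ((S + k : ℕ) : ℤ) - S = k := by push_cast; ring
      rw [← add_assoc, List.range_succ, List.filterMap_append]
      have h5 : ([S + k].filterMap fun j : ℕ =>
          if 0 ≤ (j : ℤ) - S ∧ (j : ℤ) - S < N then t (j - S) else none) = [b] := by
        rw [List.filterMap_cons, if_pos hc, hz, hb]; rfl
      rw [h5]
      refine ⟨by rw [List.length_append, h3]; rfl, fun i hi => ?_⟩
      rcases Nat.lt_succ_iff_lt_or_eq.1 hi with hi | rfl
      · rw [List.getElem?_append_left (by omega), h4 i hi]
      · rw [List.getElem?_append_right (by omega), h3, hb]; simp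
  obtain ⟨h3, h4⟩ := key N le_rfl
  have h5 : ∀ K, S + N ≤ K → ((List.range K).filterMap fun j : ℕ =>
      if 0 ≤ (j : ℤ) - S ∧ (j : ℤ) - S < N then t (j - S) else none) =
      (List.range (S + N)).filterMap fun j : ℕ =>
      if 0 ≤ (j : ℤ) - S ∧ (j : ℤ) - S < N then t (j - S) else none := by
    intro K hK
    obtain ⟨l, rfl⟩ := Nat.exists_eq_add_of_le hK
    rw [List.range_add, List.filterMap_append, List.filterMap_map]
    convert List.append_nil _
    rw [List.filterMap_eq_nil_iff]
    intro j _
    simp only [comp_apply]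
    exact if_neg (by push_cast; omega)
  rw [h5 _ (by omega)]
  intro i hi
  rw [h3] at hi
  rcases hi.eq_or_lt with rfl | hi
  · rw [h1, List.getElem?_eq_none (by omega)]
  · exact h4 i hi

theorem IsWordOn.unique {t : ℤ → Option Bool} {v w : Str} (hv : IsWordOn t v) (hw : IsWordOn t w) :
    v = w := by
  have key : ∀ {v w : Str}, IsWordOn t v → IsWordOn t w → v.length ≤ w.length := by
    intro v w hv hw
    by_contra h
    have h1 := hw w.length le_rfl
    rw [hv w.length (by omega), List.getElem?_eq_none le_rfl, List.getElem?_eq_none_iff] at h1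
    omega
  have hl : v.length = w.length := le_antisymm (key hv hw) (key hw hv)
  refine List.ext_getElem? fun i => ?_
  by_cases hi : i ≤ v.length
  · rw [← hv i hi, hw i (by omega)]
  · rw [List.getElem?_eq_none (by omega), List.getElem?_eq_none (by omega)]

/-- A sweep to the right writes, moves the heads that go to the right, and emits the word on the
query tape as it stood before the writing. -/
theorem foldl_right (y n : M.State) (w : M.Tp → Option Bool) (tape tape' : M.Tp → ℤ → Option Bool)
    (head head' : M.Tp → ℤ)
    (d : M.Tp → SignType) (S : ℕ) (h1 : ∀ i, |head i| ≤ S) (h2 : ∀ i, |head' i| ≤ S)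
    (h : ∀ i, head' i = head i + if d i = 1 then 1 else 0)
    (ht : ∀ i, tape' i = update (tape i) (head i) (w i)) (hq : tape .query (S + 1) = none) :
    ∃ ph e, IsWordOn (tape .query) e ∧ (cellsUp tape head S).foldl M.sweepAut.letterStep
      (.inr ⟨y, n, w, d, fun _ => false, none⟩, [], []) =
      (.inr ⟨y, n, w, d, fun _ => false, ph⟩, cellsDown tape' head' S, e.reverse) := by
  obtain ⟨N, hN, hN1, hN2⟩ := exists_query_word hq
  -- The phase is `none` up to the origin, then `some true` until the first blank, in cell `N`, has
  -- been read, and `some false` afterwards.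
  let st : ℕ → LeftSt M.State M.Tp ⊕ RightSt M.State M.Tp := fun j => .inr ⟨y, n, w, d,
    fun i => decide (d i = 1 ∧ head i = j - S - 1),
    if (j : ℤ) - S ≤ 0 then none else some (decide ((j : ℤ) - S ≤ N))⟩
  have h0 : ∀ i, -(S : ℤ) ≤ head i ∧ head i ≤ S := fun i => abs_le.1 (h1 i)
  have h0' : ∀ i, -(S : ℤ) ≤ head' i ∧ head' i ≤ S := fun i => abs_le.1 (h2 i)
  have hm : ∀ i (j : ℕ), (if d i = 1 then decide (d i = 1 ∧ head i = j - S - 1) else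
      decide (head i = j - S)) = decide (head' i = j - S) := by
    intro i j
    rw [h i]
    split_ifs with hd <;> simp [hd]
    omega
  have key := M.sweepAut.foldl_letterStep (st := st) (n := 2 * S + 1)
    (f := fun j : ℕ => cellAt tape head (j - S)) (g := fun j : ℕ => cellAt tape' head' (j - S))
    (em := fun j : ℕ => if 0 ≤ (j : ℤ) - S ∧ (j : ℤ) - S < N then tape .query (j - S) else none)
    fun j hj => by
      have hph : (if decide ((j : ℤ) - S = 0) = true then some true else
          if (j : ℤ) - S ≤ 0 then none else some (decide ((j : ℤ) - S ≤ N))) =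
          if 0 ≤ (j : ℤ) - S then some (decide ((j : ℤ) - S ≤ N)) else none := by
        split_ifs <;> simp_all <;> omega
      have hnone : ∀ z : ℤ, 0 ≤ z → z ≤ N → (tape .query z = none ↔ z = N) := by
        intro z hz hz'
        lift z to ℕ using hz
        constructor
        · intro h
          by_contra h'
          exact hN2 z (by omega) h
        · intro h
          rw [h, hN1]
      simp only [OracleTM.sweepAut, st, rightStep, cellAt, Prod.mk.injEq, Sum.inr.injEq,
        RightSt.mk.injEq, true_and, and_true, hm, hph]
      refine ⟨⟨funext fun i => ?_, ?_⟩, funext fun i => ?_, ?_⟩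
      · push_cast; split_ifs with hd <;> simp [hd]; omega
      · push_cast
        by_cases h3 : 0 ≤ (j : ℤ) - S
        · rw [if_pos h3, if_neg (by omega : ¬ (j : ℤ) + 1 - S ≤ 0)]
          by_cases h4 : (j : ℤ) - S ≤ N
          · simp only [h4, decide_true, true_and, hnone _ h3 h4]
            by_cases h5 : (j : ℤ) - S = N
            · rw [if_pos h5, decide_eq_false (by omega)]
            · rw [if_neg h5, decide_eq_true (by omega)]
          · rw [decide_eq_false h4, decide_eq_false (by omega)]
            simp
        · rw [if_neg h3, if_pos (by omega : (j : ℤ) + 1 - S ≤ 0)]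
          simp
      · rw [ht, update_apply]
        congr 1
        exact if_congr (by rw [decide_eq_true_eq, eq_comm]) rfl rfl
      · by_cases h3 : 0 ≤ (j : ℤ) - S
        · rw [if_pos h3]
          by_cases h4 : (j : ℤ) - S ≤ N
          · rw [decide_eq_true h4, if_pos rfl]
            by_cases h5 : (j : ℤ) - S = N
            · rw [if_neg (by omega), h5, hN1]
            · rw [if_pos (by omega)]
          · rw [decide_eq_false h4, if_neg (by simp),
              if_neg (by omega : ¬ (0 ≤ (j : ℤ) - S ∧ (j : ℤ) - S < N))]
        · rw [if_neg h3, if_neg (by simp), if_neg (by omega : ¬ (0 ≤ (j : ℤ) - S ∧ (j : ℤ) - S < N))]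
  have hst : st 0 = .inr ⟨y, n, w, d, fun _ => false, none⟩ := by
    simp only [st, Sum.inr.injEq, RightSt.mk.injEq, true_and, Nat.cast_zero]
    refine ⟨funext fun i => decide_eq_false fun h3 => ?_, if_pos (by omega)⟩
    have := h0 i; omega
  have hcy : (fun i => decide (d i = 1 ∧ head i = ((2 * S + 1 : ℕ) : ℤ) - S - 1)) = fun _ => false := by
    refine funext fun i => decide_eq_false fun h3 => ?_
    have h4 := h0' i
    have h5 := h i
    rw [if_pos h3.1] at h5
    push_cast at h3
    omega
  refine ⟨if ((2 * S + 1 : ℕ) : ℤ) - S ≤ 0 then none else some (decide (((2 * S + 1 : ℕ) : ℤ) - S ≤ N)),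
    _, isWordOn_filterMap hN hN1 hN2, ?_⟩
  rw [hst, show (List.range (2 * S + 1)).map (fun j : ℕ => cellAt tape' head' (j - S)) =
    cellsUp tape' head' S from rfl, reverse_cellsUp] at key
  rw [cellsUp, key]
  simp only [st, hcy]

end OracleSep

/-! ### Whole runs of the simulation. -/

namespace OracleSep
open Function
variable {m : ℕ} {M : OracleTM m} {A : Set Str}

/-- Two sweeps per step, and a last sweep to the left to discover the halting state. In between, the
marks stand at `head`, where the moves to the left are still pending; the invariant relates them to
the actual positions by `d`. -/
theorem sweepAut_verdict_of_cfg {S : ℕ} {b : Bool} (k : ℕ) (c : Cfg M.State M.Tp) (d : M.Tp → SignType)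
    (head : M.Tp → ℤ) (h1 : ∀ i, |head i| ≤ S) (h2 : ∀ i, c.head i = head i + if d i = -1 then -1 else 0)
    (h3 : ∀ t ≤ k, ∀ i, |((M.step A)^[t] c).head i| ≤ S) (hq : c.tape .query (S + 1) = none)
    (hb : M.act ((M.step A)^[k] c).state = .halt b) :
    M.sweepAut.verdict A (2 * k + 1) (.inl ⟨c.state, d, fun _ => false, fun _ => none⟩,
      cellsDown c.tape head S) = some b := by
  classical
  induction k generalizing c d head with
  | zero =>
    have e1 := foldl_left c.state c.tape head c.head d S h1 (h3 0 le_rfl) h2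
    simp only [iterate_zero_apply] at hb
    simp only [SweepAut.verdict, SweepAut.sweep, e1]
    simp only [OracleTM.sweepAut, OracleTM.plan, hb]
    rfl
  | succ k ih =>
    have e1 := foldl_left c.state c.tape head c.head d S h1 (h3 0 (Nat.zero_le _)) h2
    rw [show 2 * (k + 1) + 1 = 2 * k + 1 + 1 + 1 by ring]
    set sc : M.Tp → Option Bool := fun i => c.tape i (c.head i) with hsc
    have h3' : ∀ t ≤ k, ∀ i, |((M.step A)^[t] (M.step A c)).head i| ≤ S := fun t ht =>
      h3 (t + 1) (by omega)
    rcases hact : M.act c.state with b' | ⟨yes, no⟩ | δ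
    · rw [iterate_step_halt hact, hact] at hb
      rw [SweepAut.verdict, SweepAut.sweep, e1]
      simp only [OracleTM.sweepAut, OracleTM.plan, hact]
      cases hb; rfl
    · obtain ⟨ph, e, he, e2⟩ := foldl_right (M := M) yes no sc c.tape c.tape c.head c.head (fun _ => 0) S
        (h3 0 (Nat.zero_le _)) (h3 0 (Nat.zero_le _)) (by simp) (by simp [hsc]) hq
      have h5 : (∃ w ∈ A, IsWordOn (c.tape .query) w) ↔ e ∈ A :=
        ⟨fun ⟨w, hw, h⟩ => he.unique h ▸ hw, fun h => ⟨e, h, he⟩⟩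
      have hc := step_query (A := A) hact
      have := ih (M.step A c) (fun _ => 0) c.head (h3 0 (Nat.zero_le _)) (by simp [hc]) h3'
        (by rw [hc]; exact hq) hb
      rw [SweepAut.verdict, SweepAut.sweep, e1, SweepAut.verdict, SweepAut.sweep]
      simp only [OracleTM.sweepAut, OracleTM.plan, hact] at e2 this ⊢
      rw [e2]
      simp only [List.reverse_reverse, Option.none_or, decide_eq_true_eq]
      rw [hc] at this
      rw [← this]
      simp only [h5]
    · have hc := step_move (A := A) hact
      set r := δ sc with hr
      have hb1 : ∀ i, |c.head i + if r.2.2 i = 1 then 1 else 0| ≤ S := by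
        intro i
        have h4 := h3 0 (Nat.zero_le _) i
        have h5 := h3' 0 (Nat.zero_le _) i
        simp only [iterate_zero_apply, hc] at h4 h5
        split_ifs with h6
        · rw [h6] at h5; simpa using h5
        · simpa using h4
      obtain ⟨ph, e, he, e2⟩ := foldl_right (M := M) r.1 r.1 r.2.1 c.tape (M.step A c).tape c.head
        (fun i => c.head i + if r.2.2 i = 1 then 1 else 0) r.2.2 S
        (h3 0 (Nat.zero_le _)) hb1 (fun i => rfl) (by rw [hc]; exact fun i => rfl) hq
      have := ih (M.step A c) r.2.2 _ hb1 (fun i => by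
          simp only [hc]
          rcases r.2.2 i with _ | _ | _ <;> simp) h3' (by
        rw [hc]
        -- The query head is in a cell at most `S`, so the blank in cell `S + 1` survives the
        -- writing.
        have := abs_le.1 (h3 0 (Nat.zero_le _) .query)
        simp only [iterate_zero_apply] at this
        exact (update_of_ne (by omega) _ _).trans hq) hb
      rw [SweepAut.verdict, SweepAut.sweep, e1, SweepAut.verdict, SweepAut.sweep]
      simp only [OracleTM.sweepAut, OracleTM.plan, hact, ← hr] at e2 this ⊢
      rw [e2]
      simp only [Option.none_or, ite_self]
      have hst : (M.step A c).state = r.1 := by rw [hc]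
      rw [← hst]
      exact this

/-- The initial state of the simulating automaton. -/
def startSt (M : OracleTM m) : LeftSt M.State M.Tp ⊕ RightSt M.State M.Tp :=
  .inl ⟨M.start, fun _ => 0, fun _ => false, fun _ => none⟩

theorem sweepAut_verdict {xs : Fin m → Str} {S t : ℕ} {b : Bool}
    (h : ∀ t' ≤ t, ∀ i, |(M.cfgAt A xs t').head i| ≤ S) (hb : M.HaltsBy A xs t b) :
    M.sweepAut.verdict A (2 * t + 1) (startSt M, cellsDown (M.init xs).tape (fun _ => 0) S) = some b :=
  sweepAut_verdict_of_cfg t (M.init xs) _ _ (by simp) (by simp [OracleTM.init]) h rfl hb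

/-! ### The initial word -/

/-- The symbol with the given number. -/
def symOf : ℕ → Option Bool
  | 0 => none
  | 1 => some false
  | _ => some true

theorem symOf_symCode (a : Option Bool) : symOf (symCode a) = a := by
  rcases a with _ | _ | _ <;> rfl

theorem symCode_lt (a : Option Bool) : symCode a < 3 := by
  rcases a with _ | _ | _ <;> simp [symCode]

/-- The symbols of the several tracks are the ternary digits of the number of a cell, so a letter of
the initial word can be recovered from its number. -/
theorem cellCode_digit (xs : List Str) (z i : ℕ) (hi : i < xs.length) :
    cellCode xs z / 3 ^ i % 3 = symCode (xs[i])[z]? := by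
  induction xs generalizing i with
  | nil => simp at hi
  | cons x xs ih =>
    have h := symCode_lt x[z]?
    have h1 : cellCode (x :: xs) z = 3 * cellCode xs z + symCode x[z]? := rfl
    rw [h1]
    cases i with
    | zero => simp; omega
    | succ i =>
      rw [pow_succ', ← Nat.div_div_eq_div_mul, show (3 * cellCode xs z + symCode x[z]?) / 3 =
        cellCode xs z by omega, ih i (by simpa using hi)]
      rfl

theorem cellCode_lt (xs : List Str) (z : ℕ) : cellCode xs z < 3 ^ xs.length := by
  induction xs with
  | nil => simp [cellCode]
  | cons x xs ih =>
    have h := symCode_lt x[z]?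
    have h1 : cellCode (x :: xs) z = 3 * cellCode xs z + symCode x[z]? := rfl
    rw [h1, List.length_cons, pow_succ]
    omega

/-- The letter with the given number. -/
def letterOf (M : OracleTM m) (j : ℕ) : Cell M.Tp :=
  (fun i => (match i with
    | .input i => symOf (j / 2 / 3 ^ (i : ℕ) % 3)
    | _ => none, decide (j % 2 = 1)), decide (j % 2 = 1))

theorem cellAt_init_nat (xs : Fin m → Str) (z : ℕ) : cellAt (M.init xs).tape (fun _ => 0) z =
    letterOf M (2 * cellCode (List.ofFn xs) z + if z = 0 then 1 else 0) := by
  have h1 : (2 * cellCode (List.ofFn xs) z + if z = 0 then 1 else 0) / 2 = cellCode (List.ofFn xs) z := by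
    split_ifs <;> omega
  have h2 : (2 * cellCode (List.ofFn xs) z + if z = 0 then 1 else 0) % 2 = 1 ↔ z = 0 := by
    split_ifs with h <;> simp [h]
  have h3 : (0 : ℤ) = z ↔ z = 0 := by omega
  have h4 : (z : ℤ) = 0 ↔ z = 0 := by omega
  simp only [cellAt, letterOf, h1, h2, h3, h4, Prod.mk.injEq, and_true]
  funext i
  rcases i with i | i | _
  · have := cellCode_digit (List.ofFn xs) z i (by simp)
    simp only [this, symOf_symCode]
    simp [OracleTM.init, strTape]
  · rfl
  · rfl

theorem cellAt_init_neg (xs : Fin m → Str) (z : ℤ) (hz : z < 0) :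
    cellAt (M.init xs).tape (fun _ => 0) z = letterOf M 0 := by
  have h3 : ¬ (0 : ℤ) = z := by omega
  have h4 : ¬ (z : ℤ) = 0 := by omega
  simp only [cellAt, letterOf, h3, h4, Prod.mk.injEq]
  refine ⟨?_, by simp⟩
  funext i
  rcases i with i | i | _
  · simp [OracleTM.init, strTape, symOf, hz]
  · simp [OracleTM.init]
  · simp [OracleTM.init]

/-- Initially only the `m` input tracks carry symbols and all heads mark the origin, so the letters
that occur are among the `2 * 3 ^ m` values of `letterOf`; `tab` lists their codes with idle blocks.
-/
theorem exists_rep_initWord (M : OracleTM m) (enc : Cell M.Tp → Str) (B : ℕ) : ∃ tab : List Str,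
    ∀ (xs : Fin m → Str) (S : ℕ), Rep enc B (cellsDown (M.init xs).tape (fun _ => 0) S)
      (initWord tab (List.ofFn xs) S) := by
  let tab : List Str := (List.range (2 * 3 ^ m)).map fun j => enc (letterOf M j) ++ List.replicate B false
  have hblock : ∀ c o, 2 * c + o < 2 * 3 ^ m →
      block tab c o = enc (letterOf M (2 * c + o)) ++ (List.replicate B false ++ []) := by
    intro c o h
    simp [block, tab, h]
  have hrep : ∀ c o, 2 * c + o < 2 * 3 ^ m → Rep enc B [letterOf M (2 * c + o)] (block tab c o) := by
    intro c o h
    rw [hblock c o h]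
    exact .cons (by simp) .nil
  refine ⟨tab, fun xs S => ?_⟩
  have hcode : ∀ z, cellCode (List.ofFn xs) z < 3 ^ m := fun z => by
    simpa using cellCode_lt (List.ofFn xs) z
  have hpos : ∀ S : ℕ, Rep enc B ((List.range (S + 1)).map fun j : ℕ =>
      cellAt (M.init xs).tape (fun _ => 0) ((S : ℤ) - j)) (posWord tab (List.ofFn xs) S) := by
    intro S
    induction S with
    | zero =>
      have := hrep (cellCode (List.ofFn xs) 0) 1 (by have := hcode 0; omega)
      rw [posWord]
      convert this using 1
      have h0 := cellAt_init_nat (M := M) xs 0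
      simpa using h0
    | succ S ih =>
      rw [List.range_succ_eq_map, List.map_cons, List.map_map, posWord]
      refine .append (gs := [_]) ?_ ?_
      · have := hrep (cellCode (List.ofFn xs) (S + 1)) 0 (by have := hcode (S + 1); omega)
        convert this using 2
        have h0 := cellAt_init_nat (M := M) xs (S + 1)
        simpa using h0
      · convert ih using 3 with j
        simp only [comp_apply]
        congr 1
        push_cast
        ring
  have hneg : ∀ S : ℕ, Rep enc B (List.replicate S (letterOf M 0)) (negWord tab S) := by
    intro S
    induction S with
    | zero => exact .nil
    | succ S ih => exact .append (gs := [_]) (hrep 0 0 (by positivity)) ih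
  have hsplit : cellsDown (M.init xs).tape (fun _ => 0) S = ((List.range (S + 1)).map fun j : ℕ =>
      cellAt (M.init xs).tape (fun _ => 0) ((S : ℤ) - j)) ++ List.replicate S (letterOf M 0) := by
    rw [cellsDown, show 2 * S + 1 = (S + 1) + S by ring, List.range_add, List.map_append]
    congr 1
    rw [List.map_map, List.eq_replicate_iff]
    refine ⟨by simp, fun g hg => ?_⟩
    obtain ⟨j, -, rfl⟩ := List.mem_map.1 hg
    exact cellAt_init_neg xs _ (by push_cast; omega)
  rw [hsplit]
  exact (hpos S).append (hneg S)

instance {m k : ℕ} : Finite (TapeIx m k) :=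
  .of_injective (β := Fin m ⊕ Fin k ⊕ Unit)
    (fun | .input i => .inl i | .work i => .inr (.inl i) | .query => .inr (.inr ()))
    fun x y h => by rcases x <;> rcases y <;> simp_all

instance {Q T : Type} [Finite Q] [Finite T] : Finite (LeftSt Q T) :=
  .of_injective (fun s => (s.state, s.dir, s.carry, s.scan)) fun x y h => by
    cases x; cases y; simpa using h

instance {Q T : Type} [Finite Q] [Finite T] : Finite (RightSt Q T) :=
  .of_injective (fun s => (s.yes, s.no, s.write, s.dir, s.carry, s.phase)) fun x y h => by
    cases x; cases y; simpa using h

theorem exists_sweeping (M : OracleTM m) : ∃ tab P, ∀ A xs (S t : ℕ) b,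
    (∀ t' ≤ t, ∀ i, |(M.cfgAt A xs t').head i| ≤ S) → M.HaltsBy A xs t b →
    verdict A P (2 * t + 1) (0, initWord tab (List.ofFn xs) S) = some b := by
  have := M.finite_state
  have : Nonempty (Cell M.Tp) := ⟨letterOf M 0⟩
  obtain ⟨P, B, enc, h⟩ := exists_sweep_table M.sweepAut (startSt M)
  obtain ⟨tab, htab⟩ := exists_rep_initWord M enc B
  refine ⟨tab, P, fun A xs S t b h1 h2 => ?_⟩
  rw [h A _ _ _ (htab xs S)]
  exact sweepAut_verdict h1 h2

theorem verdict_mono {P : Str} {T T' : ℕ} {c : ℕ × Str} {b : Bool} (h : verdict A P T c = some b)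
    (hT : T ≤ T') : verdict A P T' c = some b := by
  induction T generalizing c T' with
  | zero => simp [verdict] at h
  | succ T ih =>
    obtain ⟨T', rfl⟩ : ∃ T'', T' = T'' + 1 := ⟨T' - 1, by omega⟩
    rw [verdict] at h ⊢
    cases h1 : (sweep A P c).1 with
    | none =>
      rw [h1] at h
      exact ih h (by omega)
    | some b' =>
      rw [h1] at h
      exact h

/-- The iterates of the configuration do not involve `T`, which makes runs with different time
limits comparable. -/
theorem verdict_eq_some_iff {P : Str} {T : ℕ} {c : ℕ × Str} {b : Bool} :
    verdict A P T c = some b ↔ ∃ j < T, (sweep A P ((fun c => (sweep A P c).2)^[j] c)).1 = some b ∧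
      ∀ i < j, (sweep A P ((fun c => (sweep A P c).2)^[i] c)).1 = none := by
  induction T generalizing c with
  | zero => simp [verdict]
  | succ T ih =>
    rw [verdict]
    cases h1 : (sweep A P c).1 with
    | none =>
      rw [Option.none_or, ih]
      constructor
      · rintro ⟨j, hj, h2, h3⟩
        refine ⟨j + 1, by omega, h2, fun i hi => ?_⟩
        cases i with
        | zero => exact h1
        | succ i => exact h3 i (by omega)
      · rintro ⟨j, hj, h2, h3⟩
        cases j with
        | zero => rw [iterate_zero_apply, h1] at h2; cases h2
        | succ j => exact ⟨j, by omega, h2, fun i hi => h3 (i + 1) (by omega)⟩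
    | some b' =>
      rw [Option.some_or]
      constructor
      · intro h
        exact ⟨0, by omega, h1.trans h, fun i hi => absurd hi (Nat.not_lt_zero i)⟩
      · rintro ⟨j, hj, h2, h3⟩
        cases j with
        | zero => exact h1.symm.trans h2
        | succ j =>
          have := h3 0 (by omega)
          rw [iterate_zero_apply, h1] at this; cases this

/-- Before the verdict no configuration is repeated, and there are at most `(|P| + 1) 2 ^ |w| ≤ 2 ^
(|P| + |w|)` of them. -/
theorem verdict_two_pow {P w : Str} {T : ℕ} {b : Bool} (h : verdict A P T (0, w) = some b) :
    verdict A P (2 ^ (P.length + w.length + 1) - 1) (0, w) = some b := by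
  obtain ⟨j, -, h1, h2⟩ := verdict_eq_some_iff.1 h
  refine verdict_eq_some_iff.2 ⟨j, ?_, h1, h2⟩
  set F : ℕ × Str → ℕ × Str := fun c => (sweep A P c).2 with hF
  have hmem : ∀ i, (F^[i] (0, w)).1 ≤ P.length ∧ (F^[i] (0, w)).2.length = w.length := by
    intro i
    induction i with
    | zero => exact ⟨Nat.zero_le _, rfl⟩
    | succ i ih =>
      rw [iterate_succ_apply']
      exact ⟨sweep_fst_le _ _, (sweep_length _ _).trans ih.2⟩
  -- After a repetition the configuration with the verdict would have occurred already at an earlier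
  -- time, at which there was none.
  have hinj : ∀ i i', i < i' → i' ≤ j → F^[i] (0, w) ≠ F^[i'] (0, w) := by
    intro i i' h3 h4 h5
    have h6 : F^[j] (0, w) = F^[j - i' + i] (0, w) := by
      rw [iterate_add_apply, h5, ← iterate_add_apply, Nat.sub_add_cancel h4]
    have h7 := h2 (j - i' + i) (by omega)
    rw [← h6, h1] at h7
    cases h7
  let f : Fin (j + 1) → Fin (P.length + 1) × List.Vector Bool w.length := fun i =>
    (⟨(F^[i] (0, w)).1, Nat.lt_succ_of_le (hmem i).1⟩, ⟨(F^[i] (0, w)).2, (hmem i).2⟩)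
  have hf : Injective f := by
    intro i i' h3
    have h4 : F^[i] (0, w) = F^[i'] (0, w) :=
      Prod.ext (congrArg (fun x => (x.1 : ℕ)) h3) (congrArg (fun x => x.2.1) h3)
    rcases lt_trichotomy (i : ℕ) i' with h5 | h5 | h5
    · exact absurd h4 (hinj _ _ h5 (by omega))
    · exact Fin.ext h5
    · exact absurd h4.symm (hinj _ _ h5 (by omega))
  have hcard := Fintype.card_le_of_injective f hf
  rw [Fintype.card_fin, Fintype.card_prod, Fintype.card_fin, card_vector, Fintype.card_bool] at hcard
  have h3 : P.length + 1 ≤ 2 ^ P.length := Nat.lt_two_pow_self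
  have h4 : (P.length + 1) * 2 ^ w.length ≤ 2 ^ (P.length + w.length) := by
    rw [pow_add]; exact Nat.mul_le_mul_right _ h3
  have h5 := Nat.one_le_two_pow (n := P.length + w.length)
  rw [pow_succ]
  omega

theorem abs_head_le (xs : Fin m → Str) (t : ℕ) (i) : |(M.cfgAt A xs t).head i| ≤ t := by
  induction t with
  | zero => simp [OracleTM.cfgAt, OracleTM.init]
  | succ t ih =>
    have h : M.cfgAt A xs (t + 1) = M.step A (M.cfgAt A xs t) := iterate_succ_apply' _ _ _
    have h1 := abs_le.1 ih
    rw [abs_le, h]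
    push_cast
    rcases hact : M.act (M.cfgAt A xs t).state with b' | ⟨yes, no⟩ | δ
    · rw [step_halt hact]; omega
    · rw [step_query hact]; simp only; omega
    · rw [step_move hact]
      simp only
      rcases (δ fun i => (M.cfgAt A xs t).tape i ((M.cfgAt A xs t).head i)).2.2 i with _ | _ | _ <;>
        simp <;> omega

/-- The normal form of the relations that are decidable in polynomial time. -/
theorem exists_sweepRel {R : (Fin m → Str) → Prop} (h : PolyTimeRel A R) :
    ∃ tab P c, ∀ xs, SweepRel A tab P c (List.ofFn xs) ↔ R xs := by
  obtain ⟨M, c0, h⟩ := h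
  obtain ⟨tab, P, hP⟩ := exists_sweeping M
  -- One exponent for both purposes: the number of sweeps, and the cells, since in `t` steps no head
  -- gets further than `t`.
  obtain ⟨c, hc⟩ : PolyBdd fun n => 2 * (n ^ c0 + c0) + 1 :=
    ((PolyBdd.const 2).mul ⟨c0, fun n => le_rfl⟩).add (.const 1)
  refine ⟨tab, P, c, fun xs => ?_⟩
  obtain ⟨b, h1, h2⟩ := h xs
  have hN : ((List.ofFn xs).map List.length).sum = ∑ i, (xs i).length := by
    rw [List.map_ofFn, List.sum_ofFn]; rfl
  have h3 := hc (∑ i, (xs i).length)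
  have h4 := hP A xs (clockBound c (List.ofFn xs)) _ b (fun t' ht i => (abs_head_le xs t' i).trans (by
    rw [clockBound, hN]; simp only at h3; exact_mod_cast (by omega))) h1
  have h5 := verdict_mono h4 (T' := clockBound c (List.ofFn xs)) (by rw [clockBound, hN]; exact h3)
  rw [SweepRel, h5, ← h2]
  simp

/-- Every language in `PSPACE` can be reduced to `univ A`. -/
theorem exists_reduction_univ {L : Set Str} (h : L ∈ PSPACE A) : ∃ tab P c, ∀ y,
    pad P (initWord tab [y] (y.length ^ c + c)) ∈ univ A ↔ y ∈ L := by
  obtain ⟨M, c, h⟩ := h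
  obtain ⟨tab, P, hP⟩ := exists_sweeping M
  refine ⟨tab, P, c, fun y => ?_⟩
  obtain ⟨h1, t, b, h2, h3⟩ := h y
  have h4 := verdict_two_pow (hP A _ _ t b (fun t' _ i => h1 t' i) h2)
  simp only [univ, Set.mem_ofPred_eq, parse_pad, ← h3]
  simp only [List.ofFn_succ, List.ofFn_zero] at h4
  rw [h4]
  simp

end OracleSep

namespace OracleSep
open Function
variable {A : Set Str}

/-! ### The criterion for the collapse -/

theorem altQuant_congr {M l : ℕ} {ex : Bool} {R R' : (Fin l → Str) → Prop} (h : ∀ xs, R xs ↔ R' xs) :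
    AltQuant M l ex R ↔ AltQuant M l ex R' := by
  rw [show R = R' from funext fun xs => propext (h xs)]

/-- Truncation maps the strings of length at most `M'` onto those of length at most `M`, so a
quantifier bound may be raised if the matrix truncates its arguments. -/
theorem altQuant_take {M M' : ℕ} (hM : M ≤ M') (l : ℕ) (ex : Bool) (R : (Fin l → Str) → Prop) :
    AltQuant M l ex R ↔ AltQuant M' l ex fun xs => R fun i => (xs i).take M := by
  induction l generalizing ex with
  | zero =>
    simp only [AltQuant]
    rw [show (fun i : Fin 0 => (Fin.elim0 i : Str).take M) = Fin.elim0 from funext fun i => i.elim0]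
  | succ l ih =>
    have key : ∀ (ex : Bool) (x : Str), AltQuant M l ex (fun xs => R (Fin.cons (x.take M) xs)) ↔
        AltQuant M' l ex fun xs => R fun i => ((Fin.cons x xs : Fin (l + 1) → Str) i).take M := by
      intro ex x
      rw [ih]
      refine altQuant_congr fun xs => ?_
      rw [show (fun i => ((Fin.cons x xs : Fin (l + 1) → Str) i).take M) =
        Fin.cons (x.take M) fun i => (xs i).take M from ?_]
      funext i
      refine Fin.cases ?_ (fun i => ?_) i <;> simp
    have htake : ∀ x : Str, x.length ≤ M → x.take M = x := fun x hx => List.take_of_length_le hx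
    cases ex
    · simp only [AltQuant, ← key]
      exact ⟨fun h x _ => h _ (by simp), fun h x hx => by
        have := h x (hx.trans hM); rwa [htake x hx] at this⟩
    · simp only [AltQuant, ← key]
      exact ⟨fun ⟨x, hx, h⟩ => ⟨x, hx.trans hM, by rwa [htake x hx]⟩,
        fun ⟨x, _, h⟩ => ⟨_, by simp, h⟩⟩

theorem altQuant_cons_iff_altList (M l : ℕ) (ex : Bool) (Q : List Str → Prop) (y : Str) :
    AltQuant M l ex (fun xs => Q (List.ofFn (Fin.cons y xs : Fin (l + 1) → Str))) ↔
      AltList M Q l ex [y] := by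
  rw [← altQuant_iff_altList]
  refine altQuant_congr fun xs => ?_
  simp

/-- The data on the right are finite objects of encodable types and do not depend on the oracle;
this makes the quantifier over formulas a number quantifier. -/
theorem mem_PH_iff {L : Set Str} : L ∈ PH A ↔ ∃ (tab : List Str) (P : Str) (c l k : ℕ),
    ∀ y, y ∈ L ↔ AltList (y.length ^ k + k) (SweepRel A tab P c) l true [y] := by
  constructor
  · rintro ⟨l, k, R, hR, h⟩
    obtain ⟨tab, P, c, h'⟩ := exists_sweepRel hR
    refine ⟨tab, P, c, l, k, fun y => ?_⟩
    rw [h, ← altQuant_cons_iff_altList]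
    exact altQuant_congr fun xs => (h' _).symm
  · rintro ⟨tab, P, c, l, k, h⟩
    refine ⟨l, k, _, polyTimeRel_sweepRel A tab P c (l + 1), fun y => ?_⟩
    rw [h, ← altQuant_cons_iff_altList]

theorem PH_subset_PSPACE (A : Set Str) : PH A ⊆ PSPACE A := by
  intro L h
  obtain ⟨tab, P, c, l, k, h⟩ := mem_PH_iff.1 h
  rw [show L = {y | AltList (y.length ^ k + k) (SweepRel A tab P c) l true [y]} from Set.ext h]
  exact mem_pspace_of_altList A tab P c l k

/-- The formula for `univ A` is applied to the padded string of the reduction, which is computed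
inside the matrix, so the number of quantifiers does not change. -/
theorem PSPACE_subset_PH (h : univ A ∈ PH A) : PSPACE A ⊆ PH A := by
  intro L hL
  obtain ⟨tab', P', c', l, k', h⟩ := mem_PH_iff.1 h
  obtain ⟨tab, P, k, hred⟩ := exists_reduction_univ hL
  let f : Str → Str := fun y => pad P (initWord tab [y] (y.length ^ k + k))
  -- The formula bounds its quantifiers in terms of the padded string; `k''` bounds them in terms of
  -- `y`.
  obtain ⟨k'', hk⟩ : PolyBdd fun n =>
      (2 * P.length + 2 * ((2 * (n ^ k + k) + 1) * maxBlock tab)) ^ k' + k' := by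
    have id := PolyBdd.id'
    have cc := fun a => PolyBdd.const a
    repeat first
      | exact cc _
      | exact id
      | refine PolyBdd.add ?_ ?_
      | refine PolyBdd.mul ?_ ?_
      | refine PolyBdd.pow ?_ _
  have hlen : ∀ y, (f y).length ^ k' + k' ≤ y.length ^ k'' + k'' := by
    intro y
    refine le_trans ?_ (hk y.length)
    have h1 := length_initWord_le tab [y] (y.length ^ k + k)
    have h2 : (f y).length = 2 * P.length + 2 * (initWord tab [y] (y.length ^ k + k)).length := by
      simp [f, pad]; omega
    refine Nat.add_le_add_right (Nat.pow_le_pow_left ?_ _) _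
    omega
  refine ⟨l, k'', _, polyTimeRel_pad A tab tab' P P' k k' c' l, fun y => ?_⟩
  rw [← hred, h, ← altQuant_cons_iff_altList, altQuant_take (hlen y)]
  refine altQuant_congr fun xs => ?_
  simp [f]

/-- The criterion: `PH` and `PSPACE` differ if and only if no formula of the polynomial hierarchy in normal
form defines the complete language. -/
theorem PH_ne_PSPACE_iff : PH A ≠ PSPACE A ↔ ∀ (tab : List Str) (P : Str) (c l k : ℕ), ∃ y,
    ¬ (y ∈ univ A ↔ AltList (y.length ^ k + k) (SweepRel A tab P c) l true [y]) := by
  rw [← not_iff_not]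
  push Not
  rw [← mem_PH_iff]
  exact ⟨fun h => h ▸ univ_mem_pspace A, fun h => (PH_subset_PSPACE A).antisymm (PSPACE_subset_PH h)⟩

end OracleSep

namespace OracleSep
open Function

/-! ### Primitive recursive evaluation with finite oracles -/

section primrec

variable {α : Type*} [Primcodable α]

theorem primrec_pow : Primrec₂ ((· ^ ·) : ℕ → ℕ → ℕ) := Primrec₂.unpaired'.1 Nat.Primrec.pow

theorem primrecRel_mem : PrimrecRel fun (u : Str) (O : List Str) => u ∈ O :=
  ((PrimrecRel.exists_mem_list (Primrec.eq (α := Str))).swap).of_eq fun u O => by simp [swap]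

theorem primrec_skipEntry : Primrec skipEntry :=
  Primrec.list_drop.comp (.const 4) (Primrec.list_dropWhile .id)

theorem primrec_readEntry : Primrec readEntry := by
  have h : ∀ i : ℕ, Primrec fun l : Str => ((l.dropWhile id)[i]?).getD false := fun i =>
    Primrec.option_getD.comp (Primrec.list_getElem?.comp (Primrec.list_dropWhile .id) (.const i))
      (.const false)
  exact (Primrec.list_length.comp (Primrec.list_takeWhile .id)).pair ((h 1).pair ((h 2).pair (h 3)))

theorem primrec_entry : Primrec₂ entry :=
  primrec_readEntry.comp (Primrec.nat_iterate .snd .fst (primrec_skipEntry.comp .snd).to₂)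

theorem primrec_bitStep : Primrec fun a : Str × (ℕ × Str × Str) × Bool => bitStep a.1 a.2.1 a.2.2 := by
  have he : Primrec fun a : Str × (ℕ × Str × Str) × Bool => entry a.1 (a.2.1.1 + a.2.2.toNat) :=
    primrec_entry.comp .fst (Primrec.nat_add.comp (Primrec.fst.comp (Primrec.fst.comp .snd))
      ((Primrec.dom_bool Bool.toNat).comp (Primrec.snd.comp .snd)))
  have h2 : Primrec fun a : Str × (ℕ × Str × Str) × Bool => a.2.1.2.2 :=
    Primrec.snd.comp (Primrec.snd.comp (Primrec.fst.comp .snd))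
  refine (Primrec.fst.comp he).pair ((Primrec.list_cons.comp (Primrec.fst.comp (Primrec.snd.comp he))
    (Primrec.fst.comp (Primrec.snd.comp (Primrec.fst.comp .snd)))).pair ?_)
  refine (Primrec.cond (Primrec.fst.comp (Primrec.snd.comp (Primrec.snd.comp he)))
    (Primrec.list_cons.comp (Primrec.snd.comp (Primrec.snd.comp (Primrec.snd.comp he))) h2) h2).of_eq
    fun a => ?_
  cases h : (entry a.1 (a.2.1.1 + a.2.2.toNat)).2.2.1 <;> simp

theorem primrec_passOver : Primrec fun a : Str × ℕ × Str => passOver a.1 a.2 :=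
  Primrec.list_foldl (Primrec.snd.comp .snd)
    ((Primrec.fst.comp .snd).pair (.const ([], [])))
    (primrec_bitStep.comp ((Primrec.fst.comp .fst).pair .snd)).to₂

theorem primrec_sweep :
    Primrec fun a : List Str × Str × ℕ × Str => sweep {x | x ∈ a.1} a.2.1 a.2.2 := by
  classical
  have hp : Primrec fun a : List Str × Str × ℕ × Str => passOver a.2.1 a.2.2 :=
    primrec_passOver.comp .snd
  have hm : PrimrecPred fun a : List Str × Str × ℕ × Str => (passOver a.2.1 a.2.2).2.2.reverse ∈ a.1 :=
    primrecRel_mem.comp (Primrec.list_reverse.comp (Primrec.snd.comp (Primrec.snd.comp hp))) .fst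
  have he : Primrec fun a : List Str × Str × ℕ × Str => entry a.2.1 ((passOver a.2.1 a.2.2).1 +
      if (passOver a.2.1 a.2.2).2.2.reverse ∈ a.1 then 3 else 2) :=
    primrec_entry.comp (Primrec.fst.comp .snd) (Primrec.nat_add.comp (Primrec.fst.comp hp)
      (Primrec.ite hm (.const 3) (.const 2)))
  refine (Primrec.pair (Primrec.cond (Primrec.fst.comp (Primrec.snd.comp he))
    (Primrec.option_some.comp (Primrec.fst.comp (Primrec.snd.comp (Primrec.snd.comp he))))
    (.const none)) ((Primrec.fst.comp he).pair (Primrec.fst.comp (Primrec.snd.comp hp)))).of_eq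
    fun a => ?_
  simp only [sweep, Set.mem_ofPred_eq, Bool.cond_eq_ite]
  congr!

/-- The configuration changes in the recursive call, so plain recursion on the number of sweeps does
not apply. `Primrec.nat_omega_rec'` is used, with that number as the measure and at most one
recursive call. -/
theorem primrec_verdict : Primrec fun a : List Str × Str × ℕ × ℕ × Str =>
    verdict {x | x ∈ a.1} a.2.1 a.2.2.1 a.2.2.2 := by
  have hs : Primrec fun a : List Str × Str × ℕ × ℕ × Str => sweep {x | x ∈ a.1} a.2.1 a.2.2.2 :=
    have h : Primrec fun a : List Str × Str × ℕ × ℕ × Str => (a.1, a.2.1, a.2.2.2) :=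
      Primrec.fst.pair ((Primrec.fst.comp .snd).pair (Primrec.snd.comp (Primrec.snd.comp .snd)))
    (primrec_sweep.comp h :)
  have hT : Primrec fun a : List Str × Str × ℕ × ℕ × Str => a.2.2.1 :=
    Primrec.fst.comp (Primrec.snd.comp .snd)
  have hp : Primrec fun p : (List Str × Str × ℕ × ℕ × Str) × ℕ =>
      (p.1.1, p.1.2.1, p.2, (sweep {x | x ∈ p.1.1} p.1.2.1 p.1.2.2.2).2) :=
    (Primrec.fst.comp .fst).pair ((Primrec.fst.comp (Primrec.snd.comp .fst)).pair
      (Primrec.snd.pair (Primrec.snd.comp (hs.comp .fst))))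
  have hl : Primrec fun a : List Str × Str × ℕ × ℕ × Str => Nat.casesOn (motive := fun _ =>
      List (List Str × Str × ℕ × ℕ × Str)) a.2.2.1 []
      fun T => [(a.1, a.2.1, T, (sweep {x | x ∈ a.1} a.2.1 a.2.2.2).2)] :=
    Primrec.nat_casesOn hT (.const []) (Primrec.list_cons.comp hp (.const [])).to₂
  have hg : Primrec₂ fun (a : List Str × Str × ℕ × ℕ × Str) (r : List (Option Bool)) =>
      some (Nat.casesOn (motive := fun _ => Option Bool) a.2.2.1 none
        fun _ => (sweep {x | x ∈ a.1} a.2.1 a.2.2.2).1 <|> (r.head?).getD none) :=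
    Primrec.option_some.comp₂ (Primrec.nat_casesOn (hT.comp .fst) (.const none)
      (Primrec.option_orElse.comp (Primrec.fst.comp (hs.comp (Primrec.fst.comp .fst)))
        (Primrec.option_getD.comp (Primrec.list_head?.comp (Primrec.snd.comp .fst)) (.const none))).to₂)
  refine Primrec.nat_omega_rec' _ hT hl hg ?_ ?_
  · rintro ⟨O, P, _ | T, c⟩ b hb <;> simp at hb
    simp [hb]
  · rintro ⟨O, P, _ | T, c⟩ <;> simp [verdict]

/-- The strings of length at most `M`. -/
def allStrs : ℕ → List Str
  | 0 => [[]]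
  | M + 1 => [] :: (allStrs M).flatMap fun u => [false :: u, true :: u]

theorem mem_allStrs {M : ℕ} {u : Str} : u ∈ allStrs M ↔ u.length ≤ M := by
  induction M generalizing u with
  | zero => simp [allStrs]
  | succ M ih =>
    rcases u with _ | ⟨b, u⟩
    · simp [allStrs]
    · cases b <;> simp [allStrs, ih]

theorem primrec_allStrs : Primrec allStrs := by
  refine (Primrec.nat_rec₁ (f := fun _ (L : List Str) => [] :: L.flatMap fun u => [false :: u, true :: u])
    [[]] ?_).of_eq fun M => ?_
  · have h := fun b : Bool => Primrec.list_cons.comp (.const b)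
      (Primrec.snd (α := ℕ × List Str) (β := Str))
    have h' : Primrec₂ fun (_ : ℕ × List Str) (u : Str) => [false :: u, true :: u] :=
      Primrec.list_cons.comp (h false) (Primrec.list_cons.comp (h true) (.const []))
    exact Primrec.list_cons.comp (.const []) (Primrec.list_flatMap .snd h')
  · induction M with
    | zero => rfl
    | succ M ih => simp only [allStrs, ← ih]

/-- Recursion over the quantifier tree: the recursive calls at a node are the instances for all
strings of `allStrs`, and their truth values are combined according to the quantifier. -/
theorem primrecPred_altList {M : α → ℕ} {Q : α → List Str → Prop} (hM : Primrec M) (hQ : PrimrecRel Q) :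
    PrimrecPred fun a : α × ℕ × Bool × List Str => AltList (M a.1) (Q a.1) a.2.1 a.2.2.1 a.2.2.2 := by
  classical
  refine Primrec.primrecPred ?_
  have hl : Primrec fun a : α × ℕ × Bool × List Str => a.2.1 := Primrec.fst.comp .snd
  have hx : Primrec fun a : α × ℕ × Bool × List Str => a.2.2.1 :=
    Primrec.fst.comp (Primrec.snd.comp .snd)
  have hxs : Primrec fun a : α × ℕ × Bool × List Str => a.2.2.2 :=
    Primrec.snd.comp (Primrec.snd.comp .snd)
  have hc : Primrec fun a : α × ℕ × Bool × List Str => Nat.casesOn (motive := fun _ =>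
      List (α × ℕ × Bool × List Str)) a.2.1 []
      fun l => (allStrs (M a.1)).map fun u => (a.1, l, !a.2.2.1, a.2.2.2 ++ [u]) :=
    Primrec.nat_casesOn hl (.const []) (Primrec.list_map
      (primrec_allStrs.comp (hM.comp (Primrec.fst.comp .fst)))
      ((Primrec.fst.comp (Primrec.fst.comp .fst)).pair ((Primrec.snd.comp .fst).pair
        ((Primrec.not.comp (hx.comp (Primrec.fst.comp .fst))).pair
        (Primrec.list_concat.comp (hxs.comp (Primrec.fst.comp .fst)) .snd)))).to₂).to₂
  have hg : Primrec₂ fun (a : α × ℕ × Bool × List Str) (r : List Bool) =>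
      some (Nat.casesOn (motive := fun _ => Bool) a.2.1 (decide (Q a.1 a.2.2.2))
        fun _ => bif a.2.2.1 then decide (∃ b ∈ r, b = true) else decide (∀ b ∈ r, b = true)) := by
    have e1 : PrimrecPred fun r : List Bool => ∃ b ∈ r, b = true :=
      PrimrecPred.exists_mem_list (Primrec.primrecPred (p := fun b : Bool => b = true)
        (Primrec.dom_bool _))
    have e2 : PrimrecPred fun r : List Bool => ∀ b ∈ r, b = true :=
      PrimrecPred.forall_mem_list (Primrec.primrecPred (p := fun b : Bool => b = true)
        (Primrec.dom_bool _))
    exact Primrec.option_some.comp₂ (Primrec.nat_casesOn (hl.comp .fst)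
      ((hQ.comp (Primrec.fst.comp .fst) (hxs.comp .fst)).decide)
      (Primrec.cond (hx.comp (Primrec.fst.comp .fst))
        (e1.decide.comp (Primrec.snd.comp .fst)) (e2.decide.comp (Primrec.snd.comp .fst))).to₂)
  refine Primrec.nat_omega_rec' _ hl hc hg ?_ ?_
  · rintro ⟨a, _ | l, x, xs⟩ b hb <;> simp at hb
    obtain ⟨u, -, rfl⟩ := hb
    simp
  · rintro ⟨a, _ | l, _ | _, xs⟩ <;> simp [AltList, mem_allStrs] <;> exact decide_eq_decide.2 Iff.rfl

theorem primrec_sum : Primrec fun xs : List Str => (xs.map List.length).sum := by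
  refine (Primrec.list_foldr (f := fun xs : List Str => xs) (g := fun _ => 0)
    (h := fun _ (p : Str × ℕ) => p.1.length + p.2) .id (.const 0)
    (Primrec.nat_add.comp (Primrec.list_length.comp (Primrec.fst.comp .snd))
      (Primrec.snd.comp .snd)).to₂).of_eq fun xs => ?_
  induction xs with
  | nil => rfl
  | cons x xs ih => simp_all

theorem primrec_cellCode : Primrec₂ cellCode := by
  have hs : Primrec symCode := Primrec.dom_finite _
  exact Primrec.list_foldr .fst (.const 0) (Primrec.nat_add.comp
    (Primrec.nat_mul.comp (.const 3) (Primrec.snd.comp .snd))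
    (hs.comp (Primrec.list_getElem?.comp (Primrec.fst.comp .snd) (Primrec.snd.comp .fst)))).to₂

theorem primrec_block : Primrec fun a : List Str × ℕ × ℕ => block a.1 a.2.1 a.2.2 :=
  Primrec.option_getD.comp (Primrec.list_getElem?.comp .fst (Primrec.nat_add.comp
    (Primrec.nat_mul.comp (.const 2) (Primrec.fst.comp .snd)) (Primrec.snd.comp .snd))) (.const [])

theorem primrec_initWord :
    Primrec fun a : List Str × List Str × ℕ => initWord a.1 a.2.1 a.2.2 := by
  have ht : Primrec fun a : (List Str × List Str × ℕ) × ℕ × Str => a.1.1 := Primrec.fst.comp .fst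
  have hn : Primrec fun a : List Str × List Str × ℕ => a.2.2 := Primrec.snd.comp .snd
  have h1 : Primrec fun a : List Str × List Str × ℕ => posWord a.1 a.2.1 a.2.2 := by
    refine (Primrec.nat_rec' hn (g := fun a => block a.1 (cellCode a.2.1 0) 1)
      (h := fun a p => block a.1 (cellCode a.2.1 (p.1 + 1)) 0 ++ p.2)
      (primrec_block.comp (Primrec.fst.pair ((primrec_cellCode.comp (Primrec.fst.comp .snd)
        (.const 0)).pair (.const 1))))
      (Primrec.list_append.comp (primrec_block.comp (ht.pair ((primrec_cellCode.comp
        (Primrec.fst.comp (Primrec.snd.comp .fst)) (Primrec.succ.comp (Primrec.fst.comp .snd))).pair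
        (.const 0)))) (Primrec.snd.comp .snd)).to₂).of_eq fun a => ?_
    obtain ⟨tab, xs, S⟩ := a
    induction S with
    | zero => rfl
    | succ S ih => simp_all [posWord]
  have h2 : Primrec fun a : List Str × List Str × ℕ => negWord a.1 a.2.2 := by
    refine (Primrec.nat_rec' hn (g := fun _ => ([] : Str)) (h := fun a p => block a.1 0 0 ++ p.2)
      (.const [])
      (Primrec.list_append.comp (primrec_block.comp (ht.pair ((Primrec.const 0).pair (.const 0))))
        (Primrec.snd.comp .snd)).to₂).of_eq fun a => ?_
    obtain ⟨tab, xs, S⟩ := a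
    simp only
    induction S with
    | zero => rfl
    | succ S ih => simp_all [negWord]
  exact Primrec.list_append.comp h1 h2

theorem primrec_clockBound : Primrec₂ clockBound :=
  Primrec.nat_add.comp (primrec_pow.comp (primrec_sum.comp .snd) .fst) .fst

theorem primrecPred_sweepRel : PrimrecPred fun a : List Str × List Str × Str × ℕ × List Str =>
    SweepRel {x | x ∈ a.1} a.2.1 a.2.2.1 a.2.2.2.1 a.2.2.2.2 := by
  have hS : Primrec fun a : List Str × List Str × Str × ℕ × List Str =>
      clockBound a.2.2.2.1 a.2.2.2.2 := primrec_clockBound.comp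
    (Primrec.fst.comp (Primrec.snd.comp (Primrec.snd.comp .snd)))
    (Primrec.snd.comp (Primrec.snd.comp (Primrec.snd.comp .snd)))
  exact Primrec.eq.comp (primrec_verdict.comp (Primrec.fst.pair
    ((Primrec.fst.comp (Primrec.snd.comp .snd)).pair (hS.pair ((Primrec.const 0).pair
    (primrec_initWord.comp ((Primrec.fst.comp .snd).pair
      ((Primrec.snd.comp (Primrec.snd.comp (Primrec.snd.comp .snd))).pair hS)))))))) (.const (some true))

/-- A left fold that remembers a pending flag; a flag left over at the end is dropped, as in
`parse`. -/
theorem primrec_parse : Primrec fun y : Str => parse y ([], []) := by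
  let F : Option Bool × Str × Str → Bool → Option Bool × Str × Str := fun s b =>
    Option.casesOn (motive := fun _ => Option Bool × Str × Str) s.1 (some b, s.2) fun f =>
      bif f then (none, b :: s.2.1, s.2.2) else (none, s.2.1, b :: s.2.2)
  have hF : Primrec₂ F := by
    have hb : Primrec fun p : ((Option Bool × Str × Str) × Bool) × Bool => p.1.2 :=
      Primrec.snd.comp .fst
    have h1 : Primrec fun p : ((Option Bool × Str × Str) × Bool) × Bool => p.1.1.2.1 :=
      Primrec.fst.comp (Primrec.snd.comp (Primrec.fst.comp .fst))
    have h2 : Primrec fun p : ((Option Bool × Str × Str) × Bool) × Bool => p.1.1.2.2 :=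
      Primrec.snd.comp (Primrec.snd.comp (Primrec.fst.comp .fst))
    exact Primrec.option_casesOn (Primrec.fst.comp .fst)
      ((Primrec.option_some.comp .snd).pair (Primrec.snd.comp .fst))
      (Primrec.cond .snd ((Primrec.const none).pair ((Primrec.list_cons.comp hb h1).pair h2))
        ((Primrec.const none).pair (h1.pair (Primrec.list_cons.comp hb h2)))).to₂
  have key : ∀ (y : Str) (a : Str × Str), (y.foldl F (none, a)).2 = parse y a := by
    intro y a
    fun_induction parse y a with
    | case1 f b l a ih => cases f <;> simpa [F] using ih
    | case2 l a h =>
      rcases l with _ | ⟨f, _ | ⟨b, l⟩⟩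
      · rfl
      · rfl
      · exact (h f b l rfl).elim
  exact (Primrec.snd.comp (Primrec.list_foldl .id (.const (none, [], []))
    (hF.comp (Primrec.fst.comp .snd) (Primrec.snd.comp .snd)).to₂)).of_eq fun y => key y _

theorem primrecPred_univ : PrimrecPred fun a : List Str × Str => a.2 ∈ univ {x | x ∈ a.1} := by
  have hp : Primrec fun a : List Str × Str => (parse a.2 ([], [])).1 :=
    Primrec.fst.comp (primrec_parse.comp .snd)
  have hw : Primrec fun a : List Str × Str => (parse a.2 ([], [])).2 :=
    Primrec.snd.comp (primrec_parse.comp .snd)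
  have h : Primrec fun a : List Str × Str => (a.1, (parse a.2 ([], [])).1,
      2 ^ ((parse a.2 ([], [])).1.length + (parse a.2 ([], [])).2.length + 1) - 1,
      0, (parse a.2 ([], [])).2) :=
    Primrec.fst.pair (hp.pair ((Primrec.nat_sub.comp (primrec_pow.comp (.const 2)
      (Primrec.succ.comp (Primrec.nat_add.comp (Primrec.list_length.comp hp)
        (Primrec.list_length.comp hw)))) (.const 1)).pair ((Primrec.const 0).pair hw)))
  exact (Primrec.eq.comp (primrec_verdict.comp h) (.const (some true)) :)

end primrec

/-! ### The use of the oracle -/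

theorem sweep_congr {A B : Set Str} (P : Str) (c : ℕ × Str)
    (h : ∀ u : Str, u.length ≤ c.2.length → (u ∈ A ↔ u ∈ B)) : sweep A P c = sweep B P c := by
  have : (passOver P c).2.2.reverse.length ≤ c.2.length := by
    simpa [passOver] using (foldl_bitStep_length P c.2 (c.1, [], [])).2
  have h := h _ this
  by_cases hA : (passOver P c).2.2.reverse ∈ A
  · simp only [sweep, hA, h.1 hA]
  · simp only [sweep, hA, mt h.2 hA]

/-- The length of the word bounds all queries, whatever the number of sweeps. So even the
exponentially long runs in `univ` use the oracle only on strings not longer than the word. -/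
theorem verdict_congr {A B : Set Str} (P : Str) (T : ℕ) (c : ℕ × Str)
    (h : ∀ u : Str, u.length ≤ c.2.length → (u ∈ A ↔ u ∈ B)) : verdict A P T c = verdict B P T c := by
  induction T generalizing c with
  | zero => rfl
  | succ T ih =>
    simp only [verdict, sweep_congr P c h]
    rw [ih _ (by rwa [sweep_length])]

theorem altList_congr {M : ℕ} {Q Q' : List Str → Prop} (l : ℕ) (ex : Bool) (xs : List Str)
    (h : ∀ ys : List Str, (ys.map List.length).sum ≤ (xs.map List.length).sum + l * M →
      (Q ys ↔ Q' ys)) : AltList M Q l ex xs ↔ AltList M Q' l ex xs := by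
  induction l generalizing ex xs with
  | zero => exact h xs (by simp)
  | succ l ih =>
    have key : ∀ (ex' : Bool) (u : Str), u.length ≤ M →
        (AltList M Q l ex' (xs ++ [u]) ↔ AltList M Q' l ex' (xs ++ [u])) := by
      refine fun ex' u hu => ih _ _ fun ys hys => h ys (hys.trans ?_)
      simp only [List.map_append, List.sum_append, List.map_cons, List.map_nil, List.sum_singleton]
      linarith
    cases ex
    · exact forall_congr' fun u => imp_congr_right fun hu => key _ u hu
    · exact exists_congr fun u => and_congr_right fun hu => key _ u hu

/-- The data of a formula of the polynomial hierarchy in normal form. -/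
abbrev Formula : Type := List Str × Str × ℕ × ℕ × ℕ

/-- The truth of a formula for the string `y`. -/
def Formula.Holds (A : Set Str) (φ : Formula) (y : Str) : Prop :=
  AltList (y.length ^ φ.2.2.2.2 + φ.2.2.2.2) (SweepRel A φ.1 φ.2.1 φ.2.2.1) φ.2.2.2.1 true [y]

/-- A bound for the length of the queries that determine whether a formula errs on `y`. -/
def Formula.useBound (φ : Formula) (y : Str) : ℕ :=
  y.length + (2 * ((y.length + φ.2.2.2.1 * (y.length ^ φ.2.2.2.2 + φ.2.2.2.2)) ^ φ.2.2.1 + φ.2.2.1) + 1) *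
    maxBlock φ.1

/-- The formula does not describe the complete language correctly at `y`. -/
def Formula.Errs (A : Set Str) (φ : Formula) (y : Str) : Prop := ¬ (y ∈ univ A ↔ φ.Holds A y)

/-- The first summand of `useBound` accounts for `univ`; the second bounds the initial word for the
matrix, whose arguments are `y` and strings within the quantifier bound. -/
theorem Formula.errs_congr {A B : Set Str} {φ : Formula} {y : Str}
    (h : ∀ u : Str, u.length ≤ φ.useBound y → (u ∈ A ↔ u ∈ B)) : φ.Errs A y ↔ φ.Errs B y := by
  have h1 : y ∈ univ A ↔ y ∈ univ B := by
    simp only [univ, Set.mem_ofPred_eq]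
    rw [verdict_congr]
    refine fun u hu => h u (hu.trans ?_)
    exact ((length_parse_le y ([], [])).2.trans (by simp)).trans (Nat.le_add_right _ _)
  have h2 : φ.Holds A y ↔ φ.Holds B y := by
    refine altList_congr _ _ _ fun ys hys => ?_
    rw [SweepRel, SweepRel, verdict_congr]
    refine fun u hu => h u (hu.trans ((length_initWord_le _ _ _).trans ?_))
    refine le_trans (Nat.mul_le_mul_right _ ?_) (Nat.le_add_left _ _)
    have : clockBound φ.2.2.1 ys ≤ _ := Nat.add_le_add_right (Nat.pow_le_pow_left hys _) _
    simpa using this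
  rw [Formula.Errs, Formula.Errs, h1, h2]

theorem Formula.primrecPred_holds :
    PrimrecPred fun a : List Str × Formula × Str => a.2.1.Holds {x | x ∈ a.1} a.2.2 := by
  have hφ : Primrec fun a : List Str × Formula × Str => a.2.1 := Primrec.fst.comp .snd
  have hy : Primrec fun a : List Str × Formula × Str => a.2.2 := Primrec.snd.comp .snd
  have hl : Primrec fun a : List Str × Formula × Str => a.2.1.2.2.2.1 :=
    Primrec.fst.comp (Primrec.snd.comp (Primrec.snd.comp (Primrec.snd.comp hφ)))
  have hk : Primrec fun a : List Str × Formula × Str => a.2.1.2.2.2.2 :=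
    Primrec.snd.comp (Primrec.snd.comp (Primrec.snd.comp (Primrec.snd.comp hφ)))
  have hM : Primrec fun a : List Str × Formula × Str => a.2.2.length ^ a.2.1.2.2.2.2 + a.2.1.2.2.2.2 :=
    Primrec.nat_add.comp (primrec_pow.comp (Primrec.list_length.comp hy) hk) hk
  have hφ' : Primrec fun p : (List Str × Formula × Str) × List Str => p.1.2.1 := hφ.comp .fst
  have h : Primrec fun p : (List Str × Formula × Str) × List Str =>
      (p.1.1, p.1.2.1.1, p.1.2.1.2.1, p.1.2.1.2.2.1, p.2) :=
    (Primrec.fst.comp .fst).pair ((Primrec.fst.comp hφ').pair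
      ((Primrec.fst.comp (Primrec.snd.comp hφ')).pair
      ((Primrec.fst.comp (Primrec.snd.comp (Primrec.snd.comp hφ'))).pair .snd)))
  have hQ : PrimrecRel fun (a : List Str × Formula × Str) (xs : List Str) =>
      SweepRel {x | x ∈ a.1} a.2.1.1 a.2.1.2.1 a.2.1.2.2.1 xs := (primrecPred_sweepRel.comp h :)
  exact (primrecPred_altList hM hQ).comp (Primrec.id.pair (hl.pair
    ((Primrec.const true).pair (Primrec.list_cons.comp hy (.const [])))))

theorem Formula.primrecPred_errs :
    PrimrecPred fun a : List Str × Formula × Str => a.2.1.Errs {x | x ∈ a.1} a.2.2 := by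
  classical
  have h : Primrec fun a : List Str × Formula × Str => (a.1, a.2.2) :=
    Primrec.fst.pair (Primrec.snd.comp .snd)
  have h1 : PrimrecPred fun a : List Str × Formula × Str => a.2.2 ∈ univ {x | x ∈ a.1} :=
    (primrecPred_univ.comp h :)
  refine (Primrec.eq.comp h1.decide Formula.primrecPred_holds.decide).not.of_eq fun a => ?_
  rw [Formula.Errs, decide_eq_decide]

theorem Formula.primrec_useBound : Primrec₂ Formula.useBound := by
  have hn : Primrec fun a : Formula × Str => a.2.length := Primrec.list_length.comp .snd
  have hc : Primrec fun a : Formula × Str => a.1.2.2.1 :=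
    Primrec.fst.comp (Primrec.snd.comp (Primrec.snd.comp .fst))
  have hl : Primrec fun a : Formula × Str => a.1.2.2.2.1 :=
    Primrec.fst.comp (Primrec.snd.comp (Primrec.snd.comp (Primrec.snd.comp .fst)))
  have hk : Primrec fun a : Formula × Str => a.1.2.2.2.2 :=
    Primrec.snd.comp (Primrec.snd.comp (Primrec.snd.comp (Primrec.snd.comp .fst)))
  have hM := Primrec.nat_add.comp (primrec_pow.comp hn hk) hk
  have hS := Primrec.nat_add.comp (primrec_pow.comp (Primrec.nat_add.comp hn
    (Primrec.nat_mul.comp hl hM)) hc) hc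
  exact Primrec.nat_add.comp hn (Primrec.nat_mul.comp
    (Primrec.succ.comp (Primrec.nat_mul.comp (.const 2) hS)) (primrec_sum.comp (Primrec.fst.comp .fst)))

/-! ### Oracles given by initial segments -/

/-- The first `n` strings, and those of them that belong to the oracle with the initial segment `σ`. -/
def decided (e : ℕ → Str) (σ : List Bool) : ℕ → List Str × List Str
  | 0 => ([], [])
  | n + 1 => (e n :: (decided e σ n).1,
      bif (σ[n]?).getD false then e n :: (decided e σ n).2 else (decided e σ n).2)

theorem mem_decided_fst {e : ℕ → Str} {σ : List Bool} {n : ℕ} {u : Str} :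
    u ∈ (decided e σ n).1 ↔ ∃ i < n, e i = u := by
  induction n with
  | zero => simp [decided]
  | succ n ih => rw [decided, List.mem_cons, ih, Nat.exists_lt_succ_right, or_comm, eq_comm]

theorem mem_decided_snd {e : ℕ → Str} {σ : List Bool} {n : ℕ} {u : Str} :
    u ∈ (decided e σ n).2 ↔ ∃ i < n, e i = u ∧ (σ[i]?).getD false = true := by
  induction n with
  | zero => simp [decided]
  | succ n ih =>
    rw [Nat.exists_lt_succ_right, ← ih]
    cases h : (σ[n]?).getD false
    · simp [decided, h]
    · simp [decided, h, or_comm, eq_comm]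

/-- Here the computability of the enumeration enters; the evaluation of formulas is primitive
recursive. -/
theorem computable_decided {e : ℕ → Str} (he : Computable e) :
    Computable fun σ : List Bool => decided e σ σ.length := by
  refine (Computable.nat_rec (f := fun σ : List Bool => σ.length) (g := fun _ => (([], []) : List Str × List Str))
    (h := fun σ p => (e p.1 :: p.2.1, bif (σ[p.1]?).getD false then e p.1 :: p.2.2 else p.2.2))
    Computable.list_length (.const _) ?_).of_eq fun σ => ?_
  · have hs : Computable fun a : List Bool × ℕ × List Str × List Str => e a.2.1 :=
      he.comp (Computable.fst.comp .snd)
    have h2 : Computable fun a : List Bool × ℕ × List Str × List Str => a.2.2.2 :=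
      Computable.snd.comp (Computable.snd.comp .snd)
    have hb : Computable fun a : List Bool × ℕ × List Str × List Str => (a.1[a.2.1]?).getD false :=
      (Primrec.option_getD.comp (Primrec.list_getElem?.comp .fst (Primrec.fst.comp .snd))
        (.const false)).to_comp
    exact (Computable.list_cons.comp hs (Computable.fst.comp (Computable.snd.comp .snd))).pair
      (Computable.cond hb (Computable.list_cons.comp hs h2) h2)
  · generalize σ.length = n
    induction n with
    | zero => rfl
    | succ n ih => simp_all [decided]

/-- The initial segment `σ` suffices to see that the formula number `n` errs on `y`. -/
def ErrsBy (e : ℕ → Str) (n : ℕ) (σ : List Bool) (y : Str) : Prop :=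
  (∀ u ∈ allStrs (((Encodable.decode n : Option Formula).getD ([], [], 0, 0, 0)).useBound y),
    u ∈ (decided e σ σ.length).1) ∧
  ((Encodable.decode n : Option Formula).getD ([], [], 0, 0, 0)).Errs
    {x | x ∈ (decided e σ σ.length).2} y

/-- An unbounded search for `y` with a decidable test; the segment `σ` stands for a finite oracle
and for the list of strings that it decides. -/
theorem rePred_errsBy {e : ℕ → Str} (he : Computable e) :
    REPred fun p : ℕ × List Bool => ∃ y, ErrsBy e p.1 p.2 y := by
  classical
  let F : (List Str × List Str) × Formula × Str → Prop := fun a =>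
    (∀ u ∈ allStrs (a.2.1.useBound a.2.2), u ∈ a.1.1) ∧ a.2.1.Errs {x | x ∈ a.1.2} a.2.2
  have hF : PrimrecPred F := by
    refine .and ?_ ?_
    · have h : Primrec fun a : (List Str × List Str) × Formula × Str =>
          allStrs (a.2.1.useBound a.2.2) :=
        primrec_allStrs.comp (Formula.primrec_useBound.comp (Primrec.fst.comp .snd)
          (Primrec.snd.comp .snd))
      have h' : Primrec fun a : (List Str × List Str) × Formula × Str => a.1.1 :=
        Primrec.fst.comp .fst
      exact (primrecRel_mem.forall_mem_list.comp h h' :)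
    · have h : Primrec fun a : (List Str × List Str) × Formula × Str => (a.1.2, a.2) :=
        (Primrec.snd.comp .fst).pair .snd
      exact (Formula.primrecPred_errs.comp h :)
  have hφ : Primrec fun n : ℕ => (Encodable.decode n : Option Formula).getD ([], [], 0, 0, 0) :=
    Primrec.option_getD.comp .decode (.const _)
  have hy : Primrec fun n : ℕ => (Encodable.decode n : Option Str).getD [] :=
    Primrec.option_getD.comp .decode (.const _)
  have hg : Computable fun a : (ℕ × List Bool) × ℕ => (decided e a.1.2 a.1.2.length,
      (Encodable.decode a.1.1 : Option Formula).getD ([], [], 0, 0, 0),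
      (Encodable.decode a.2 : Option Str).getD []) :=
    ((computable_decided he).comp (Computable.snd.comp .fst)).pair
      ((hφ.to_comp.comp (Computable.fst.comp .fst)).pair (hy.to_comp.comp .snd))
  have hc := (hF.decide.to_comp.comp hg).to₂
  refine (Partrec.rfind hc.partrec₂).dom_re.of_eq fun p => ?_
  simp only [Nat.rfind_dom]
  constructor
  · rintro ⟨k, hk, -⟩
    have hk := (Part.mem_some_iff.1 hk).symm
    rw [decide_eq_true_iff] at hk
    exact ⟨_, hk⟩
  · rintro ⟨y, h⟩
    refine ⟨Encodable.encode y, ?_, fun _ => trivial⟩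
    refine Part.mem_some_iff.2 (decide_eq_true ?_).symm
    simp only [Encodable.encodek, Option.getD_some]
    exact h

/-- The use principle: an error depends on finitely many strings, and a sufficiently long segment of
`a` decides them. Conversely, the finite oracle of a segment that decides all of them agrees with
the real one as far as it matters. -/
theorem exists_errsBy_iff (e : ℕ ≃ Str) (n : ℕ) (a : ℕ → Bool) :
    (∃ y, ((Encodable.decode n : Option Formula).getD ([], [], 0, 0, 0)).Errs (oracleOf e a) y) ↔
    ∃ σ : List Bool, (∃ y, ErrsBy e n σ y) ∧ (List.range σ.length).map a = σ := by
  have agree : ∀ (N : ℕ) (u : Str), u ∈ (decided e ((List.range N).map a) N).1 →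
      (u ∈ oracleOf e a ↔ u ∈ (decided e ((List.range N).map a) N).2) := by
    intro N u hu
    obtain ⟨i, hi, rfl⟩ := mem_decided_fst.1 hu
    rw [mem_decided_snd]
    constructor
    · intro h
      exact ⟨i, hi, rfl, by simpa [hi, oracleOf] using h⟩
    · rintro ⟨j, hj, hji, h⟩
      obtain rfl := e.injective hji
      simpa [hi, oracleOf] using h
  generalize hφ : (Encodable.decode n : Option Formula).getD ([], [], 0, 0, 0) = φ
  constructor
  · rintro ⟨y, hy⟩
    obtain ⟨N, hN⟩ : ∃ N, ∀ u ∈ allStrs (φ.useBound y), e.symm u < N := by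
      -- The sum of the indices is at least each of them.
      refine ⟨((allStrs (φ.useBound y)).map e.symm).sum + 1, fun u hu => Nat.lt_succ_of_le ?_⟩
      exact List.single_le_sum (by simp) _ (List.mem_map_of_mem hu)
    have hall : ∀ u ∈ allStrs (φ.useBound y), u ∈ (decided e ((List.range N).map a) N).1 :=
      fun u hu => mem_decided_fst.2 ⟨_, hN u hu, e.apply_symm_apply u⟩
    refine ⟨(List.range N).map a, ⟨y, ?_, ?_⟩, by simp⟩
    · rw [hφ]; simpa using hall
    · rw [hφ]
      refine (Formula.errs_congr fun u hu => ?_).1 hy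
      simpa using agree N u (hall u (mem_allStrs.2 hu))
  · rintro ⟨σ, ⟨y, h1, h2⟩, hσ⟩
    rw [hφ] at h1 h2
    refine ⟨y, (Formula.errs_congr fun u hu => ?_).2 h2⟩
    have := agree σ.length u
    rw [hσ] at this
    exact this (h1 u (mem_allStrs.2 hu))

theorem mem_sepSet_iff (e : ℕ ≃ Str) (a : ℕ → Bool) : a ∈ sepSet e ↔ ∀ n, ∃ σ : List Bool,
    (∃ y, ErrsBy e n σ y) ∧ (List.range σ.length).map a = σ := by
  simp only [← exists_errsBy_iff]
  rw [sepSet, Set.mem_ofPred_eq, PH_ne_PSPACE_iff]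
  constructor
  · intro h n
    exact h _ _ _ _ _
  -- Every formula is decoded from its own code. Numbers that are no codes stand for the default
  -- formula and add no new condition.
  · intro h tab P c l k
    simpa [Formula.Errs, Formula.Holds] using h (Encodable.encode ((tab, P, c, l, k) : Formula))

end OracleSep

/-- For every `n` the condition on `a` defines a union of cylinders, which is open; the sets
`ErrsBy` provide both the recursively enumerable family and the countable intersection of open sets.
-/
theorem mainTheorem11 (e : ℕ ≃ List Bool) (he : Computable e) :
    OracleSep.LightfacePi02 (OracleSep.sepSet e) ∧
      IsGδ (OracleSep.sepSet e) ∧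
      @MeasurableSet (ℕ → Bool) (borel (ℕ → Bool)) (OracleSep.sepSet e) := by
  have hG : IsGδ (OracleSep.sepSet e) := by
    have : OracleSep.sepSet e = ⋂ n, ⋃ σ ∈ {σ : List Bool | ∃ y, OracleSep.ErrsBy e n σ y},
        {a | (List.range σ.length).map a = σ} := by
      ext a
      simp only [OracleSep.mem_sepSet_iff, Set.mem_iInter, Set.mem_iUnion, Set.mem_ofPred_eq, exists_prop]
    rw [this]
    refine .iInter_of_isOpen fun n => isOpen_biUnion fun σ _ => ?_
    -- A cylinder is the preimage of a point under the restriction to finitely many coordinates,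
    -- which is continuous with values in a discrete space.
    have : {a : ℕ → Bool | (List.range σ.length).map a = σ} =
        (fun (a : ℕ → Bool) (i : Fin σ.length) => a i) ⁻¹' {fun i => σ[i]} := by
      ext a
      simp only [Set.mem_ofPred_eq, Set.mem_preimage, Set.mem_singleton_iff, funext_iff]
      constructor
      · intro h i
        have := congrArg (fun l => l[(i : ℕ)]?) h
        simpa using this
      · intro h
        refine List.ext_getElem (by simp) fun i h1 h2 => ?_
        simpa using h ⟨i, h2⟩
    rw [this]
    exact (isOpen_discrete _).preimage (by fun_prop)
  refine ⟨⟨{p | ∃ σ : List Bool, (∃ y, OracleSep.ErrsBy e p.1 σ y) ∧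
    (List.range σ.length).map p.2 = σ}, ⟨_, OracleSep.rePred_errsBy he, fun n a => Iff.rfl⟩,
    OracleSep.mem_sepSet_iff e⟩, hG, ?_⟩
  let : MeasurableSpace (ℕ → Bool) := borel _
  have : BorelSpace (ℕ → Bool) := ⟨rfl⟩
  exact hG.measurableSet
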